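/- Let $\Lambda=\mathbb Z[\lambda^{\pm1},z,\delta]/\langle\lambda^{-1}-\lambda-z(\delta-1)\rangle$ and let $n\ge 0$. An $(n,n)$-tangle is a piece of unoriented knot diagram in a rectangle, consisting of arcs and closed curves, whose arcs end in $n$ standard points at the top and $n$ at the bottom; tangles are considered up to regular isotopy (isotopies of the rectangle fixing its boundary, and Reidemeister moves II and III). Kauffman's tangle algebra $MT_n$, regarded as a $\Lambda$-module, is the quotient of the free $\Lambda$-module on these tangles by the relations 1. $T^+-T^-=z(T^0-T^\infty)$, where the four tangles agree except in a small disc; there $T^+$ is a crossing whose overstring runs from upper left to lower right, $T^-$ is the other crossing, $T^0$ consists of two vertical strings, and $T^\infty$ of a local minimum above a local maximum; 2. $T^{\mathrm{right}}=\lambda^{-1}T$ and $T^{\mathrm{left}}=\lambda T$, where $T^{\mathrm{right}}$ (resp. $T^{\mathrm{left}}$) is obtained from $T$ by adding to a vertical string a curl, with its loop on either side, that consists of one local maximum, one local minimum and between them one crossing of type $T^+$ (resp. $T^-$); 3. $T\amalg O=\delta T$, where $O$ is a circle that has no crossings with $T$ or with itself. An $n$-connector is a pairing of the $2n$ end points into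 $n$ pairs; $C_n$ is the set of $n$-connectors, and $\operatorname{conn}(T)\in C_n$ is the pairing given by the arcs of $T$. A tangle diagram is totally descending for a sequence of base points (first one end point of each arc, then one point on each closed component) if, when its components are traversed from their base points in this order, every crossing is first met as an overcrossing. **Theorem 4.2.** (i) Any family of tangles $\{T_c\}_{c\in C_n}$ without closed components, with $\operatorname{conn}(T_c)=c$ for all $c$, that spans $MT_n$ is a free $\Lambda$-basis of $MT_n$. (ii) For each $c\in C_n$ and each choice, in any order, of one end point from each pair of $c$ as base points, there is a tangle diagram without closed components and with connector $c$ that is totally descending for these base points and in which no arc crosses itself and any two arcs cross at most once. If for each $c\in C_n$ a tangle diagram $T_c$ without closed components, with $\operatorname{conn}(T_c)=c$, is given that is totally descending for some such choice of base points (the choice may depend on $c$), then $\{T_c\}_{c\in C_n}$ is a free $\Lambda$-basis of $MT_n$. (iii) Hence $MT_n$ is a free $\Lambda$-module of rank $(2n-1)!!$ (which is $1$ for $n=0$). -/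

import Mathlib

open scoped LaurentPolynomial

noncomputable section

namespace Kauffman

/-! ### The coefficient ring -/

/-- The Laurent polynomials in `λ = T 1` over `ℤ[z, δ]`, where `z = X 0` and `δ = X 1`. -/
abbrev PreCoeff : Type := (MvPolynomial (Fin 2) ℤ)[T;T⁻¹]

/-- The ring `Λ = ℤ[λ^{±1}, z, δ] / (λ⁻¹ - λ - z (δ - 1))`. -/
abbrev Coeff : Type :=
  PreCoeff ⧸ Ideal.span
    {(LaurentPolynomial.T (-1) - LaurentPolynomial.T 1 -
      LaurentPolynomial.C (MvPolynomial.X 0 * (MvPolynomial.X 1 - 1)) : PreCoeff)}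

/-- The element `λ` of `Λ`. -/
def lam : Coeff := Ideal.Quotient.mk _ (LaurentPolynomial.T 1)

/-- The element `λ⁻¹` of `Λ`. -/
def lamInv : Coeff := Ideal.Quotient.mk _ (LaurentPolynomial.T (-1))

/-- The element `z` of `Λ`. -/
def zee : Coeff := Ideal.Quotient.mk _ (LaurentPolynomial.C (MvPolynomial.X 0))

/-- The element `δ` of `Λ`. -/
def del : Coeff := Ideal.Quotient.mk _ (LaurentPolynomial.C (MvPolynomial.X 1))

/-! ### Tangle diagrams

A tangle diagram in the rectangle, in general position with respect to the height, is read from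
the top to the bottom as a finite sequence of elementary pieces.  Each piece consists of one
crossing, one local minimum or one local maximum, with vertical strings on both sides of it.
Positions are counted from the left, starting with `0`.  Up to isotopy of the rectangle every
tangle diagram arises in this way, closed components included, and two such diagrams are regularly
isotopic exactly if they are related by a sequence of the local moves below (the standard
presentation of unoriented tangle diagrams in Morse position). -/

/-- The elementary pieces, without the vertical strings beside them.
* `cross true` is the crossing at which the string from upper left to lower right is over;
* `cross false` is the crossing at which the string from upper right to lower left is over;
* `cup` is a local minimum, joining two neighbouring strings that come from above;
* `cap` is a local maximum, from which two neighbouring strings go down. -/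
inductive Shape : Type
  | cross (positive : Bool)
  | cup
  | cap

/-- The number of strings that enter the shape from above. -/
def Shape.ins : Shape → ℕ
  | cross _ => 2
  | cup => 2
  | cap => 0

/-- The number of strings that leave the shape downwards. -/
def Shape.outs : Shape → ℕ
  | cross _ => 2
  | cup => 0
  | cap => 2

/-- A shape with `left` vertical strings to the left of it. -/
structure Piece : Type where
  shape : Shape
  left : ℕ

/-- The piece `p` can be put below `m` strings. -/
def Piece.Fits (p : Piece) (m : ℕ) : Prop := p.left + p.shape.ins ≤ m

/-- The number of strings below the piece `p` if there are `m` strings above it. -/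
def Piece.after (p : Piece) (m : ℕ) : ℕ := m - p.shape.ins + p.shape.outs

/-- The sequence of pieces, read from the top, leads from `m` to `n` strings. -/
def Runs : List Piece → ℕ → ℕ → Prop
  | [], m, n => m = n
  | p :: w, m, n => p.Fits m ∧ Runs w (p.after m) n

/-- An `(m, n)`-tangle diagram: `m` end points at the top and `n` at the bottom. -/
structure Diagram (m n : ℕ) : Type where
  word : List Piece
  runs : Runs word m n

/-! ### Regular isotopy -/

/-- The local moves. The first five are isotopies in the rectangle, the last three are
Reidemeister's moves II and III. -/
inductive Move : List Piece → List Piece → Prop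
  /-- Two pieces side by side change their relative height. -/
  | slide (s t : Shape) (i k : ℕ) :
      Move [⟨s, i⟩, ⟨t, i + s.outs + k⟩] [⟨t, i + s.ins + k⟩, ⟨s, i⟩]
  /-- A maximum and a minimum on one string cancel. -/
  | zigzag (i : ℕ) : Move [⟨.cap, i⟩, ⟨.cup, i + 1⟩] []
  | zagzig (i : ℕ) : Move [⟨.cap, i + 1⟩, ⟨.cup, i⟩] []
  /-- A crossing turns round a maximum or a minimum. -/
  | turnCap (ε : Bool) (i : ℕ) :
      Move [⟨.cap, i⟩, ⟨.cross ε, i + 1⟩] [⟨.cap, i + 1⟩, ⟨.cross (!ε), i⟩]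
  | turnCup (ε : Bool) (i : ℕ) :
      Move [⟨.cross ε, i + 1⟩, ⟨.cup, i⟩] [⟨.cross (!ε), i⟩, ⟨.cup, i + 1⟩]
  | reidemeisterTwo (ε : Bool) (i : ℕ) : Move [⟨.cross ε, i⟩, ⟨.cross (!ε), i⟩] []
  | reidemeisterThree (ε : Bool) (i : ℕ) :
      Move [⟨.cross ε, i⟩, ⟨.cross ε, i + 1⟩, ⟨.cross ε, i⟩]
        [⟨.cross ε, i + 1⟩, ⟨.cross ε, i⟩, ⟨.cross ε, i + 1⟩]

/-- Two diagrams differ by one local move. -/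
def Diagram.Step {m n : ℕ} (D E : Diagram m n) : Prop :=
  ∃ u v x y : List Piece, Move x y ∧ D.word = u ++ x ++ v ∧ E.word = u ++ y ++ v

/-- The set `𝒰` of `(m, n)`-tangles up to regular isotopy (the equivalence relation generated by
the local moves). -/
def Tangle (m n : ℕ) : Type := Quot (Diagram.Step (m := m) (n := n))

/-- The tangle represented by a diagram. -/
def Diagram.toTangle {m n : ℕ} (D : Diagram m n) : Tangle m n := Quot.mk _ D

/-! ### Kauffman's tangle module -/

/-- The element of `Λ[𝒰]` given by a diagram. -/
def Diagram.elt {m n : ℕ} (D : Diagram m n) : Tangle m n →₀ Coeff :=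
  Finsupp.single D.toTangle 1

/-- `D` and `E` agree except in one place, where they are `x` and `y`. -/
def Diagram.Differ {m n : ℕ} (x y : List Piece) (D E : Diagram m n) : Prop :=
  ∃ u v : List Piece, D.word = u ++ x ++ v ∧ E.word = u ++ y ++ v

/-- The relators of Kauffman's tangle module, in `Λ[𝒰]`. -/
inductive Relator (m n : ℕ) : (Tangle m n →₀ Coeff) → Prop
  /-- `T⁺ - T⁻ = z (T⁰ - T^∞)` -/
  | skein (u v : List Piece) (i : ℕ) (P N Z I : Diagram m n)
      (hP : P.word = u ++ [⟨.cross true, i⟩] ++ v)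
      (hN : N.word = u ++ [⟨.cross false, i⟩] ++ v)
      (hZ : Z.word = u ++ v)
      (hI : I.word = u ++ [⟨.cup, i⟩, ⟨.cap, i⟩] ++ v) :
      Relator m n (P.elt - N.elt - zee • (Z.elt - I.elt))
  /-- `T^right = λ⁻¹ T`, with the loop of the curl to the left or to the right of the string -/
  | rightCurl (i : ℕ) (K D : Diagram m n)
      (h : K.Differ [⟨.cap, i⟩, ⟨.cross true, i + 1⟩, ⟨.cup, i⟩] [] D ∨
        K.Differ [⟨.cap, i + 1⟩, ⟨.cross true, i⟩, ⟨.cup, i + 1⟩] [] D) :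
      Relator m n (K.elt - lamInv • D.elt)
  /-- `T^left = λ T`, with the loop of the curl to the left or to the right of the string -/
  | leftCurl (i : ℕ) (K D : Diagram m n)
      (h : K.Differ [⟨.cap, i⟩, ⟨.cross false, i + 1⟩, ⟨.cup, i⟩] [] D ∨
        K.Differ [⟨.cap, i + 1⟩, ⟨.cross false, i⟩, ⟨.cup, i + 1⟩] [] D) :
      Relator m n (K.elt - lam • D.elt)
  /-- `T ∐ O = δ T` -/
  | circle (i : ℕ) (K D : Diagram m n) (h : K.Differ [⟨.cap, i⟩, ⟨.cup, i⟩] [] D) :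
      Relator m n (K.elt - del • D.elt)

/-- The `Λ`-module of `(m, n)`-tangles modulo the skein, curl and circle relations. -/
abbrev TangleModule (m n : ℕ) : Type :=
  (Tangle m n →₀ Coeff) ⧸ Submodule.span Coeff {x | Relator m n x}

/-- Kauffman's tangle algebra `MT_n`, as a `Λ`-module. -/
abbrev MT (n : ℕ) : Type := TangleModule n n

/-- The element of `TangleModule m n` represented by a diagram. -/
def Diagram.toMT {m n : ℕ} (D : Diagram m n) : TangleModule m n :=
  Submodule.Quotient.mk D.elt

/-! ### Arcs and connectors -/

/-- The number of strings of `D` at level `k`, that is, below the first `k` pieces. -/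
def Diagram.width {m n : ℕ} (D : Diagram m n) (k : ℕ) : ℕ :=
  (D.word.take k).foldl (fun w p => p.after w) m

/-- The points of the strands of `D` at the levels between consecutive pieces: `(k, j)` is the
point at level `k` and position `j`. Level `0` is the top of the rectangle, level
`D.word.length` the bottom. -/
def Diagram.IsPoint {m n : ℕ} (D : Diagram m n) (p : ℕ × ℕ) : Prop :=
  p.1 ≤ D.word.length ∧ p.2 < D.width p.1

/-- The strands inside the pieces: two points are related if one of the pieces contains a strand
from the one to the other. -/
inductive Diagram.Strand {m n : ℕ} (D : Diagram m n) : ℕ × ℕ → ℕ × ℕ → Prop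
  /-- the strings to the left of the shape -/
  | left (k : ℕ) (p : Piece) (j : ℕ) (hp : D.word[k]? = some p) (hj : j < p.left) :
      Strand D (k, j) (k + 1, j)
  /-- the strings to the right of the shape -/
  | right (k : ℕ) (p : Piece) (j : ℕ) (hp : D.word[k]? = some p)
      (hj : p.left + p.shape.ins + j < D.width k) :
      Strand D (k, p.left + p.shape.ins + j) (k + 1, p.left + p.shape.outs + j)
  /-- the string of a crossing from upper left to lower right -/
  | crossRight (k : ℕ) (ε : Bool) (i : ℕ) (hp : D.word[k]? = some ⟨.cross ε, i⟩) :
      Strand D (k, i) (k + 1, i + 1)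
  /-- the string of a crossing from upper right to lower left -/
  | crossLeft (k : ℕ) (ε : Bool) (i : ℕ) (hp : D.word[k]? = some ⟨.cross ε, i⟩) :
      Strand D (k, i + 1) (k + 1, i)
  | cup (k : ℕ) (i : ℕ) (hp : D.word[k]? = some ⟨.cup, i⟩) : Strand D (k, i) (k, i + 1)
  | cap (k : ℕ) (i : ℕ) (hp : D.word[k]? = some ⟨.cap, i⟩) : Strand D (k + 1, i) (k + 1, i + 1)

/-- Two points are the ends of a strand inside one piece. -/
def Diagram.Adj {m n : ℕ} (D : Diagram m n) (p q : ℕ × ℕ) : Prop := D.Strand p q ∨ D.Strand q p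

/-- Two points lie on the same component of the diagram. -/
def Diagram.Joined {m n : ℕ} (D : Diagram m n) : ℕ × ℕ → ℕ × ℕ → Prop :=
  Relation.ReflTransGen D.Adj

/-- The end points: `inl i` at the top of the rectangle, `inr j` at the bottom. -/
def Diagram.endPt {m n : ℕ} (D : Diagram m n) : Fin m ⊕ Fin n → ℕ × ℕ
  | .inl i => (0, i)
  | .inr j => (D.word.length, j)

/-- Every component of the diagram is an arc. -/
def Diagram.NoClosed {m n : ℕ} (D : Diagram m n) : Prop :=
  ∀ p, D.IsPoint p → ∃ x, D.Joined (D.endPt x) p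

/-- An `n`-connector: a pairing of the `n` points at the top and the `n` points at the bottom into
`n` pairs, given by the map that sends each point to its partner. -/
structure Connector (n : ℕ) : Type where
  partner : Fin n ⊕ Fin n → Fin n ⊕ Fin n
  partner_partner : ∀ x, partner (partner x) = x
  partner_ne : ∀ x, partner x ≠ x

/-- `conn D = c`: the arcs of `D` join the end points that the connector `c` pairs. -/
def Diagram.HasConn {n : ℕ} (D : Diagram n n) (c : Connector n) : Prop :=
  ∀ x, D.Joined (D.endPt x) (D.endPt (c.partner x))

/-! ### Totally descending diagrams -/

/-- The sequence `l` of points traverses a whole component of the diagram, starting from the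
first point of `l`. -/
structure Diagram.Traverses {m n : ℕ} (D : Diagram m n) (l : List (ℕ × ℕ)) : Prop where
  nodup : l.Nodup
  chain : l.IsChain D.Adj
  closed : ∀ p ∈ l, ∀ q, D.Adj p q → q ∈ l

/-- The string at a crossing `ε` in position `i` below level `k` is represented by its upper end:
this is the upper end of the overcrossing string. -/
def overPt (k : ℕ) (ε : Bool) (i : ℕ) : ℕ × ℕ := if ε then (k, i) else (k, i + 1)

/-- The upper end of the undercrossing string. -/
def underPt (k : ℕ) (ε : Bool) (i : ℕ) : ℕ × ℕ := if ε then (k, i + 1) else (k, i)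

/-- `D` is totally descending for the sequence `b` of base points, where `b` consists of one end
point of each arc: there are traversals `A` of the arcs, starting from the points of `b` in this
order, followed by traversals `C` of the closed components, on which each crossing is first met as
an overcrossing. -/
def Diagram.TotallyDescending {m n : ℕ} (D : Diagram m n) (b : List (Fin m ⊕ Fin n)) : Prop :=
  ∃ A C : List (List (ℕ × ℕ)),
    A.map List.head? = b.map (fun x => some (D.endPt x)) ∧
    (∀ l ∈ A ++ C, D.Traverses l) ∧
    (∀ l ∈ C, l ≠ [] ∧ ∀ x, D.endPt x ∉ l) ∧
    (A ++ C).flatten.Nodup ∧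
    (∀ p, p ∈ (A ++ C).flatten ↔ D.IsPoint p) ∧
    ∀ k ε i, D.word[k]? = some ⟨.cross ε, i⟩ →
      (A ++ C).flatten.idxOf (overPt k ε i) < (A ++ C).flatten.idxOf (underPt k ε i)

/-- `b` is a choice, in some order, of one of the two points of each pair of the connector. -/
def Connector.IsBase {n : ℕ} (c : Connector n) (b : List (Fin n ⊕ Fin n)) : Prop :=
  b.Nodup ∧ ∀ x, c.partner x ∈ b ↔ x ∉ b

/-- No component crosses itself, and any two components cross at most once. -/
def Diagram.CrossOnce {m n : ℕ} (D : Diagram m n) : Prop :=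
  (∀ k ε i, D.word[k]? = some ⟨.cross ε, i⟩ → ¬ D.Joined (k, i) (k, i + 1)) ∧
  ∀ k ε i k' ε' i', D.word[k]? = some ⟨.cross ε, i⟩ → D.word[k']? = some ⟨.cross ε', i'⟩ →
    (D.Joined (k, i) (k', i') ∧ D.Joined (k, i + 1) (k', i' + 1) ∨
      D.Joined (k, i) (k', i' + 1) ∧ D.Joined (k, i + 1) (k', i')) →
    k = k'

end Kauffman

end

noncomputable section
namespace Kauffman

/-! ### Words -/

/-! Call a diagram layered if its arcs lie one above the other in disjoint layers. Bending the top
end points down (`foldWord`) turns `(n, n)`-tangles into diagrams from `0` to `2n` strings. There a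
layered word (`Std`) is built by adding maxima one after the other, one leg of each being pulled
over the strings in its way. It is determined by the list of layer labels at its bottom
(`Std.unique`).

Spanning: a layered word followed by a crossing with the higher arc over, by a maximum, or by a
minimum that joins two neighbouring layers is again layered up to a unit (`Std.cross`, `Std.cap`,
`Std.cup`). The piece rises through the layers that it does not touch and is absorbed by a layer
that it touches, through an isotopy or a curl. A crossing of the wrong sign is switched at the cost
of diagrams with fewer crossings, and a closed circle gives `δ`. So every diagram is, modulo
diagrams with fewer crossings, a multiple of the layered diagram with its connector, for every order
of the layers (`exists_lowEq`); induction on the number of crossings then gives spanning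
(`cls_mem_of_std`).

Independence: for each `m` there is a vertex model of orthogonal type with at least `2m` labels over
`ℤ[q, q⁻¹]`, with `z = q - q⁻¹` and `λ = q ^ (1 - 2m)`, obtained from the empty model by adding
pairs of opposite labels (`Model.extend`). It yields functionals on the tangle module, one for each
choice of weights at the bottom (`Model.exists_eval`). At `q = 1` crossings become flips, and a
layered word only tests whether a labelling of the end points respects its pairing
(`Model.Flat.std`). For large `m` one labelling per connector can be chosen such that the matrix of
values becomes the identity at `q = 1`. Its determinant is therefore not zero, and the coefficients
of a linear relation vanish under all these specialisations. They are jointly injective on `Λ`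
(`eq_zero_of_forall_ringHom`): `z` is no zero divisor, `q - q⁻¹` is transcendental and `λ` takes
infinitely many values. Hence layered words form a basis (`coeff_eq_zero_of_sum_std`,
`exists_basis_of_std`).

Consequences: a spanning family of the size of a basis is a basis, because surjective endomorphisms
of finitely generated modules are injective (`exists_basis_of_span`). A totally descending diagram
without closed components is layered up to a unit after folding
(`Diagram.exists_std_of_totallyDescending`): when it is read from the top, the components of the
part already seen are intervals in the time of the traversal, and their order in time is the order
of the layers. Totally descending diagrams with few crossings exist because arcs can be drawn from
innermost pairs outwards (`exists_colored`). The rank is the number of involutions of `2n` points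
without fixed points (`card_connector`). -/

theorem runs_append {x y : List Piece} {m n : ℕ} :
    Runs (x ++ y) m n ↔ ∃ k, Runs x m k ∧ Runs y k n := by
  induction x generalizing m with
  | nil => simp [Runs]
  | cons p x ih => simp [Runs, ih, and_assoc]

theorem Runs.append {x y : List Piece} {m k n : ℕ} (hx : Runs x m k) (hy : Runs y k n) :
    Runs (x ++ y) m n := runs_append.2 ⟨k, hx, hy⟩

theorem Runs.unique {x : List Piece} {m n n' : ℕ} (h : Runs x m n) (h' : Runs x m n') :
    n = n' := by
  induction x generalizing m with
  | nil => exact h.symm.trans h'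
  | cons p x ih => exact ih h.2 h'.2

theorem runs_congr_append {x y v : List Piece} {m k n : ℕ} (hx : Runs x m k) (hy : Runs y m k) :
    Runs (x ++ v) m n ↔ Runs (y ++ v) m n := by
  simp only [runs_append]
  constructor
  · rintro ⟨l, h, h'⟩; exact ⟨k, hy, (h.unique hx) ▸ h'⟩
  · rintro ⟨l, h, h'⟩; exact ⟨k, hx, (h.unique hy) ▸ h'⟩

/-- The word `w` with `j` more vertical strings on its left. -/
def sh (j : ℕ) (w : List Piece) : List Piece := w.map fun p => ⟨p.shape, p.left + j⟩

@[simp] theorem sh_nil (j : ℕ) : sh j [] = [] := rfl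
@[simp] theorem sh_cons (j : ℕ) (s : Shape) (i : ℕ) (w : List Piece) :
    sh j (⟨s, i⟩ :: w) = ⟨s, i + j⟩ :: sh j w := rfl
@[simp] theorem sh_append (j : ℕ) (x y : List Piece) : sh j (x ++ y) = sh j x ++ sh j y :=
  List.map_append
@[simp] theorem sh_zero (w : List Piece) : sh 0 w = w := by simp [sh]
@[simp] theorem sh_sh (i j : ℕ) (w : List Piece) : sh i (sh j w) = sh (j + i) w := by
  simp [sh, Function.comp_def, Nat.add_assoc]

theorem Runs.widen {w : List Piece} {m n : ℕ} (h : Runs w m n) (j r : ℕ) :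
    Runs (sh j w) (j + m + r) (j + n + r) := by
  induction w generalizing m with
  | nil => simp only [Runs] at h; subst h; rfl
  | cons p w ih =>
    obtain ⟨s, i⟩ := p
    simp only [Runs, sh_cons, Piece.Fits, Piece.after] at h ⊢
    refine ⟨by omega, ?_⟩
    have := ih h.2
    convert this using 1
    omega

theorem Runs.sh {w : List Piece} {m n : ℕ} (h : Runs w m n) (j : ℕ) :
    Runs (sh j w) (j + m) (j + n) := h.widen j 0

/-! ### Classes of words -/

/-- The ring `Λ`, with its ring structure sealed. -/
def Scal : Type := Coeff

instance : CommRing Scal := inferInstanceAs (CommRing Coeff)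

/-- The module of `(m, n)`-tangles, with its module structure sealed. -/
def TMod (m n : ℕ) : Type := TangleModule m n

instance (m n : ℕ) : AddCommGroup (TMod m n) := inferInstanceAs (AddCommGroup (TangleModule m n))

instance (m n : ℕ) : Module Scal (TMod m n) := inferInstanceAs (Module Coeff (TangleModule m n))

/-- The element `λ` of `Λ`. -/
def sLam : Scal := lam
/-- The element `λ⁻¹` of `Λ`. -/
def sLamInv : Scal := lamInv
/-- The element `z` of `Λ`. -/
def sZ : Scal := zee
/-- The element `δ` of `Λ`. -/
def sDel : Scal := del

/-- The class of a diagram. -/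
def Diagram.toTMod {m n : ℕ} (D : Diagram m n) : TMod m n := D.toMT

open Classical in
/-- The class of a word in the tangle module, and `0` if the word is not a diagram. -/
def cls (m n : ℕ) (w : List Piece) : TMod m n :=
  if h : Runs w m n then (⟨w, h⟩ : Diagram m n).toTMod else 0

theorem cls_eq {m n : ℕ} {w : List Piece} (h : Runs w m n) :
    cls m n w = (⟨w, h⟩ : Diagram m n).toTMod := dif_pos h

theorem Diagram.toTMod_eq_cls {m n : ℕ} (D : Diagram m n) : D.toTMod = cls m n D.word :=
  (cls_eq D.runs).symm

theorem cls_eq_zero {m n : ℕ} {w : List Piece} (h : ¬ Runs w m n) : cls m n w = 0 := dif_neg h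

theorem toMT_eq_of_step {m n : ℕ} {D E : Diagram m n} (h : D.Step E) : D.toTMod = E.toTMod := by
  have : D.toTangle = E.toTangle := Quot.sound h
  exact congrArg (fun t => (Submodule.Quotient.mk (Finsupp.single t 1) : TangleModule m n)) this

theorem sub_smul_of_relator {m n : ℕ} {D E : Diagram m n} {c : Scal}
    (h : Relator m n (D.elt - (show Coeff from c) • E.elt)) : D.toTMod = c • E.toTMod :=
  sub_eq_zero.1 ((Submodule.Quotient.mk_eq_zero _).2 (Submodule.subset_span h))

theorem skein_of_relator {m n : ℕ} {P N Z I : Diagram m n}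
    (h : Relator m n (P.elt - N.elt - zee • (Z.elt - I.elt))) :
    P.toTMod - N.toTMod = sZ • (Z.toTMod - I.toTMod) :=
  sub_eq_zero.1 ((Submodule.Quotient.mk_eq_zero _).2 (Submodule.subset_span h))

/-- Replacing `x` by `y` below `N` strings multiplies the class by `c`. -/
def Sim (c : Scal) (N : ℕ) (x y : List Piece) : Prop :=
  ∀ (u v : List Piece) (m n : ℕ), Runs u m N → cls m n (u ++ x ++ v) = c • cls m n (u ++ y ++ v)

theorem Sim.refl (N : ℕ) (x : List Piece) : Sim 1 N x x := fun _ _ _ _ _ => by simp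

theorem Sim.trans {c d : Scal} {N : ℕ} {x y w : List Piece} (h : Sim c N x y) (h' : Sim d N y w) :
    Sim (c * d) N x w := fun u v m n hu => by
  rw [h u v m n hu, h' u v m n hu, smul_smul]

theorem Sim.ctx {c : Scal} {N N' : ℕ} {x y : List Piece} (h : Sim c N' x y) {u : List Piece}
    (hu : Runs u N N') (v : List Piece) : Sim c N (u ++ x ++ v) (u ++ y ++ v) :=
  fun a b m n ha => by
    have := h (a ++ u) (v ++ b) m n (ha.append hu)
    simpa only [List.append_assoc] using this

/-- The local argument behind all relations: it suffices to treat diagrams. -/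
theorem Sim.of_diagram {c : Scal} {N N' : ℕ} {x y : List Piece} (hx : Runs x N N')
    (hy : Runs y N N')
    (h : ∀ (u v : List Piece) (m n : ℕ) (D E : Diagram m n), D.word = u ++ x ++ v →
      E.word = u ++ y ++ v → D.toTMod = c • E.toTMod) : Sim c N x y := by
  intro u v m n hu
  -- As `x` and `y` run between the same widths, either both words are diagrams or both classes are
  -- `0`.
  have hxy : Runs (u ++ x ++ v) m n ↔ Runs (u ++ y ++ v) m n :=
    runs_congr_append (hu.append hx) (hu.append hy)
  by_cases hr : Runs (u ++ x ++ v) m n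
  · rw [cls_eq hr, cls_eq (hxy.1 hr)]
    exact h u v m n _ _ rfl rfl
  · rw [cls_eq_zero hr, cls_eq_zero (hxy.not.1 hr), smul_zero]

theorem Sim.of_move {N N' : ℕ} {x y : List Piece} (h : Move x y) (hx : Runs x N N')
    (hy : Runs y N N') : Sim 1 N x y :=
  Sim.of_diagram hx hy fun u v m n D E hD hE => by
    rw [one_smul]; exact toMT_eq_of_step ⟨u, v, x, y, h, hD, hE⟩

/-- Replacing `x` by `y` below `N` strings multiplies the class by a unit. -/
def Eqv (N : ℕ) (x y : List Piece) : Prop := ∃ c : Scalˣ, Sim c N x y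

theorem Eqv.refl (N : ℕ) (x : List Piece) : Eqv N x x := ⟨1, Sim.refl N x⟩

theorem Eqv.of_eq {N : ℕ} {x y : List Piece} (h : x = y) : Eqv N x y := h ▸ Eqv.refl N x

theorem Eqv.symm {N : ℕ} {x y : List Piece} (h : Eqv N x y) : Eqv N y x := by
  obtain ⟨c, h⟩ := h
  refine ⟨c⁻¹, fun u v m n hu => ?_⟩
  rw [h u v m n hu, smul_smul, Units.inv_mul, one_smul]

theorem Eqv.trans {N : ℕ} {x y w : List Piece} (h : Eqv N x y) (h' : Eqv N y w) : Eqv N x w := by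
  obtain ⟨c, h⟩ := h
  obtain ⟨d, h'⟩ := h'
  exact ⟨c * d, by simpa using h.trans h'⟩

theorem Eqv.ctx {N N' : ℕ} {x y : List Piece} (h : Eqv N' x y) {u : List Piece}
    (hu : Runs u N N') (v : List Piece) : Eqv N (u ++ x ++ v) (u ++ y ++ v) := by
  obtain ⟨c, h⟩ := h
  exact ⟨c, h.ctx hu v⟩

theorem Eqv.left {N N' : ℕ} {x y : List Piece} (h : Eqv N' x y) {u : List Piece}
    (hu : Runs u N N') : Eqv N (u ++ x) (u ++ y) := by
  simpa using h.ctx hu []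

theorem Eqv.right {N : ℕ} {x y : List Piece} (h : Eqv N x y) (v : List Piece) :
    Eqv N (x ++ v) (y ++ v) := by
  simpa using h.ctx (u := []) rfl v

theorem Eqv.of_move {N N' : ℕ} {x y : List Piece} (h : Move x y) (hx : Runs x N N')
    (hy : Runs y N N') : Eqv N x y := ⟨1, by simpa using Sim.of_move h hx hy⟩

/-! ### Local relations -/

theorem sLam_mul_sLamInv : sLam * sLamInv = 1 :=
  (map_mul (Ideal.Quotient.mk _) _ _).symm.trans
    ((congrArg _ (by rw [← LaurentPolynomial.T_add]; rfl)).trans (map_one (Ideal.Quotient.mk _)))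

/-- `λ` as a unit. -/
def lamUnit : Scalˣ := ⟨sLam, sLamInv, sLam_mul_sLamInv, by rw [mul_comm]; exact sLam_mul_sLamInv⟩

theorem eqv_slide {N i k : ℕ} (s t : Shape) (h : i + s.ins + k + t.ins ≤ N) :
    Eqv N [⟨s, i⟩, ⟨t, i + s.outs + k⟩] [⟨t, i + s.ins + k⟩, ⟨s, i⟩] := by
  refine Eqv.of_move (N' := N - s.ins - t.ins + s.outs + t.outs) (.slide s t i k) ?_ ?_ <;>
  · simp only [Runs, Piece.Fits, Piece.after]
    omega

theorem eqv_zigzag {N i : ℕ} (h : i < N) : Eqv N [⟨.cap, i⟩, ⟨.cup, i + 1⟩] [] := by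
  refine Eqv.of_move (N' := N) (.zigzag i) ?_ ?_ <;>
  · simp only [Runs, Piece.Fits, Piece.after, Shape.ins, Shape.outs]
    try omega

theorem eqv_zagzig {N i : ℕ} (h : i < N) : Eqv N [⟨.cap, i + 1⟩, ⟨.cup, i⟩] [] := by
  refine Eqv.of_move (N' := N) (.zagzig i) ?_ ?_ <;>
  · simp only [Runs, Piece.Fits, Piece.after, Shape.ins, Shape.outs]
    try omega

theorem eqv_turnCap {N i : ℕ} (ε : Bool) (h : i < N) :
    Eqv N [⟨.cap, i⟩, ⟨.cross ε, i + 1⟩] [⟨.cap, i + 1⟩, ⟨.cross (!ε), i⟩] := by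
  refine Eqv.of_move (N' := N + 2) (.turnCap ε i) ?_ ?_ <;>
  · simp only [Runs, Piece.Fits, Piece.after, Shape.ins, Shape.outs]
    try omega

theorem eqv_turnCup {N i : ℕ} (ε : Bool) (h : i + 2 < N) :
    Eqv N [⟨.cross ε, i + 1⟩, ⟨.cup, i⟩] [⟨.cross (!ε), i⟩, ⟨.cup, i + 1⟩] := by
  refine Eqv.of_move (N' := N - 2) (.turnCup ε i) ?_ ?_ <;>
  · simp only [Runs, Piece.Fits, Piece.after, Shape.ins, Shape.outs]
    try omega

theorem eqv_r2 {N i : ℕ} (ε : Bool) (h : i + 1 < N) :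
    Eqv N [⟨.cross ε, i⟩, ⟨.cross (!ε), i⟩] [] := by
  refine Eqv.of_move (N' := N) (.reidemeisterTwo ε i) ?_ ?_ <;>
  · simp only [Runs, Piece.Fits, Piece.after, Shape.ins, Shape.outs]
    try omega

theorem eqv_r3 {N i : ℕ} (ε : Bool) (h : i + 2 < N) :
    Eqv N [⟨.cross ε, i⟩, ⟨.cross ε, i + 1⟩, ⟨.cross ε, i⟩]
        [⟨.cross ε, i + 1⟩, ⟨.cross ε, i⟩, ⟨.cross ε, i + 1⟩] := by
  refine Eqv.of_move (N' := N) (.reidemeisterThree ε i) ?_ ?_ <;>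
  · simp only [Runs, Piece.Fits, Piece.after, Shape.ins, Shape.outs]
    try omega

theorem eqv_of_relator {N N' : ℕ} {x y : List Piece} (c : Scalˣ) (hx : Runs x N N')
    (hy : Runs y N N')
    (h : ∀ m n (D E : Diagram m n), D.Differ x y E → Relator m n (D.elt - (show Coeff from c.val) • E.elt)) :
    Eqv N x y := by
  refine ⟨c, Sim.of_diagram hx hy fun u v m n D E hD hE => ?_⟩
  exact sub_smul_of_relator (h m n D E ⟨u, v, hD, hE⟩)

theorem eqv_curl {N i : ℕ} (ε : Bool) (h : i < N) :
    Eqv N [⟨.cap, i⟩, ⟨.cross ε, i + 1⟩, ⟨.cup, i⟩] [] := by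
  refine eqv_of_relator (N' := N) (if ε then lamUnit⁻¹ else lamUnit) ?_ ?_ ?_
  · simp only [Runs, Piece.Fits, Piece.after, Shape.ins, Shape.outs]; omega
  · rfl
  · intro m n D E hDE
    cases ε
    · exact .leftCurl i D E (.inl hDE)
    · exact .rightCurl i D E (.inl hDE)

/-- The factor `δ` is not available as a unit, so removing a circle gives a `Sim` and no `Eqv`. -/
theorem sim_circle {N i : ℕ} (h : i ≤ N) : Sim sDel N [⟨.cap, i⟩, ⟨.cup, i⟩] [] := by
  refine Sim.of_diagram (N' := N) ?_ ?_ fun u v m n D E hD hE => ?_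
  · simp only [Runs, Piece.Fits, Piece.after, Shape.ins, Shape.outs]; omega
  · rfl
  · exact sub_smul_of_relator (c := sDel) (.circle i D E ⟨u, v, hD, hE⟩)

theorem cls_skein {N i : ℕ} (h : i + 1 < N) {u v : List Piece} {m : ℕ} (n : ℕ) (hu : Runs u m N) :
    cls m n (u ++ [⟨.cross true, i⟩] ++ v) - cls m n (u ++ [⟨.cross false, i⟩] ++ v) =
      sZ • (cls m n (u ++ v) - cls m n (u ++ [⟨.cup, i⟩, ⟨.cap, i⟩] ++ v)) := by
  have hc : ∀ ε, Runs [⟨.cross ε, i⟩] N N := fun ε => by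
    simp only [Runs, Piece.Fits, Piece.after, Shape.ins, Shape.outs]; omega
  have he : Runs [⟨.cup, i⟩, ⟨.cap, i⟩] N N := by
    simp only [Runs, Piece.Fits, Piece.after, Shape.ins, Shape.outs]; omega
  by_cases hr : Runs v N n
  · have hP := (hu.append (hc true)).append hr
    have hN := (hu.append (hc false)).append hr
    have hI := (hu.append he).append hr
    have hZ := hu.append hr
    have := skein_of_relator (.skein u v i ⟨_, hP⟩ ⟨_, hN⟩ ⟨_, hZ⟩ ⟨_, hI⟩ rfl rfl rfl rfl)
    rw [cls_eq hP, cls_eq hN, cls_eq hI, cls_eq hZ]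
    exact this
  -- If `v` does not run from `N` to `n`, all four words fail to be diagrams and the relation reads
  -- `0 = 0`.
  · have key : ∀ x, Runs x N N → cls m n (u ++ x ++ v) = 0 := fun x hx => by
      refine cls_eq_zero fun hh => hr ?_
      obtain ⟨k, h1, h2⟩ := runs_append.1 hh
      rwa [h1.unique (hu.append hx)] at h2
    have h0 := key [] rfl
    simp only [List.append_nil] at h0
    rw [key _ (hc _), key _ (hc _), key _ he, h0]; simp


/-! ### Interchange -/

/-- A piece can be moved below a word to the right of it. -/
theorem eqv_slide_word {N i : ℕ} (s : Shape) {y : List Piece} (hy : ∀ p ∈ y, i ≤ p.left)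
    {N' : ℕ} (hr : Runs y (N - s.ins) N') (h : i + s.ins ≤ N) :
    Eqv N (⟨s, i⟩ :: sh s.outs y) (sh s.ins y ++ [⟨s, i⟩]) := by
  induction y generalizing N with
  | nil => exact Eqv.refl _ _
  | cons p y ih =>
    obtain ⟨t, j⟩ := p
    obtain ⟨k, rfl⟩ := Nat.exists_eq_add_of_le (hy ⟨t, j⟩ (by simp))
    simp only [Runs, Piece.Fits, Piece.after] at hr
    have hr1 := hr.1
    have h1 : Eqv N [⟨s, i⟩, ⟨t, i + s.outs + k⟩] [⟨t, i + s.ins + k⟩, ⟨s, i⟩] :=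
      eqv_slide s t (by omega)
    have h2 := h1.right (sh s.outs y)
    have h3 := ih (N := N - t.ins + t.outs) (fun p hp => hy p (by simp [hp]))
      (by convert hr.2 using 1; omega) (by have := hr.1; omega)
    have h4 := h3.left (N := N) (u := [⟨t, i + s.ins + k⟩])
      ⟨show i + s.ins + k + t.ins ≤ N by omega, rfl⟩
    have e1 : i + k + s.outs = i + s.outs + k := by omega
    have e2 : i + k + s.ins = i + s.ins + k := by omega
    rw [sh_cons, sh_cons, e1, e2]
    exact h2.trans h4

/-- A piece can be moved below a word to the left of it. -/
theorem eqv_slide_word' {N a a' i : ℕ} (t : Shape) {x : List Piece} (hr : Runs x a a')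
    (h : a + i + t.ins ≤ N) :
    Eqv N (x ++ [⟨t, a' + i⟩]) (⟨t, a + i⟩ :: x) := by
  induction x generalizing N a with
  | nil => simp only [Runs] at hr; subst hr; exact Eqv.refl _ _
  | cons p x ih =>
    obtain ⟨s, j⟩ := p
    have hr' := hr
    simp only [Runs, Piece.Fits, Piece.after] at hr
    have hr1 := hr.1
    have h3 := ih (N := N - s.ins + s.outs) hr.2 (by omega)
    have h4 := h3.left (N := N) (u := [⟨s, j⟩])
      ⟨show j + s.ins ≤ N by omega, rfl⟩
    have h1 := eqv_slide (N := N) (i := j) (k := a - s.ins - j + i) s t (by omega)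
    have e1 : j + s.outs + (a - s.ins - j + i) = a - s.ins + s.outs + i := by omega
    have e2 : j + s.ins + (a - s.ins - j + i) = a + i := by omega
    rw [e1, e2] at h1
    exact h4.trans (h1.right x)

/-- Two words side by side can be interchanged. -/
theorem eqv_interchange {a a' b b' : ℕ} {x y : List Piece} (hx : Runs x a a')
    (hy : Runs y b b') : Eqv (a + b) (x ++ sh a' y) (sh a y ++ x) := by
  induction y generalizing b with
  | nil => simpa using Eqv.refl _ _
  | cons p y ih =>
    obtain ⟨t, i⟩ := p
    have hy' := hy
    simp only [Runs, Piece.Fits, Piece.after] at hy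
    have hy1 := hy.1
    have h1 := (eqv_slide_word' (N := a + b) (i := i) t hx (by omega)).right (sh a' y)
    have h2 := (ih hy.2).left (N := a + b) (u := [⟨t, a + i⟩])
      (by simp only [Runs, Piece.Fits, Piece.after]; omega)
    simp only [sh_cons, List.append_assoc, List.cons_append, List.nil_append,
      Nat.add_comm i] at h1 h2 ⊢
    exact h1.trans h2

/-! ### Strings that are pulled over others -/

/-- The string in position `b` is pulled to the right over `k` other strings. -/
def pullR (b : ℕ) : ℕ → List Piece
  | 0 => []
  | k + 1 => pullR b k ++ [⟨.cross true, b + k⟩]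

/-- The string in position `b + k` is pulled to the left over `k` other strings. -/
def pullL (b : ℕ) : ℕ → List Piece
  | 0 => []
  | k + 1 => ⟨.cross false, b + k⟩ :: pullL b k

/-- An arc is added above everything else. -/
def topArc (a k : ℕ) : List Piece := ⟨.cap, a⟩ :: pullR (a + 1) k

theorem pullR_add (b k l : ℕ) : pullR b (k + l) = pullR b k ++ pullR (b + k) l := by
  induction l with
  | zero => simp [pullR]
  | succ l ih => rw [← Nat.add_assoc, pullR, ih, pullR, List.append_assoc, Nat.add_assoc]

theorem pullR_succ' (b k : ℕ) : pullR b (k + 1) = ⟨.cross true, b⟩ :: pullR (b + 1) k := by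
  rw [Nat.add_comm, pullR_add]; rfl

theorem runs_cross {ε : Bool} {i N : ℕ} (h : i + 1 < N) : Runs [⟨.cross ε, i⟩] N N := by
  simp only [Runs, Piece.Fits, Piece.after, Shape.ins, Shape.outs]; omega

theorem runs_cap {i N : ℕ} (h : i ≤ N) : Runs [⟨.cap, i⟩] N (N + 2) := by
  simp only [Runs, Piece.Fits, Piece.after, Shape.ins, Shape.outs]; omega

theorem runs_pullR {b k N : ℕ} (h : b + k < N) : Runs (pullR b k) N N := by
  induction k with
  | zero => rfl
  | succ k ih => exact (ih (by omega)).append (runs_cross (by omega))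

theorem runs_topArc {a k N : ℕ} (h : a + k ≤ N) : Runs (topArc a k) N (N + 2) :=
  (runs_cap (by omega)).append (y := pullR (a + 1) k) (runs_pullR (by omega))

theorem left_le_of_mem_pullR {b k : ℕ} {p : Piece} (hp : p ∈ pullR b k) : b ≤ p.left := by
  induction k with
  | zero => simp [pullR] at hp
  | succ k ih =>
    simp only [pullR, List.mem_append, List.mem_singleton] at hp
    rcases hp with hp | rfl
    · exact ih hp
    · simp

theorem sh_pullR (j b k : ℕ) : sh j (pullR b k) = pullR (b + j) k := by
  induction k with
  | zero => rfl
  | succ k ih =>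
    rw [pullR, sh_append, ih, pullR, sh_cons, sh_nil]
    congr 3; omega

theorem sh_topArc (j a k : ℕ) : sh j (topArc a k) = topArc (a + j) k := by
  rw [topArc, sh_cons, sh_pullR, topArc]; congr 2; omega

/-- A piece moves past a pulled string to the right of it. -/
theorem eqv_piece_pullR {N i b k : ℕ} (s : Shape) (h : i + s.ins ≤ b) (hN : b + k < N) :
    Eqv N (pullR b k ++ [⟨s, i⟩]) (⟨s, i⟩ :: pullR (b - s.ins + s.outs) k) := by
  have := eqv_slide_word (N := N) (i := i) s (y := pullR (b - s.ins) k) (N' := N - s.ins)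
    (fun p hp => (by have := left_le_of_mem_pullR hp; omega)) (runs_pullR (by omega)) (by omega)
  rw [sh_pullR, sh_pullR] at this
  convert this.symm using 3; omega

/-- A piece moves past a pulled string to the left of it. -/
theorem eqv_pullR_piece {N i b k : ℕ} (s : Shape) (h : b + k < i) (hN : i + s.ins ≤ N) :
    Eqv N (pullR b k ++ [⟨s, i⟩]) (⟨s, i⟩ :: pullR b k) := by
  have := eqv_slide_word' (N := N) (a := b + k + 1) (a' := b + k + 1) (i := i - (b + k + 1)) s
    (x := pullR b k) (runs_pullR (by omega)) (by omega)
  rwa [show b + k + 1 + (i - (b + k + 1)) = i by omega] at this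

/-- Far to the right of the arc the piece commutes with it; its position below is larger by `2`
since the arc has added two strings on its left. -/
theorem eqv_topArc_piece {N i a k : ℕ} (s : Shape) (h : a + k ≤ i) (hN : i + s.ins ≤ N) :
    Eqv N (topArc a k ++ [⟨s, i + 2⟩]) (⟨s, i⟩ :: topArc a k) := by
  have := eqv_slide_word' (N := N) (a := a + k) (a' := a + k + 2) (i := i - (a + k)) s
    (x := topArc a k) (runs_topArc (by omega)) (by omega)
  rwa [show a + k + 2 + (i - (a + k)) = i + 2 by omega,
    show a + k + (i - (a + k)) = i by omega] at this

theorem eqv_piece_topArc {N i a k : ℕ} (s : Shape) (h : i + s.ins ≤ a) (hN : a + k ≤ N) :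
    Eqv N (topArc a k ++ [⟨s, i⟩]) (⟨s, i⟩ :: topArc (a - s.ins + s.outs) k) := by
  have := eqv_slide_word (N := N) (i := i) s (y := topArc (a - s.ins) k) (N' := N - s.ins + 2)
    (fun p hp => by
      simp only [topArc, List.mem_cons] at hp
      rcases hp with rfl | hp
      · simp only; omega
      · have := left_le_of_mem_pullR hp; omega) (runs_topArc (by omega)) (by omega)
  rw [sh_topArc, sh_topArc] at this
  convert this.symm using 3; omega

/-- Reidemeister move III for a string over a crossing of any sign. -/
theorem eqv_r3' {N i : ℕ} (ε : Bool) (h : i + 2 < N) :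
    Eqv N [⟨.cross true, i⟩, ⟨.cross true, i + 1⟩, ⟨.cross ε, i⟩]
      [⟨.cross ε, i + 1⟩, ⟨.cross true, i⟩, ⟨.cross true, i + 1⟩] := by
  cases ε with
  | true => exact eqv_r3 true h
  | false =>
    -- A cancelling pair is inserted at `i + 1`, so that the move for positive crossings applies;
    -- afterwards a pair at `i` cancels.
    have h1 : Eqv N [⟨.cross true, i⟩, ⟨.cross true, i + 1⟩, ⟨.cross false, i⟩]
        [⟨.cross false, i + 1⟩, ⟨.cross true, i + 1⟩, ⟨.cross true, i⟩, ⟨.cross true, i + 1⟩,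
          ⟨.cross false, i⟩] :=
      ((eqv_r2 (i := i + 1) false (by omega)).symm).right
        [⟨.cross true, i⟩, ⟨.cross true, i + 1⟩, ⟨.cross false, i⟩]
    have h2 := ((eqv_r3 (N := N) true h).symm.ctx (u := [⟨.cross false, i + 1⟩])
      (runs_cross (by omega))) [⟨.cross false, i⟩]
    have h3 := (eqv_r2 (N := N) (i := i) true (by omega)).left
      (u := [⟨.cross false, i + 1⟩, ⟨.cross true, i⟩, ⟨.cross true, i + 1⟩])
      (((runs_cross (ε := false) (i := i + 1) (by omega)).append
        (runs_cross (ε := true) (i := i) (by omega))).append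
        (runs_cross (ε := true) (i := i + 1) (by omega)))
    exact h1.trans (h2.trans h3)

/-- A string is pulled over a crossing. -/
theorem eqv_pullR_cross {N b k j : ℕ} (ε : Bool) (h : b ≤ j) (h' : j + 2 ≤ b + k)
    (hN : b + k < N) :
    Eqv N (pullR b k ++ [⟨.cross ε, j⟩]) (⟨.cross ε, j + 1⟩ :: pullR b k) := by
  obtain ⟨l, rfl⟩ := Nat.exists_eq_add_of_le h
  obtain ⟨r, rfl⟩ := Nat.exists_eq_add_of_le (show l + 2 ≤ k by omega)
  have e : pullR b (l + 2 + r) =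
      pullR b l ++ [⟨.cross true, b + l⟩, ⟨.cross true, b + l + 1⟩] ++ pullR (b + l + 2) r := by
    rw [pullR_add, pullR_add]; rfl
  have r1 : Runs (pullR b l) N N := runs_pullR (by omega)
  have r2 : Runs [⟨.cross true, b + l⟩, ⟨.cross true, b + l + 1⟩] N N :=
    (runs_cross (by omega)).append (runs_cross (by omega))
  have h1 := (eqv_piece_pullR (N := N) (i := b + l) (b := b + l + 2) (k := r) (.cross ε)
    (by simp [Shape.ins]) (by omega)).left (r1.append r2)
  have h2 := (eqv_r3' (N := N) (i := b + l) ε (by omega)).ctx r1 (pullR (b + l + 2) r)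
  have h3 := (eqv_pullR_piece (N := N) (i := b + l + 1) (b := b) (k := l) (.cross ε) (by omega)
    (by simp only [Shape.ins]; omega)).right
    ([⟨.cross true, b + l⟩, ⟨.cross true, b + l + 1⟩] ++ pullR (b + l + 2) r)
  rw [e]
  simp only [List.append_assoc, List.cons_append, List.nil_append, Shape.ins, Shape.outs,
    Nat.add_sub_cancel] at h1 h2 h3 ⊢
  exact h1.trans (h2.trans h3)

/-- A string is pulled over a maximum. -/
theorem eqv_pullR_cap {N b k i : ℕ} (h : b ≤ i) (h' : i ≤ b + k) (hN : b + k < N) :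
    Eqv N (pullR b k ++ [⟨.cap, i⟩]) (⟨.cap, i + 1⟩ :: pullR b (k + 2)) := by
  obtain ⟨l, rfl⟩ := Nat.exists_eq_add_of_le h
  obtain ⟨r, rfl⟩ := Nat.exists_eq_add_of_le (show l ≤ k by omega)
  have e : pullR b (l + r + 2) =
      pullR b l ++ [⟨.cross true, b + l⟩, ⟨.cross true, b + l + 1⟩] ++ pullR (b + l + 2) r := by
    rw [show l + r + 2 = l + 2 + r by omega, pullR_add, pullR_add]; rfl
  have r1 : Runs (pullR b l) N N := runs_pullR (by omega)
  have h1 := (eqv_piece_pullR (N := N) (i := b + l) (b := b + l) (k := r) .cap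
    (by simp [Shape.ins]) (by omega)).left r1
  -- A cancelling pair of crossings is created below the right leg of the maximum, and the upper one
  -- is turned round the maximum.
  have h0 : Eqv N [⟨.cap, b + l⟩]
      [⟨.cap, b + l + 1⟩, ⟨.cross true, b + l⟩, ⟨.cross true, b + l + 1⟩] := by
    have a1 := ((eqv_r2 (N := N + 2) (i := b + l + 1) false (by omega)).left
      (runs_cap (i := b + l) (N := N) (by omega))).symm
    have a2 := (eqv_turnCap (N := N) (i := b + l) false (by omega)).right
      [⟨.cross true, b + l + 1⟩]
    exact a1.trans a2
  have h2 := h0.ctx r1 (pullR (b + l + 2) r)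
  have h3 := (eqv_pullR_piece (N := N) (i := b + l + 1) (b := b) (k := l) .cap (by omega)
    (by simp only [Shape.ins]; omega)).right
    ([⟨.cross true, b + l⟩, ⟨.cross true, b + l + 1⟩] ++ pullR (b + l + 2) r)
  rw [pullR_add, e]
  simp only [List.append_assoc, List.cons_append, List.nil_append, Shape.ins, Shape.outs,
    Nat.sub_zero] at h1 h2 h3 ⊢
  exact h1.trans (h2.trans h3)

/-- A string is pulled over a minimum. -/
theorem eqv_pullR_cup {N b k i : ℕ} (h : b ≤ i) (h' : i + 2 ≤ b + k) (hN : b + k < N) :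
    Eqv N (pullR b k ++ [⟨.cup, i⟩]) (⟨.cup, i + 1⟩ :: pullR b (k - 2)) := by
  obtain ⟨l, rfl⟩ := Nat.exists_eq_add_of_le h
  obtain ⟨r, rfl⟩ := Nat.exists_eq_add_of_le (show l + 2 ≤ k by omega)
  have e : pullR b (l + 2 + r) =
      pullR b l ++ [⟨.cross true, b + l⟩, ⟨.cross true, b + l + 1⟩] ++ pullR (b + l + 2) r := by
    rw [pullR_add, pullR_add]; rfl
  have r1 : Runs (pullR b l) N N := runs_pullR (by omega)
  have r2 : Runs [⟨.cross true, b + l⟩, ⟨.cross true, b + l + 1⟩] N N :=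
    (runs_cross (by omega)).append (runs_cross (by omega))
  have h1 := (eqv_piece_pullR (N := N) (i := b + l) (b := b + l + 2) (k := r) .cup
    (by simp [Shape.ins]) (by omega)).left (r1.append r2)
  -- The lower crossing is turned round the minimum and becomes the inverse of the upper one.
  have h0 : Eqv N [⟨.cross true, b + l⟩, ⟨.cross true, b + l + 1⟩, ⟨.cup, b + l⟩]
      [⟨.cup, b + l + 1⟩] := by
    have a1 := (eqv_turnCup (N := N) (i := b + l) true (by omega)).left
      (runs_cross (ε := true) (i := b + l) (N := N) (by omega))
    have a2 := (eqv_r2 (N := N) (i := b + l) true (by omega)).right [⟨.cup, b + l + 1⟩]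
    exact a1.trans a2
  have h2 := h0.ctx r1 (pullR (b + l) r)
  have h3 := (eqv_pullR_piece (N := N) (i := b + l + 1) (b := b) (k := l) .cup (by omega)
    (by simp only [Shape.ins]; omega)).right (pullR (b + l) r)
  rw [e, show l + 2 + r - 2 = l + r by omega, pullR_add]
  simp only [List.append_assoc, List.cons_append, List.nil_append, Shape.ins, Shape.outs,
    Nat.add_sub_cancel, Nat.add_zero] at h1 h2 h3 ⊢
  exact h1.trans (h2.trans h3)

/-! ### The top arc and the piece below it -/

/-- The crossing passes up under the pulled leg and then slides beside the maximum. Under the arc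
only its left end lies to the left, hence the shift from `j + 1` to `j`. -/
theorem eqv_topArc_cross {N a k j : ℕ} (ε : Bool) (h : a ≤ j) (h' : j + 2 ≤ a + k)
    (hN : a + k ≤ N) :
    Eqv N (topArc a k ++ [⟨.cross ε, j + 1⟩]) (⟨.cross ε, j⟩ :: topArc a k) := by
  have h1 := (eqv_pullR_cross (N := N + 2) (b := a + 1) (k := k) (j := j + 1) ε (by omega)
    (by omega) (by omega)).left (runs_cap (i := a) (N := N) (by omega))
  have h2 := (eqv_slide (N := N) (i := a) (k := j - a) .cap (.cross ε)
    (by simp only [Shape.ins]; omega)).right (pullR (a + 1) k)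
  simp only [Shape.ins, Shape.outs, show a + 2 + (j - a) = j + 1 + 1 by omega,
    show a + 0 + (j - a) = j by omega] at h2
  exact h1.trans h2

theorem eqv_topArc_cap {N a k j : ℕ} (h : a ≤ j) (h' : j ≤ a + k) (hN : a + k ≤ N) :
    Eqv N (topArc a k ++ [⟨.cap, j + 1⟩]) (⟨.cap, j⟩ :: topArc a (k + 2)) := by
  have h1 := (eqv_pullR_cap (N := N + 2) (b := a + 1) (k := k) (i := j + 1) (by omega)
    (by omega) (by omega)).left (runs_cap (i := a) (N := N) (by omega))
  have h2 := (eqv_slide (N := N) (i := a) (k := j - a) .cap .cap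
    (by simp only [Shape.ins]; omega)).right (pullR (a + 1) (k + 2))
  simp only [Shape.ins, Shape.outs, show a + 2 + (j - a) = j + 1 + 1 by omega,
    show a + 0 + (j - a) = j by omega] at h2
  exact h1.trans h2

theorem eqv_topArc_cup {N a k j : ℕ} (h : a ≤ j) (h' : j + 2 ≤ a + k) (hN : a + k ≤ N) :
    Eqv N (topArc a k ++ [⟨.cup, j + 1⟩]) (⟨.cup, j⟩ :: topArc a (k - 2)) := by
  have h1 := (eqv_pullR_cup (N := N + 2) (b := a + 1) (k := k) (i := j + 1) (by omega)
    (by omega) (by omega)).left (runs_cap (i := a) (N := N) (by omega))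
  have h2 := (eqv_slide (N := N) (i := a) (k := j - a) .cap .cup
    (by simp only [Shape.ins]; omega)).right (pullR (a + 1) (k - 2))
  simp only [Shape.ins, Shape.outs, show a + 2 + (j - a) = j + 1 + 1 by omega,
    show a + 0 + (j - a) = j by omega] at h2
  exact h1.trans h2

/-- The left end of the arc goes over its left neighbour; turned round the maximum, this crossing
becomes the first one of a longer pull. -/
theorem eqv_topArc_left {N a k : ℕ} (hN : a + 1 + k ≤ N) :
    Eqv N (topArc (a + 1) k ++ [⟨.cross false, a⟩]) (topArc a (k + 1)) := by
  have h1 := (eqv_piece_pullR (N := N + 2) (i := a) (b := a + 2) (k := k) (.cross false)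
    (by simp [Shape.ins]) (by omega)).left (runs_cap (i := a + 1) (N := N) (by omega))
  have h2 := ((eqv_turnCap (N := N) (i := a) true (by omega)).symm).right (pullR (a + 2) k)
  rw [topArc, topArc, pullR_succ']
  exact h1.trans h2

theorem eqv_topArc_right {N a k : ℕ} (hN : a + (k + 1) ≤ N) :
    Eqv N (topArc a (k + 1) ++ [⟨.cross true, a⟩]) (topArc (a + 1) k) := by
  have h1 := ((eqv_topArc_left (N := N) (a := a) (k := k) (by omega)).symm).right
    [⟨.cross true, a⟩]
  have h2 := (eqv_r2 (N := N + 2) (i := a) false (by omega)).left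
    (runs_topArc (a := a + 1) (k := k) (N := N) (by omega))
  simp only [List.append_assoc, List.append_nil] at h1 h2
  exact h1.trans h2

theorem eqv_topArc_shorten {N a k : ℕ} (hN : a + (k + 1) ≤ N) :
    Eqv N (topArc a (k + 1) ++ [⟨.cross false, a + k + 1⟩]) (topArc a k) := by
  have h2 := (eqv_r2 (N := N + 2) (i := a + k + 1) true (by omega)).left
    (runs_topArc (a := a) (k := k) (N := N) (by omega))
  simpa [topArc, pullR, show a + 1 + k = a + k + 1 by omega] using h2

theorem topArc_lengthen (a k : ℕ) : topArc a k ++ [⟨.cross true, a + k + 1⟩] = topArc a (k + 1) := by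
  simp [topArc, pullR, show a + 1 + k = a + k + 1 by omega]

/-- A crossing below a maximum is a curl. -/
theorem eqv_cap_curl {N a : ℕ} (ε : Bool) (h : a ≤ N) :
    Eqv N [⟨.cap, a⟩, ⟨.cross ε, a⟩] [⟨.cap, a⟩] := by
  have r := runs_cap (i := a) (N := N) h
  have r' := r.append (runs_cap (i := a + 1) (N := N + 2) (by omega))
  have h1 := (eqv_curl (N := N + 2) (i := a) (!ε) (by omega)).left r
  have h2 := (eqv_slide (N := N) (i := a) (k := 0) .cap .cap (by simpa [Shape.ins])).right
    [⟨.cross (!ε), a + 1⟩, ⟨.cup, a⟩]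
  have h3 := (eqv_turnCap (N := N + 2) (i := a + 1) ε (by omega)).ctx r [⟨.cup, a⟩]
  have h4 := (eqv_slide (N := N + 4) (i := a) (k := 0) .cup (.cross ε)
    (by simp only [Shape.ins]; omega)).left r'
  have h5 := (eqv_zagzig (N := N + 2) (i := a) (by omega)).ctx r [⟨.cross ε, a⟩]
  -- A zigzag is inserted, and the crossing is moved past its minimum and turned round its maximum,
  -- until a curl on a vertical string appears.
  exact h5.symm.trans (h4.trans (h3.trans (h2.trans h1)))

/-- A crossing above a minimum is a curl. -/
theorem eqv_cup_curl {N a : ℕ} (ε : Bool) (h : a + 1 < N) :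
    Eqv N [⟨.cross ε, a⟩, ⟨.cup, a⟩] [⟨.cup, a⟩] := by
  have r := runs_cap (i := a) (N := N) (by omega)
  have h1 := (eqv_curl (N := N) (i := a) (!ε) (by omega)).right [⟨.cup, a⟩]
  have h2 := (eqv_slide (N := N + 2) (i := a) (k := 0) .cup .cup
    (by simp only [Shape.ins]; omega)).left
    (r.append (runs_cross (ε := !ε) (i := a + 1) (by omega)))
  have h3 := (eqv_turnCup (N := N + 2) (i := a + 1) ε (by omega)).ctx r [⟨.cup, a⟩]
  have h4 := (eqv_slide (N := N) (i := a) (k := 0) .cap (.cross ε)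
    (by simp only [Shape.ins]; omega)).right [⟨.cup, a + 1⟩, ⟨.cup, a⟩]
  have h5 := (eqv_zigzag (N := N) (i := a) (by omega)).ctx
    (runs_cross (ε := ε) (i := a) (by omega)) [⟨.cup, a⟩]
  exact h5.symm.trans (h4.symm.trans (h3.trans (h2.symm.trans h1)))

/-- The right end of the top arc is joined to the string on its right. -/
theorem eqv_topArc_join_right {N a k : ℕ} (hN : a + k < N) :
    Eqv N (topArc a k ++ [⟨.cup, a + k + 1⟩]) (pullL a k) := by
  induction k with
  | zero => exact eqv_zigzag (by omega)
  | succ k ih =>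
    have h1 := (eqv_turnCup (N := N + 2) (i := a + k + 1) false (by omega)).symm.left
      (runs_topArc (a := a) (k := k) (N := N) (by omega))
    have h2 := (eqv_topArc_piece (N := N) (i := a + k) (a := a) (k := k) (.cross false) le_rfl
      (by simp only [Shape.ins]; omega)).right [⟨.cup, a + k + 1⟩]
    have h3 := (ih (by omega)).left (runs_cross (ε := false) (i := a + k) (N := N) (by omega))
    have e := topArc_lengthen a k
    rw [← e]
    simp only [List.append_assoc, List.cons_append, List.nil_append] at h1 h2 h3 ⊢
    exact h1.trans (h2.trans h3)

/-- The left end of the top arc is joined to the string on its left. -/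
theorem eqv_topArc_join_left {N b k : ℕ} (hN : b + 1 + k ≤ N) :
    Eqv N (topArc (b + 1) k ++ [⟨.cup, b⟩]) (pullR b k) := by
  have h1 := (eqv_piece_pullR (N := N + 2) (i := b) (b := b + 2) (k := k) .cup
    (by simp [Shape.ins]) (by omega)).left (runs_cap (i := b + 1) (N := N) (by omega))
  have h2 := (eqv_zagzig (N := N) (i := b) (by omega)).right (pullR b k)
  exact h1.trans h2

/-- The left end of the top arc is joined to the string on its right. -/
theorem eqv_topArc_join_left' {N a k : ℕ} (hN : a + (k + 1) ≤ N) :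
    Eqv N (topArc a (k + 1) ++ [⟨.cup, a⟩]) (pullR a k) := by
  have h1 := (eqv_piece_pullR (N := N + 2) (i := a) (b := a + 2) (k := k) .cup
    (by simp [Shape.ins]) (by omega)).left ((runs_cap (i := a) (N := N) (by omega)).append
      (runs_cross (ε := true) (i := a + 1) (by omega)))
  have h2 := (eqv_curl (N := N) (i := a) true (by omega)).right (pullR a k)
  rw [topArc, pullR_succ']
  exact h1.trans h2

/-- The right end of the top arc is joined to the string on its left. -/
theorem eqv_topArc_join_right' {N a k : ℕ} (hN : a + (k + 1) ≤ N) :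
    Eqv N (topArc a (k + 1) ++ [⟨.cup, a + k + 1⟩]) (pullL a k) := by
  have h1 := (eqv_cup_curl (N := N + 2) (a := a + k + 1) true (by omega)).left
    (runs_topArc (a := a) (k := k) (N := N) (by omega))
  have h2 := eqv_topArc_join_right (N := N) (a := a) (k := k) (by omega)
  rw [← topArc_lengthen]
  simp only [List.append_assoc, List.cons_append, List.nil_append] at h1 h2 ⊢
  exact h1.trans h2


/-! ### Layered words -/

/-- `Std l s` means that the word `s`, from `0` to `l.length` strings, consists of arcs lying in
layers one above the other.  The arcs are labelled, smaller labels lie higher, and `l` is the list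
of the labels at the bottom of the diagram. -/
inductive Std : List ℕ → List Piece → Prop
  | nil : Std [] []
  | cons (u v w : List ℕ) (a : ℕ) (s : List Piece) (h : Std (u ++ v ++ w) s)
      (ha : ∀ y ∈ u ++ v ++ w, a < y) :
      Std (u ++ a :: (v ++ a :: w)) (s ++ topArc u.length v.length)

/-- Each label occurs twice. -/
def Double (l : List ℕ) : Prop := ∀ x ∈ l, l.count x = 2

theorem Std.runs {l : List ℕ} {s : List Piece} (h : Std l s) : Runs s 0 l.length := by
  induction h with
  | nil => rfl
  | cons u v w a s h ha ih =>
    refine ih.append ?_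
    convert runs_topArc (N := (u ++ v ++ w).length) _ using 1
    · simp only [List.length_append, List.length_cons]; omega
    · simp only [List.length_append]; omega

theorem Std.double {l : List ℕ} {s : List Piece} (h : Std l s) : Double l := by
  induction h with
  | nil => simp [Double]
  | cons u v w a s h ha ih =>
    intro x hx
    by_cases hxa : x = a
    · subst hxa
      have : ∀ t : List ℕ, (∀ y ∈ t, x < y) → t.count x = 0 := fun t ht =>
        List.count_eq_zero.2 fun hm => lt_irrefl _ (ht x hm)
      have h1 := this u fun y hy => ha y (by simp [hy])
      have h2 := this v fun y hy => ha y (by simp [hy])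
      have h3 := this w fun y hy => ha y (by simp [hy])
      simp [List.count_append, h1, h2, h3]
    · have := ih x (by simp [hxa] at hx; simpa using hx)
      simp only [List.count_append, List.count_cons, beq_iff_eq, Ne.symm hxa, if_false] at this ⊢
      omega

/-- Only the order of the labels enters the construction. -/
theorem Std.map {l : List ℕ} {s : List Piece} (h : Std l s) {f : ℕ → ℕ}
    (hf : StrictMonoOn f {x | x ∈ l}) : Std (l.map f) s := by
  induction h with
  | nil => exact .nil
  | cons u v w a s h ha ih =>
    have h1 := ih (hf.mono fun x hx => by
      simp only [Set.mem_ofPred_eq, List.mem_append, List.mem_cons] at hx ⊢; tauto)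
    have h2 := Std.cons (u.map f) (v.map f) (w.map f) (f a) s (by simpa using h1) (by
      intro y hy
      rw [← List.map_append, ← List.map_append, List.mem_map] at hy
      obtain ⟨x, hx, rfl⟩ := hy
      refine hf ?_ ?_ (ha x hx)
      · simp
      · simp only [Set.mem_ofPred_eq, List.mem_append, List.mem_cons] at hx ⊢; tauto)
    simpa using h2

theorem Std.congr {l l' : List ℕ} {s : List Piece} (h : Std l s) (e : l = l') : Std l' s := e ▸ h

/-- A position between two strings lies to the left of the top arc, between its ends, or to the
right of it. -/
theorem append_eq_split {α : Type*} {u w p v r : List α} {a : α}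
    (h : u ++ w = p ++ a :: (v ++ a :: r)) :
    (∃ t, p = u ++ t ∧ w = t ++ a :: (v ++ a :: r)) ∨
    (∃ t t', v = t ++ t' ∧ u = p ++ a :: t ∧ w = t' ++ a :: r) ∨
    (∃ t, r = t ++ w ∧ u = p ++ a :: (v ++ a :: t)) := by
  rcases List.append_eq_append_iff.1 h with ⟨t, h1, h2⟩ | ⟨t, h1, h2⟩
  · exact .inl ⟨t, h1, h2⟩
  · rcases List.cons_eq_append_iff.1 h2 with ⟨rfl, h3⟩ | ⟨t', rfl, h3⟩
    · exact .inl ⟨[], by simpa using h1.symm, h3⟩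
    · rcases List.append_eq_append_iff.1 h3 with ⟨c, h4, h5⟩ | ⟨c, h4, h5⟩
      · rcases List.cons_eq_append_iff.1 h5 with ⟨rfl, h6⟩ | ⟨c', rfl, h6⟩
        · exact .inr (.inl ⟨v, [], by simp, by simp [h1, h4], by simpa using h6⟩)
        · exact .inr (.inr ⟨c', h6, by simp [h1, h4]⟩)
      · exact .inr (.inl ⟨t', c, h4, h1, h5⟩)

/-- The eight positions of two neighbouring strings relative to the two ends of the top arc: three
avoid the ends, five involve at least one. -/
theorem append_cons_cons_eq_split {α : Type*} {u w p v r : List α} {a x y : α}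
    (h : u ++ x :: y :: w = p ++ a :: (v ++ a :: r)) :
    (∃ t, p = u ++ x :: y :: t ∧ w = t ++ a :: (v ++ a :: r)) ∨
    (p = u ++ [x] ∧ y = a ∧ w = v ++ a :: r) ∨
    (x = a ∧ u = p ∧ v = [] ∧ y = a ∧ w = r) ∨
    (∃ t, x = a ∧ u = p ∧ v = y :: t ∧ w = t ++ a :: r) ∨
    (∃ t t', v = t ++ x :: y :: t' ∧ u = p ++ a :: t ∧ w = t' ++ a :: r) ∨
    (∃ t, v = t ++ [x] ∧ y = a ∧ u = p ++ a :: t ∧ w = r) ∨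
    (x = a ∧ u = p ++ a :: v ∧ r = y :: w) ∨
    (∃ t, r = t ++ x :: y :: w ∧ u = p ++ a :: (v ++ a :: t)) := by
  rcases append_eq_split h with ⟨t, h1, h2⟩ | ⟨t, t', h1, h2, h3⟩ | ⟨t, h1, h2⟩
  · rcases t with _ | ⟨b, _ | ⟨c, t⟩⟩
    · rcases v with _ | ⟨b, v⟩
      · simp only [List.nil_append, List.cons.injEq] at h2
        exact .inr (.inr (.inl ⟨h2.1, by simpa using h1.symm, rfl, h2.2⟩))
      · simp only [List.nil_append, List.cons_append, List.cons.injEq] at h2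
        refine .inr (.inr (.inr (.inl ⟨v, h2.1, by simpa using h1.symm, by rw [h2.2.1], h2.2.2⟩)))
    · simp only [List.nil_append, List.cons_append, List.cons.injEq] at h2
      exact .inr (.inl ⟨by rw [h1, h2.1], h2.2⟩)
    · simp only [List.cons_append, List.cons.injEq] at h2
      exact .inl ⟨t, by rw [h1, h2.1, h2.2.1], h2.2.2⟩
  · rcases t' with _ | ⟨b, _ | ⟨c, t'⟩⟩
    · simp only [List.nil_append, List.cons.injEq] at h3
      refine .inr (.inr (.inr (.inr (.inr (.inr (.inl ⟨h3.1, ?_, h3.2.symm⟩))))))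
      rw [h2, h1, List.append_nil]
    · simp only [List.nil_append, List.cons_append, List.cons.injEq] at h3
      exact .inr (.inr (.inr (.inr (.inr (.inl ⟨t, by rw [h1, h3.1], h3.2.1, h2, h3.2.2⟩)))))
    · simp only [List.cons_append, List.cons.injEq] at h3
      exact .inr (.inr (.inr (.inr (.inl ⟨t, t', by rw [h1, h3.1, h3.2.1], h2, h3.2.2⟩))))
  · exact .inr (.inr (.inr (.inr (.inr (.inr (.inr ⟨t, h1, h2⟩))))))

theorem append_cons_inj {α : Type*} {a : α} {u u' t t' : List α} (hu : a ∉ u) (hu' : a ∉ u')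
    (h : u ++ a :: t = u' ++ a :: t') : u = u' ∧ t = t' := by
  induction u generalizing u' with
  | nil =>
    cases u' with
    | nil => simpa using h
    | cons c u' =>
      simp only [List.nil_append, List.cons_append, List.cons.injEq] at h
      exact absurd (by simp [h.1]) hu'
  | cons b u ih =>
    cases u' with
    | nil =>
      simp only [List.nil_append, List.cons_append, List.cons.injEq] at h
      exact absurd (by simp [h.1]) hu
    | cons c u' =>
      simp only [List.cons_append, List.cons.injEq, List.mem_cons, not_or] at h hu hu'
      obtain ⟨rfl, rfl⟩ := ih hu.2 hu'.2 h.2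
      simp [h.1]

/-- The smallest label belongs to the last layer and marks both its ends, so the word can be
recovered from the labels. This identifies layered words that arise from different moves. -/
theorem Std.unique {l : List ℕ} {s s' : List Piece} (h : Std l s) (h' : Std l s') : s = s' := by
  induction h generalizing s' with
  | nil =>
    generalize hl : ([] : List ℕ) = l at h'
    cases h' with
    | nil => rfl
    | cons => simp at hl
  | cons u v w a s h ha ih =>
    generalize hl : u ++ a :: (v ++ a :: w) = l at h'
    cases h' with
    | nil => simp at hl
    | cons u' v' w' b s' h' hb =>
      have hab : a = b := by
        have h1 : a ∈ u' ++ b :: (v' ++ b :: w') := hl ▸ (by simp)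
        have h2 : b ∈ u ++ a :: (v ++ a :: w) := hl ▸ (by simp)
        rcases eq_or_ne a b with e | e
        · exact e
        · have h3 : b < a := hb a (by simp [e] at h1; simpa using h1)
          have h4 : a < b := ha b (by simp [e.symm] at h2; simpa using h2)
          omega
      subst hab
      have nu : a ∉ u := fun hm => lt_irrefl _ (ha a (by simp [hm]))
      have nu' : a ∉ u' := fun hm => lt_irrefl _ (hb a (by simp [hm]))
      have nv : a ∉ v := fun hm => lt_irrefl _ (ha a (by simp [hm]))
      have nv' : a ∉ v' := fun hm => lt_irrefl _ (hb a (by simp [hm]))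
      obtain ⟨rfl, h5⟩ := append_cons_inj nu nu' hl
      obtain ⟨rfl, rfl⟩ := append_cons_inj nv nv' h5
      rw [ih h']

/-- The two occurrences of the smallest label are removed and their arc is put on top of the word
for the rest. -/
theorem exists_std {l : List ℕ} (h : Double l) : ∃ s, Std l s := by
  induction hn : l.length using Nat.strong_induction_on generalizing l with
  | _ n ih =>
    rcases eq_or_ne l [] with rfl | hl
    · exact ⟨[], .nil⟩
    · obtain ⟨a, ha, hmin⟩ : ∃ a ∈ l, ∀ y ∈ l, a ≤ y := by
        obtain ⟨a, ha⟩ := List.exists_mem_of_ne_nil l hl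
        obtain ⟨b, hb, hb'⟩ := (l.toFinset).exists_min_image id ⟨a, by simpa using ha⟩
        exact ⟨b, by simpa using hb, fun y hy => hb' y (by simpa using hy)⟩
      obtain ⟨u, t, rfl, hu⟩ := List.eq_append_cons_of_mem ha
      have hc := h a ha
      rw [List.count_append, List.count_cons_self, List.count_eq_zero.2 hu] at hc
      obtain ⟨v, w, rfl, hv⟩ := List.eq_append_cons_of_mem (List.count_pos_iff.1 (by omega : 0 < t.count a))
      rw [List.count_append, List.count_cons_self, List.count_eq_zero.2 hv] at hc
      have hw : a ∉ w := List.count_eq_zero.1 (by omega)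
      have hne : ∀ y ∈ u ++ v ++ w, a ≠ y := by
        rintro y hy rfl; simp [hu, hv, hw] at hy
      obtain ⟨s, hs⟩ := ih (u ++ v ++ w).length (by simp at hn ⊢; omega) (l := u ++ v ++ w)
        (fun x hx => by
          have h1 := h x (by simp at hx ⊢; tauto)
          have h2 := hne x hx
          simp only [List.count_append, List.count_cons, beq_iff_eq, h2, if_false] at h1 ⊢
          omega) rfl
      exact ⟨_, .cons u v w a s hs fun y hy => lt_of_le_of_ne
        (hmin y (by simp at hy ⊢; tauto)) (hne y hy)⟩

/-- A piece moves up through the top arc. -/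
theorem Eqv.pass {N : ℕ} {s₀ s₁ A A' : List Piece} {p p' : Piece} (hr : Runs s₀ 0 N)
    (h : Eqv N (A ++ [p]) (p' :: A')) (h' : Eqv 0 (s₀ ++ [p']) s₁) :
    Eqv 0 (s₀ ++ A ++ [p]) (s₁ ++ A') := by
  have h1 := h.left hr
  have h2 := h'.right A'
  simp only [List.append_assoc, List.cons_append, List.nil_append] at h1 h2 ⊢
  exact h1.trans h2

/-- A layered word followed by a crossing in which the higher of the two arcs is over. -/
theorem Std.cross {l : List ℕ} {s : List Piece} (h : Std l s) {u w : List ℕ} {x y : ℕ}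
    (hl : l = u ++ x :: y :: w) {ε : Bool} (h1 : x < y → ε = true) (h2 : y < x → ε = false) :
    ∃ s', Std (u ++ y :: x :: w) s' ∧ Eqv 0 (s ++ [⟨.cross ε, u.length⟩]) s' := by
  induction h generalizing u w with
  | nil => simp at hl
  | cons p v r a s h ha ih =>
    have hr := h.runs
    simp only [List.length_append] at hr
    -- In the first, fifth and eighth cases the crossing avoids the top arc and is passed up to the
    -- lower layers. In the third it is a curl. In the others it moves one end of the top arc by one
    -- place, the sign being forced by `h1` or `h2`.
    rcases append_cons_cons_eq_split hl.symm with ⟨t, rfl, rfl⟩ | ⟨rfl, rfl, rfl⟩ |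
      ⟨rfl, rfl, rfl, rfl, rfl⟩ | ⟨t, rfl, rfl, rfl, rfl⟩ | ⟨t, t', rfl, rfl, rfl⟩ |
      ⟨t, rfl, rfl, rfl, rfl⟩ | ⟨rfl, rfl, rfl⟩ | ⟨t, rfl, rfl⟩
    · obtain ⟨s', h3, h4⟩ := ih (u := u) (w := t ++ v ++ r) (by simp)
      have h5 := Std.cons (u ++ y :: x :: t) v r a s' (by simpa using h3)
        (fun z hz => ha z (by simp at hz ⊢; tauto))
      refine ⟨_, h5.congr (by simp), ?_⟩
      refine Eqv.pass hr ?_ h4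
      convert eqv_piece_topArc (a := (u ++ x :: y :: t).length) (k := v.length) (.cross ε) _ _ using 4
      · simp [Shape.ins, Shape.outs]; omega
      · simp [Shape.ins]
      · omega
    · have hlt : y < x := ha x (by simp)
      obtain rfl := h2 hlt
      refine ⟨_, Std.cons u (x :: v) r y s (by simpa using h) (fun z hz => ha z (by simpa using hz)), ?_⟩
      have := (eqv_topArc_left (a := u.length) (k := v.length) (N := (u ++ [x]).length + v.length + r.length)
        (by simp)).left hr
      simpa using this
    · refine ⟨_, Std.cons u [] w y s h ha, ?_⟩
      have := (eqv_cap_curl (a := u.length) ε (N := u.length + ([] : List ℕ).length + w.length)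
        (by simp)).left hr
      simpa [topArc, pullR] using this
    · have hlt : x < y := ha y (by simp)
      obtain rfl := h1 hlt
      have h5 := Std.cons (u ++ [y]) t r x s (by simpa using h)
        (fun z hz => ha z (by simpa using hz))
      refine ⟨_, h5.congr (by simp), ?_⟩
      have := (eqv_topArc_right (a := u.length) (k := t.length) (N := u.length + (y :: t).length + r.length)
        (by simp)).left hr
      simpa using this
    · obtain ⟨s', h3, h4⟩ := ih (u := p ++ t) (w := t' ++ r) (by simp)
      have h5 := Std.cons p (t ++ y :: x :: t') r a s' (by simpa using h3)
        (fun z hz => ha z (by simp at hz ⊢; tauto))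
      refine ⟨_, h5.congr (by simp), ?_⟩
      refine Eqv.pass hr ?_ h4
      have := eqv_topArc_cross (N := p.length + (t ++ x :: y :: t').length + r.length) (a := p.length)
        (k := (t ++ x :: y :: t').length) (j := p.length + t.length) ε (by omega)
        (by simp; omega) (by omega)
      simpa [Nat.add_assoc] using this
    · have hlt : y < x := ha x (by simp)
      obtain rfl := h2 hlt
      have h5 := Std.cons p t (x :: w) y s (by simpa using h)
        (fun z hz => ha z (by simpa using hz))
      refine ⟨_, h5.congr (by simp), ?_⟩
      have := (eqv_topArc_shorten (a := p.length) (k := t.length) (N := p.length + (t ++ [x]).length + w.length)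
        (by simp)).left hr
      simpa [Nat.add_assoc] using this
    · have hlt : x < y := ha y (by simp)
      obtain rfl := h1 hlt
      have h5 := Std.cons p (v ++ [y]) w x s (by simpa using h)
        (fun z hz => ha z (by simpa using hz))
      refine ⟨_, h5.congr (by simp), Eqv.of_eq ?_⟩
      have := topArc_lengthen p.length v.length
      simp only [List.append_assoc, List.length_append, List.length_cons, List.length_nil]
      rw [Nat.zero_add, ← this]
      simp [Nat.add_assoc]
    · obtain ⟨s', h3, h4⟩ := ih (u := p ++ v ++ t) (w := w) (by simp)
      have h5 := Std.cons p v (t ++ y :: x :: w) a s' (by simpa using h3)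
        (fun z hz => ha z (by simp at hz ⊢; tauto))
      refine ⟨_, h5.congr (by simp), ?_⟩
      refine Eqv.pass hr ?_ h4
      have := eqv_topArc_piece (N := p.length + v.length + (t ++ x :: y :: w).length) (a := p.length)
        (k := v.length) (i := (p ++ v ++ t).length) (.cross ε) (by simp)
        (by simp [Shape.ins]; omega)
      convert this using 4
      simp; omega

/-- A layered word followed by a maximum. -/
theorem Std.cap {l : List ℕ} {s : List Piece} (h : Std l s) {u w : List ℕ} {x : ℕ}
    (hl : l = u ++ w) (hx : x ∉ l) :
    ∃ s', Std (u ++ x :: x :: w) s' ∧ Eqv 0 (s ++ [⟨.cap, u.length⟩]) s' := by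
  induction h generalizing u w with
  | nil =>
    obtain ⟨rfl, rfl⟩ := List.append_eq_nil_iff.1 hl.symm
    exact ⟨_, Std.cons [] [] [] x [] .nil (by simp), Eqv.refl _ _⟩
  | cons p v r a s h ha ih =>
    have hr := h.runs
    simp only [List.length_append] at hr
    have hxa : x ≠ a := by rintro rfl; simp at hx
    rcases lt_or_gt_of_ne hxa with hlt | hgt
    -- A label smaller than all others makes the maximum itself the new top layer, with nothing to
    -- be pulled over.
    · have h5 := Std.cons u [] w x (s ++ topArc p.length v.length)
        ((Std.cons p v r a s h ha).congr (by simpa using hl)) (fun z hz => by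
          rw [List.append_nil, ← hl] at hz
          simp only [List.mem_append, List.mem_cons] at hz ha
          rcases hz with hz | rfl | hz | rfl | hz
          · exact hlt.trans (ha z (by tauto))
          · exact hlt
          · exact hlt.trans (ha z (by tauto))
          · exact hlt
          · exact hlt.trans (ha z (by tauto)))
      exact ⟨_, h5, Eqv.refl _ _⟩
    · rcases append_eq_split hl.symm with ⟨t, rfl, rfl⟩ | ⟨t, t', rfl, rfl, rfl⟩ | ⟨t, rfl, rfl⟩
      · obtain ⟨s', h3, h4⟩ := ih (u := u) (w := t ++ v ++ r) (by simp)
          (by simp at hx ⊢; tauto)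
        have h5 := Std.cons (u ++ x :: x :: t) v r a s' (by simpa using h3)
          (fun z hz => by
            simp only [List.mem_append, List.mem_cons] at hz ha
            rcases hz with ((hz | rfl | rfl | hz) | hz) | hz <;> first | exact hgt | exact ha z (by tauto))
        refine ⟨_, h5.congr (by simp), ?_⟩
        refine Eqv.pass hr ?_ h4
        have := eqv_piece_topArc (N := (u ++ t).length + v.length + r.length) (i := u.length)
          (a := (u ++ t).length) (k := v.length) .cap (by simp [Shape.ins]) (by omega)
        convert this using 4
        simp [Shape.ins, Shape.outs]; omega
      · obtain ⟨s', h3, h4⟩ := ih (u := p ++ t) (w := t' ++ r) (by simp)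
          (by simp at hx ⊢; tauto)
        have h5 := Std.cons p (t ++ x :: x :: t') r a s' (by simpa using h3)
          (fun z hz => by
            simp only [List.mem_append, List.mem_cons] at hz ha
            rcases hz with (hz | hz | rfl | rfl | hz) | hz <;> first | exact hgt | exact ha z (by tauto))
        refine ⟨_, h5.congr (by simp), ?_⟩
        refine Eqv.pass hr ?_ h4
        have := eqv_topArc_cap (N := p.length + (t ++ t').length + r.length) (a := p.length)
          (k := (t ++ t').length) (j := p.length + t.length) (by omega) (by simp) (by omega)
        simpa [Nat.add_assoc] using this
      · obtain ⟨s', h3, h4⟩ := ih (u := p ++ v ++ t) (w := w) (by simp)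
          (by simp at hx ⊢; tauto)
        have h5 := Std.cons p v (t ++ x :: x :: w) a s' (by simpa using h3)
          (fun z hz => by
            simp only [List.mem_append, List.mem_cons] at hz ha
            rcases hz with (hz | hz) | hz | rfl | rfl | hz <;> first | exact hgt | exact ha z (by tauto))
        refine ⟨_, h5.congr (by simp), ?_⟩
        refine Eqv.pass hr ?_ h4
        have := eqv_topArc_piece (N := p.length + v.length + (t ++ w).length) (a := p.length)
          (k := v.length) (i := (p ++ v ++ t).length) .cap (by simp)
          (by simp [Shape.ins]; omega)
        convert this using 4
        simp; omega

/-- The top arc is pulled to the right over the arcs `v`. -/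
theorem Std.pullR {x : ℕ} {v : List ℕ} : ∀ {u w : List ℕ} {s : List Piece},
    Std (u ++ x :: (v ++ w)) s → (∀ y ∈ v, x ≤ y) →
    ∃ s', Std (u ++ (v ++ x :: w)) s' ∧ Eqv 0 (s ++ Kauffman.pullR u.length v.length) s' := by
  induction v with
  | nil => exact fun {u w s} h _ => ⟨s, h, by simpa [Kauffman.pullR] using Eqv.refl _ _⟩
  | cons y v ih =>
    intro u w s h hx
    obtain ⟨s', h1, h2⟩ := h.cross (u := u) (x := x) (y := y) (w := v ++ w) rfl (ε := true)
      (fun _ => rfl) (fun hlt => absurd hlt (not_lt.2 (hx y (by simp))))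
    obtain ⟨s'', h3, h4⟩ := ih (u := u ++ [y]) (w := w) (s := s') (by simpa using h1)
      (fun z hz => hx z (by simp [hz]))
    refine ⟨s'', by simpa using h3, ?_⟩
    have h5 := h2.right (Kauffman.pullR (u.length + 1) v.length)
    rw [List.length_cons, pullR_succ']
    simp only [List.append_assoc, List.cons_append, List.nil_append, List.length_append,
      List.length_cons, List.length_nil, Nat.zero_add] at h4 h5 ⊢
    exact h5.trans h4

/-- The top arc is pulled to the left over the arcs `v`. -/
theorem Std.pullL {x : ℕ} {v : List ℕ} : ∀ {u w : List ℕ} {s : List Piece},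
    Std (u ++ (v ++ x :: w)) s → (∀ y ∈ v, x ≤ y) →
    ∃ s', Std (u ++ x :: (v ++ w)) s' ∧ Eqv 0 (s ++ Kauffman.pullL u.length v.length) s' := by
  induction v using List.reverseRecOn with
  | nil => exact fun {u w s} h _ => ⟨s, h, by simpa [Kauffman.pullL] using Eqv.refl _ _⟩
  | append_singleton v y ih =>
    intro u w s h hx
    obtain ⟨s', h1, h2⟩ := h.cross (u := u ++ v) (x := y) (y := x) (w := w) (by simp) (ε := false)
      (fun hlt => absurd hlt (not_lt.2 (hx y (by simp)))) (fun _ => rfl)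
    obtain ⟨s'', h3, h4⟩ := ih (u := u) (w := y :: w) (s := s') (by simpa using h1)
      (fun z hz => hx z (by simp [hz]))
    refine ⟨s'', by simpa using h3, ?_⟩
    have h5 := h2.right (Kauffman.pullL u.length v.length)
    rw [List.length_append, List.length_singleton, Kauffman.pullL]
    simp only [List.append_assoc, List.cons_append, List.nil_append, List.length_append] at h4 h5 ⊢
    exact h5.trans h4


/-- The smaller of the labels `x`, `y` is replaced by the larger one. -/
def mergeLabel (x y t : ℕ) : ℕ := if t = min x y then max x y else t

theorem le_mergeLabel (x y t : ℕ) : t ≤ mergeLabel x y t := by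
  unfold mergeLabel; split_ifs <;> omega

theorem map_mergeLabel_eq {x y : ℕ} {l : List ℕ} (h : ∀ t ∈ l, min x y < t) :
    l.map (mergeLabel x y) = l := by
  conv_rhs => rw [← List.map_id l]
  exact List.map_congr_left fun t ht => if_neg (by have := h t ht; omega)

/-- A layered word followed by a minimum that joins two arcs in neighbouring layers. -/
theorem Std.cup {l : List ℕ} {s : List Piece} (h : Std l s) {u w : List ℕ} {x y : ℕ}
    (hl : l = u ++ x :: y :: w) (hxy : x ≠ y)
    (hb : ∀ t ∈ l, ¬ (min x y < t ∧ t < max x y)) :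
    ∃ s', Std ((u ++ w).map (mergeLabel x y)) s' ∧ Eqv 0 (s ++ [⟨.cup, u.length⟩]) s' := by
  induction h generalizing u w with
  | nil => simp at hl
  | cons p v r a s h ha ih =>
    have hr := h.runs
    simp only [List.length_append] at hr
    have hmem : ∀ t, t ∈ p ++ v ++ r → t ∈ p ++ a :: (v ++ a :: r) := fun t ht => by
      simp only [List.mem_append, List.mem_cons] at ht ⊢; tauto
    -- If the top arc takes part, `hb` puts its partner directly below it, so the joined arc may be
    -- pulled over all the others.
    have hlow : ∀ c, a = min x y → c = max x y → ∀ t ∈ p ++ v ++ r, c ≤ t := fun c h1 h2 t ht => by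
      have h3 := hb t (hmem t ht)
      have h4 := ha t ht
      omega
    -- the relabelling when the top arc is one of the two
    have hrel : ∀ c, a = min x y → c = max x y → mergeLabel x y a = c ∧
        p.map (mergeLabel x y) = p ∧ v.map (mergeLabel x y) = v ∧ r.map (mergeLabel x y) = r :=
      fun c h1 h2 => ⟨by rw [mergeLabel, if_pos h1, h2],
        map_mergeLabel_eq fun t ht => h1 ▸ ha t (by simp [ht]),
        map_mergeLabel_eq fun t ht => h1 ▸ ha t (by simp [ht]),
        map_mergeLabel_eq fun t ht => h1 ▸ ha t (by simp [ht])⟩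
    -- If both arcs are lower, merging only raises labels, and the top arc stays on top.
    have hother : x ∈ p ++ v ++ r → y ∈ p ++ v ++ r → mergeLabel x y a = a ∧
        ∀ t, t ∈ p ++ v ++ r → a < mergeLabel x y t := fun hx hy => by
      have h1 := ha x hx
      have h2 := ha y hy
      exact ⟨if_neg (by omega), fun t ht => (ha t ht).trans_le (le_mergeLabel x y t)⟩
    rcases append_cons_cons_eq_split hl.symm with ⟨t, rfl, rfl⟩ | ⟨rfl, rfl, rfl⟩ |
      ⟨rfl, rfl, rfl, rfl, rfl⟩ | ⟨t, rfl, rfl, rfl, rfl⟩ | ⟨t, t', rfl, rfl, rfl⟩ |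
      ⟨t, rfl, rfl, rfl, rfl⟩ | ⟨rfl, rfl, rfl⟩ | ⟨t, rfl, rfl⟩
    · obtain ⟨h6, h7⟩ := hother (by simp) (by simp)
      obtain ⟨s', h3, h4⟩ := ih (u := u) (w := t ++ v ++ r) (by simp)
        (fun z hz => hb z (hmem z hz))
      have h5 := Std.cons ((u ++ t).map (mergeLabel x y)) (v.map (mergeLabel x y))
        (r.map (mergeLabel x y)) a s' (by simpa using h3) (fun z hz => by
          rw [← List.map_append, ← List.map_append, List.mem_map] at hz
          obtain ⟨z, hz, rfl⟩ := hz
          exact h7 z (by simp at hz ⊢; tauto))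
      refine ⟨_, h5.congr (by simp [h6]), Eqv.pass hr ?_ h4⟩
      have := eqv_piece_topArc (N := (u ++ x :: y :: t).length + v.length + r.length)
        (i := u.length) (a := (u ++ x :: y :: t).length) (k := v.length) .cup
        (by simp [Shape.ins]) (by omega)
      simp only [List.length_map]
      convert this using 4
      simp [Shape.ins, Shape.outs]; omega
    · have hlt : y < x := ha x (by simp)
      obtain ⟨h6, h7, h8, h9⟩ := hrel x (by omega) (by omega)
      -- The minimum absorbs the top arc into its neighbour, which is now the string pulled over
      -- `v`.
      obtain ⟨s', h3, h4⟩ := Std.pullR (u := u) (x := x) (v := v) (w := r) (s := s)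
        (by simpa using h) (fun z hz => hlow x (by omega) (by omega) z (by simp [hz]))
      refine ⟨s', h3.congr ?_, ?_⟩
      · simp only [List.map_append, List.map_cons, List.map_nil] at h7 ⊢
        rw [(List.append_inj' h7 rfl).1, h6, h8, h9]
      · have := (eqv_topArc_join_left (N := (u ++ [x]).length + v.length + r.length)
          (b := u.length) (k := v.length) (by simp)).left hr
        refine Eqv.trans ?_ h4
        simpa using this
    · exact absurd rfl hxy
    · have hlt : x < y := ha y (by simp)
      obtain ⟨h6, h7, h8, h9⟩ := hrel y (by omega) (by omega)
      obtain ⟨s', h3, h4⟩ := Std.pullR (u := u) (x := y) (v := t) (w := r) (s := s)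
        (by simpa using h) (fun z hz => hlow y (by omega) (by omega) z (by simp [hz]))
      refine ⟨s', h3.congr ?_, ?_⟩
      · simp only [List.map_append, List.map_cons, List.cons.injEq] at h8 ⊢
        rw [h7, h8.2, h6, h9]
      · have := (eqv_topArc_join_left' (N := u.length + (y :: t).length + r.length)
          (a := u.length) (k := t.length) (by simp)).left hr
        refine Eqv.trans ?_ h4
        simpa using this
    · obtain ⟨h6, h7⟩ := hother (by simp) (by simp)
      obtain ⟨s', h3, h4⟩ := ih (u := p ++ t) (w := t' ++ r) (by simp)
        (fun z hz => hb z (hmem z hz))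
      have h5 := Std.cons (p.map (mergeLabel x y)) ((t ++ t').map (mergeLabel x y))
        (r.map (mergeLabel x y)) a s' (by simpa using h3) (fun z hz => by
          rw [← List.map_append, ← List.map_append, List.mem_map] at hz
          obtain ⟨z, hz, rfl⟩ := hz
          exact h7 z (by simp at hz ⊢; tauto))
      refine ⟨_, h5.congr (by simp [h6]), Eqv.pass hr ?_ h4⟩
      have := eqv_topArc_cup (N := p.length + (t ++ x :: y :: t').length + r.length)
        (a := p.length) (k := (t ++ x :: y :: t').length) (j := p.length + t.length) (by omega)
        (by simp; omega) (by omega)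
      rw [show (t ++ x :: y :: t').length - 2 = (t ++ t').length by simp; omega] at this
      simpa [Nat.add_assoc] using this
    · have hlt : y < x := ha x (by simp)
      obtain ⟨h6, h7, h8, h9⟩ := hrel x (by omega) (by omega)
      obtain ⟨s', h3, h4⟩ := Std.pullL (u := p) (x := x) (v := t) (w := w) (s := s)
        (by simpa using h) (fun z hz => hlow x (by omega) (by omega) z (by simp [hz]))
      refine ⟨s', h3.congr ?_, ?_⟩
      · simp only [List.map_append, List.map_cons, List.map_nil] at h8 ⊢
        rw [h7, (List.append_inj' h8 rfl).1, h6, h9]; simp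
      · have := (eqv_topArc_join_right' (N := p.length + (t ++ [x]).length + w.length)
          (a := p.length) (k := t.length) (by simp)).left hr
        refine Eqv.trans ?_ h4
        simpa [Nat.add_assoc] using this
    · have hlt : x < y := ha y (by simp)
      obtain ⟨h6, h7, h8, h9⟩ := hrel y (by omega) (by omega)
      obtain ⟨s', h3, h4⟩ := Std.pullL (u := p) (x := y) (v := v) (w := w) (s := s)
        (by simpa using h) (fun z hz => hlow y (by omega) (by omega) z (by simp [hz]))
      refine ⟨s', h3.congr ?_, ?_⟩
      · simp only [List.map_append, List.map_cons, List.cons.injEq] at h9 ⊢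
        rw [h7, h8, h6, h9.2]; simp
      · have := (eqv_topArc_join_right (N := p.length + v.length + (y :: w).length)
          (a := p.length) (k := v.length) (by simp)).left hr
        refine Eqv.trans ?_ h4
        simpa [Nat.add_assoc] using this
    · obtain ⟨h6, h7⟩ := hother (by simp) (by simp)
      obtain ⟨s', h3, h4⟩ := ih (u := p ++ v ++ t) (w := w) (by simp)
        (fun z hz => hb z (hmem z hz))
      have h5 := Std.cons (p.map (mergeLabel x y)) (v.map (mergeLabel x y))
        ((t ++ w).map (mergeLabel x y)) a s' (by simpa using h3) (fun z hz => by
          rw [← List.map_append, ← List.map_append, List.mem_map] at hz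
          obtain ⟨z, hz, rfl⟩ := hz
          exact h7 z (by simp at hz ⊢; tauto))
      refine ⟨_, h5.congr (by simp [h6]), Eqv.pass hr ?_ h4⟩
      have := eqv_topArc_piece (N := p.length + v.length + (t ++ x :: y :: w).length)
        (a := p.length) (k := v.length) (i := (p ++ v ++ t).length) .cup (by simp)
        (by simp [Shape.ins]; omega)
      simp only [List.length_map]
      convert this using 4
      simp; omega

/-- A layered word with an arc that joins two neighbouring points ends with this arc. -/
theorem Std.uncap {u w : List ℕ} {x : ℕ} {s : List Piece} (h : Std (u ++ x :: x :: w) s) :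
    ∃ s', Std (u ++ w) s' ∧ Eqv 0 (s' ++ [⟨.cap, u.length⟩]) s := by
  have hd := h.double
  have hc := hd x (by simp)
  simp only [List.count_append, List.count_cons_self] at hc
  have hx : x ∉ u ++ w := by
    rw [← List.count_eq_zero, List.count_append]; omega
  obtain ⟨s₀, h0⟩ := exists_std (l := u ++ w) (fun y hy => by
    have hne : x ≠ y := fun e => hx (e ▸ hy)
    have := hd y (by simp at hy ⊢; tauto)
    simp only [List.count_append, List.count_cons, beq_iff_eq, hne, if_false] at this ⊢
    omega)
  obtain ⟨s', h1, h2⟩ := h0.cap rfl hx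
  -- Adding the arc with label `x` again produces a layered word with the labels of `s`, hence `s`
  -- itself.
  exact ⟨s₀, h0, h1.unique h ▸ h2⟩


/-! ### Spanning -/

/-- Whether a piece is a crossing. -/
def Piece.isCross (p : Piece) : Bool :=
  match p.shape with
  | .cross _ => true
  | _ => false

/-- The number of crossings. -/
def crossings (w : List Piece) : ℕ := w.countP Piece.isCross

@[simp] theorem crossings_nil : crossings [] = 0 := rfl

@[simp] theorem crossings_append (x y : List Piece) :
    crossings (x ++ y) = crossings x + crossings y := List.countP_append

@[simp] theorem crossings_cross (ε : Bool) (i : ℕ) (w : List Piece) :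
    crossings (⟨.cross ε, i⟩ :: w) = crossings w + 1 := List.countP_cons_of_pos rfl

@[simp] theorem crossings_cup (i : ℕ) (w : List Piece) :
    crossings (⟨.cup, i⟩ :: w) = crossings w := List.countP_cons_of_neg (by simp [Piece.isCross])

@[simp] theorem crossings_cap (i : ℕ) (w : List Piece) :
    crossings (⟨.cap, i⟩ :: w) = crossings w := List.countP_cons_of_neg (by simp [Piece.isCross])

/-- The span of the diagrams with less than `k` crossings. -/
def lowSpan (n k : ℕ) : Submodule Scal (TMod 0 n) :=
  Submodule.span Scal {x | ∃ w, crossings w < k ∧ cls 0 n w = x}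

theorem cls_mem_lowSpan {n k : ℕ} {w : List Piece} (h : crossings w < k) :
    cls 0 n w ∈ lowSpan n k := Submodule.subset_span ⟨w, h, rfl⟩

theorem Double.map {l : List ℕ} (h : Double l) {σ : ℕ → ℕ} (hσ : Set.InjOn σ {x | x ∈ l}) :
    Double (l.map σ) := by
  intro y hy
  obtain ⟨x, hx, rfl⟩ := List.mem_map.1 hy
  rw [← h x hx, List.count, List.countP_map, List.count]
  refine List.countP_congr fun z hz => ?_
  simp only [Function.comp_apply, beq_iff_eq]
  exact ⟨fun e => hσ hz hx e, fun e => e ▸ rfl⟩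

/-- `w` is a multiple of `s` modulo diagrams with fewer crossings than `w`, whatever follows. -/
def LowEq (w s : List Piece) : Prop :=
  ∃ c : Scal, ∀ (v : List Piece) (n : ℕ),
    cls 0 n (w ++ v) - c • cls 0 n (s ++ v) ∈ lowSpan n (crossings w + crossings v)

/-- A piece absorbed by the layered word only changes the scalar; its crossings are merely
transferred from the continuation to the word, so the bound stays the same. -/
theorem LowEq.step {w s s' : List Piece} {p : Piece} (h : LowEq w s) {d : Scal}
    (hs : Sim d 0 (s ++ [p]) s') : LowEq (w ++ [p]) s' := by
  obtain ⟨c, hc⟩ := h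
  refine ⟨c * d, fun v n => ?_⟩
  have h1 := hc ([p] ++ v) n
  have h2 := hs [] v 0 n rfl
  simp only [List.nil_append, List.append_assoc] at h2
  rw [h2, smul_smul] at h1
  rw [List.append_assoc]
  convert h1 using 2
  simp only [crossings_append]; omega

theorem exists_eq_append_cons_cons {α : Type*} {l : List α} {i : ℕ} (h : i + 1 < l.length) :
    ∃ u x y w, l = u ++ x :: y :: w ∧ u.length = i := by
  refine ⟨l.take i, l[i], l[i + 1], l.drop (i + 2), ?_, by simp; omega⟩
  rw [← List.drop_eq_getElem_cons, ← List.drop_eq_getElem_cons, List.take_append_drop]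

/-- Every diagram is, modulo diagrams with fewer crossings, a multiple of each layered diagram
with the same connector. -/
theorem exists_lowEq {w : List Piece} : ∀ {N : ℕ}, Runs w 0 N →
    ∃ l : List ℕ, Double l ∧ l.length = N ∧ ∀ σ : ℕ → ℕ, Set.InjOn σ {x | x ∈ l} →
      ∀ s, Std (l.map σ) s → LowEq w s := by
  induction w using List.reverseRecOn with
  | nil =>
    intro N h
    refine ⟨[], by simp [Double], h, fun σ _ s hs => ⟨1, fun v n => ?_⟩⟩
    rw [hs.unique .nil, one_smul, sub_self]
    exact zero_mem _
  | append_singleton w p ih =>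
    intro N h
    obtain ⟨M, hw, hp⟩ := runs_append.1 h
    obtain ⟨l, hd, hl, hl'⟩ := ih hw
    obtain ⟨s, i⟩ := p
    obtain ⟨hfit, hN⟩ := hp
    simp only [Runs, Piece.Fits, Piece.after] at hfit hN
    cases s with
    | cross ε =>
      simp only [Shape.ins, Shape.outs] at hfit hN
      obtain ⟨u, x, y, t, rfl, rfl⟩ := exists_eq_append_cons_cons (l := l) (i := i) (by omega)
      have hset : {z | z ∈ u ++ x :: y :: t} = {z | z ∈ u ++ y :: x :: t} := by
        ext z; simp; tauto
      refine ⟨u ++ y :: x :: t, fun z hz => ?_, by simp at hl ⊢; omega, fun σ hσ s hs => ?_⟩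
      · rw [← hd z (by simp at hz ⊢; tauto)]
        simp only [List.count_append, List.count_cons]; omega
      · rw [← hset] at hσ
        obtain ⟨s₁, h1⟩ := exists_std (hd.map hσ)
        obtain ⟨s', h2, d, h3⟩ := h1.cross (u := u.map σ) (x := σ x) (y := σ y) (w := t.map σ)
          (by simp) (ε := decide (σ x < σ y)) (fun h => by simpa using h)
          (fun h => by simp; omega)
        have e := h2.unique (hs.congr (by simp))
        subst e
        have key := (hl' σ hσ s₁ h1).step h3
        rw [List.length_map] at key
        by_cases he : ε = decide (σ x < σ y)
        · rwa [← he] at key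
        · obtain ⟨c, hc⟩ := key
          refine ⟨c, fun v n => ?_⟩
          have h4 := hc v n
          have h5 := cls_skein (i := u.length) (u := w) (v := v) (N := M) (by omega) n hw
          have h6 : sZ • (cls 0 n (w ++ v) - cls 0 n (w ++ [⟨.cup, u.length⟩, ⟨.cap, u.length⟩] ++ v))
              ∈ lowSpan n (crossings (w ++ [⟨.cross ε, u.length⟩]) + crossings v) :=
            Submodule.smul_mem _ _ (Submodule.sub_mem _ (cls_mem_lowSpan (by simp))
              (cls_mem_lowSpan (by simp)))
          simp only [crossings_append, crossings_cross] at h4 h6 ⊢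
          rw [← h5] at h6
          cases ε with
          | true =>
            rw [show decide (σ x < σ y) = false by simpa using Ne.symm he] at h4
            convert Submodule.add_mem _ h4 h6 using 1
            abel
          | false =>
            rw [show decide (σ x < σ y) = true by simpa using Ne.symm he] at h4
            convert Submodule.sub_mem _ h4 h6 using 1
            abel
    | cap =>
      simp only [Shape.ins, Shape.outs] at hfit hN
      have hsplit := List.take_append_drop i l
      set u := l.take i with hu
      set t := l.drop i with ht
      have hui : u.length = i := by simp [hu]; omega
      -- A number larger than every entry, hence a fresh label.
      set x := l.sum + 1 with hx
      have hxl : x ∉ l := fun hm => by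
        have := List.single_le_sum (l := l) (fun _ _ => Nat.zero_le _) x hm
        omega
      refine ⟨u ++ x :: x :: t, fun z hz => ?_, ?_, fun σ hσ s hs => ?_⟩
      · by_cases hzx : z = x
        · have : l.count x = 0 := List.count_eq_zero.2 hxl
          rw [← hsplit, List.count_append] at this
          simp only [List.count_append, List.count_cons, hzx]; simp; omega
        · rw [← hd z (by rw [← hsplit]; simp [hzx] at hz ⊢; tauto)]
          conv_rhs => rw [← hsplit]
          simp only [List.count_append, List.count_cons, beq_iff_eq, Ne.symm hzx, if_false]
          rfl
      · have := congrArg List.length hsplit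
        simp only [List.length_append, List.length_cons] at this ⊢; omega
      · obtain ⟨s', h1, d, h2⟩ := Std.uncap (u := u.map σ) (w := t.map σ) (x := σ x) (s := s)
          (hs.congr (by simp))
        rw [List.length_map, hui] at h2
        exact (hl' σ (hσ.mono fun z hz => by
          simp only [Set.mem_ofPred_eq] at hz ⊢
          rw [← hsplit] at hz; simp at hz ⊢; tauto) s'
          (h1.congr (by rw [← List.map_append, hsplit]))).step h2
    | cup =>
      simp only [Shape.ins, Shape.outs] at hfit hN
      obtain ⟨u, x, y, t, rfl, rfl⟩ := exists_eq_append_cons_cons (l := l) (i := i) (by omega)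
      -- For equal labels the minimum closes an arc, which can be isolated as a circle with factor
      -- `δ`; otherwise it merges two arcs.
      rcases eq_or_ne x y with rfl | hxy
      · have hc := hd x (by simp)
        simp only [List.count_append, List.count_cons_self] at hc
        have hx : x ∉ u ++ t := by rw [← List.count_eq_zero, List.count_append]; omega
        refine ⟨u ++ t, fun z hz => ?_, by simp at hl ⊢; omega, fun σ hσ s hs => ?_⟩
        · rw [← hd z (by simp at hz ⊢; tauto)]
          have : x ≠ z := fun e => hx (e ▸ hz)
          simp [List.count_append, this]
        -- Since `x` is no longer present below, `σ` need not be injective on it; a fresh value `b`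
        -- is used in its place.
        · obtain ⟨b, hb⟩ : ∃ b, b ∉ (u ++ t).map σ := ⟨((u ++ t).map σ).sum + 1, fun hm => by
            have := List.single_le_sum (l := (u ++ t).map σ) (fun _ _ => Nat.zero_le _) _ hm
            omega⟩
          have hmap : ∀ q : List ℕ, (∀ z ∈ q, z ∈ u ++ t) →
              q.map (Function.update σ x b) = q.map σ := fun q hq =>
            List.map_congr_left fun z hz => Function.update_of_ne
              (fun e => hx (by rw [← e]; exact hq z hz)) _ _
          have hu := hmap u (by simp +contextual)
          have ht := hmap t (by simp +contextual)
          have hσ' : Set.InjOn (Function.update σ x b) {z | z ∈ u ++ x :: x :: t} := by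
            have h1 : ∀ z, z ∈ u ++ t → Function.update σ x b z = σ z := fun z hz =>
              Function.update_of_ne (fun e => hx (by rw [← e]; exact hz)) _ _
            have h2 : ∀ z, z ∈ u ++ t → σ z ≠ b := fun z hz e => hb (e ▸ List.mem_map_of_mem hz)
            have h3 : ∀ z, z ∈ u ++ x :: x :: t → z = x ∨ z ∈ u ++ t := fun z hz => by
              simp at hz ⊢; tauto
            intro z hz z' hz' e
            rcases h3 z hz with hzx | hz1 <;> rcases h3 z' hz' with hzx' | hz1'
            · rw [hzx, hzx']
            · rw [hzx, Function.update_self, h1 _ hz1'] at e; exact absurd e.symm (h2 _ hz1')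
            · rw [hzx', Function.update_self, h1 _ hz1] at e; exact absurd e (h2 _ hz1)
            · rw [h1 _ hz1, h1 _ hz1'] at e; exact hσ hz1 hz1' e
          obtain ⟨s₁, h1⟩ := exists_std (hd.map hσ')
          obtain ⟨s', h2, h3⟩ := Std.uncap (u := u.map σ) (w := t.map σ) (x := b) (s := s₁)
            (h1.congr (by simp [hu, ht]))
          have e := h2.unique (hs.congr (by simp))
          subst e
          obtain ⟨d, h3⟩ := h3.symm
          have h4 := h3.ctx (u := []) rfl [⟨.cup, u.length⟩]
          have h5 := (sim_circle (N := (u ++ t).length) (i := u.length) (by simp)).ctx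
            (u := s') (N := 0) (by simpa using hs.runs) []
          simp only [List.nil_append, List.append_assoc, List.append_nil, List.length_map,
            List.cons_append] at h4 h5
          exact (hl' _ hσ' s₁ h1).step (h4.trans h5)
      -- The merged arc keeps the label `x`.
      · set f : ℕ → ℕ := fun z => if z = y then x else z with hf
        have hcx := hd x (by simp)
        have hcy := hd y (by simp)
        simp only [List.count_append, List.count_cons, beq_iff_eq, if_true, hxy, Ne.symm hxy,
          if_false] at hcx hcy
        have hxm : x ∈ u ++ t := List.count_pos_iff.1 (by rw [List.count_append]; omega)
        refine ⟨(u ++ t).map f, fun z hz => ?_, by simp at hl ⊢; omega, fun σ hσ s hs => ?_⟩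
        · obtain ⟨z, hz, rfl⟩ := List.mem_map.1 hz
          have hsum : ∀ q : List ℕ, (q.map f).count x = q.count x + q.count y := fun q => by
            induction q with
            | nil => rfl
            | cons b q ihq =>
              rw [List.map_cons, List.count_cons, List.count_cons, List.count_cons, ihq]
              have hfb : f b = if b = y then x else b := rfl
              rw [hfb]
              by_cases hb : b = y
              · simp [hb, Ne.symm hxy]; omega
              · simp [hb]; omega
          by_cases hzx : f z = x
          · rw [hzx, hsum, List.count_append, List.count_append]; omega
          · have hzy : z ≠ y := fun e => hzx (by simp [hf, e])
            have hfz : f z = z := by simp [hf, hzy]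
            rw [hfz] at hzx ⊢
            have hq : ∀ q : List ℕ, (q.map f).count z = q.count z := fun q => by
              rw [List.count, List.countP_map]
              refine List.countP_congr fun b _ => ?_
              simp only [Function.comp_apply, beq_iff_eq, hf]
              split_ifs with hb
              · exact ⟨fun e => absurd e.symm hzx, fun e => absurd (e.symm.trans hb) hzy⟩
              · rfl
            rename_i hzm
            rw [hq, ← hd z (by simp at hzm ⊢; tauto)]
            simp [List.count_append, Ne.symm hzx, Ne.symm hzy]
        -- The prescribed order of the merged arcs is refined: doubling makes room to put `y`
        -- immediately after `x`, as `Std.cup` requires.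
        · set τ : ℕ → ℕ := fun z => if z = y then 2 * σ x + 1 else 2 * σ z with hτ
          have hin : ∀ z, z ∈ u ++ x :: y :: t → z ≠ y → z ∈ (u ++ t).map f := fun z hz hzy => by
            refine List.mem_map.2 ⟨z, ?_, by simp [hf, hzy]⟩
            simp only [List.mem_append, List.mem_cons, hzy, false_or] at hz hxm ⊢
            rcases hz with hz | rfl | hz <;> tauto
          have hτ' : Set.InjOn τ {z | z ∈ u ++ x :: y :: t} := by
            intro z hz z' hz' e
            simp only [hτ] at e
            split_ifs at e with h1 h2 h2
            · exact h1.trans h2.symm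
            · omega
            · omega
            · exact hσ (hin z hz h1) (hin z' hz' h2) (by omega)
          obtain ⟨s₁, h1⟩ := exists_std (hd.map hτ')
          have hx' : τ x = 2 * σ x := by simp [hτ, hxy]
          have hy' : τ y = 2 * σ x + 1 := by simp [hτ]
          obtain ⟨s', h2, d, h3⟩ := h1.cup (u := u.map τ) (x := τ x) (y := τ y) (w := t.map τ)
            (by simp) (by omega) (fun z _ => by omega)
          -- The labels left by `Std.cup` are the prescribed ones up to the monotone map `g`, so
          -- both describe the same layered word.
          set g : ℕ → ℕ := fun z => if z = σ x then 2 * σ x + 1 else 2 * z with hg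
          have hgm : StrictMono g := fun a b hab => by
            simp only [hg]; split_ifs <;> omega
          have h4 := hs.map (hgm.strictMonoOn _)
          have e := h2.unique (h4.congr (by
            rw [← List.map_append, List.map_map, List.map_map, List.map_map]
            refine List.map_congr_left fun z _ => ?_
            simp only [Function.comp_apply, mergeLabel, hτ, hg, hf]
            split_ifs <;> omega))
          subst e
          rw [List.length_map] at h3
          exact (hl' τ hτ' s₁ h1).step h3

/-- A submodule that contains a layered diagram for each connector is everything. -/
theorem cls_mem_of_std {N : ℕ} (P : Submodule Scal (TMod 0 N))
    (hP : ∀ l : List ℕ, Double l → l.length = N → ∃ σ : ℕ → ℕ, Set.InjOn σ {x | x ∈ l} ∧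
      ∃ s, Std (l.map σ) s ∧ cls 0 N s ∈ P) (w : List Piece) : cls 0 N w ∈ P := by
  induction hk : crossings w using Nat.strong_induction_on generalizing w with
  | _ k ih =>
    by_cases hw : Runs w 0 N
    · obtain ⟨l, hd, hl, h⟩ := exists_lowEq hw
      obtain ⟨σ, hσ, s, hs, hsP⟩ := hP l hd hl
      obtain ⟨c, hc⟩ := h σ hσ s hs
      have h1 := hc [] N
      simp only [List.append_nil, crossings_nil, Nat.add_zero] at h1
      have h2 : lowSpan N (crossings w) ≤ P := by
        refine Submodule.span_le.2 ?_
        rintro _ ⟨w', hw', rfl⟩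
        exact ih _ (hk ▸ hw') w' rfl
      have := P.add_mem (h2 h1) (P.smul_mem c hsP)
      simpa using this
    · rw [cls_eq_zero hw]; exact zero_mem _


/-! ### Vertex models -/

/-- The value of `λ` or `λ⁻¹`. -/
def curlFactor {R : Type} (lam lamI : R) (ε : Bool) : R := if ε then lam else lamI

/-- A vertex model with values in `R` for the tangle category: a finite set `I` of labels and
transfer operators, satisfying the relations of Kauffman's tangles. The operators take a
function of the labels below a piece to a function of the labels above it. -/
structure Model (R : Type) [CommRing R] (z lam lamI del : R) where
  I : Type
  finite : Finite I
  T : Bool → I → I → (I → I → R) → R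
  cap : (I → I → R) → R
  cup : I → I → R
  T_add : ∀ ε a b (G H : I → I → R), T ε a b (fun k l => G k l + H k l) = T ε a b G + T ε a b H
  T_mul : ∀ ε a b c (G : I → I → R), T ε a b (fun k l => c * G k l) = c * T ε a b G
  cap_add : ∀ G H : I → I → R, cap (fun k l => G k l + H k l) = cap G + cap H
  cap_mul : ∀ c (G : I → I → R), cap (fun k l => c * G k l) = c * cap G
  zig : ∀ a (H : I → R), cap (fun k l => cup l a * H k) = H a
  zag : ∀ a (H : I → R), cap (fun k l => cup a k * H l) = H a
  turnCap : ∀ ε a (H : I → I → I → R), cap (fun k l => T ε l a fun m n => H k m n) =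
    cap (fun k l => T (!ε) a k fun m n => H m n l)
  turnCup : ∀ ε a b c (H : I → R), T ε b c (fun m n => cup a m * H n) =
    T (!ε) a b (fun m n => cup n c * H m)
  r2 : ∀ ε a b (G : I → I → R), T ε a b (fun k l => T (!ε) k l G) = G a b
  r3 : ∀ a b c (G : I → I → I → R),
    T true a b (fun k l => T true l c fun m f => T true k m fun d e => G d e f) =
      T true b c (fun k l => T true a k fun d m => T true m l fun e f => G d e f)
  skein : ∀ a b (G : I → I → R),
    T true a b G = T false a b G + z * (G a b + (-1) * (cup a b * cap G))
  capCurl : ∀ ε (G : I → I → R),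
    cap (fun k l => T ε k l G) = curlFactor lam lamI ε * cap G
  cupCurl : ∀ ε a b, T ε a b cup = curlFactor lam lamI ε * cup a b
  circle : cap cup = del

/-! ### Sliding, curl and skein identities in a vertex model -/

namespace Model

variable {R : Type} [CommRing R] {z lam lamI del : R}

theorem T_mul_right (M : Model R z lam lamI del) (ε a b) (G : M.I → M.I → R) (c : R) :
    M.T ε a b (fun k l => G k l * c) = M.T ε a b G * c := by
  simp only [mul_comm _ c, M.T_mul]

theorem T_zero (M : Model R z lam lamI del) (ε a b) : M.T ε a b (fun _ _ => 0) = 0 := by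
  simpa using M.T_mul ε a b 0 (fun _ _ => 0)

theorem cap_zero (M : Model R z lam lamI del) : M.cap (fun _ _ => 0) = 0 := by
  simpa using M.cap_mul 0 (fun _ _ => 0)

/-- A string slides over a minimum. -/
theorem slideCup (M : Model R z lam lamI del) (ε : Bool) (a b c : M.I) (H : M.I → R) :
    M.T ε b c (fun k l => M.T ε a k fun d m => M.cup m l * H d) = M.cup a b * H c := by
  have h1 : ∀ k l, M.T ε a k (fun d m => M.cup m l * H d) =
      M.T (!ε) k l (fun m n => M.cup a m * H n) := fun k l => by
    rw [M.turnCup, Bool.not_not]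
  simp only [h1, M.r2]

theorem slideCup' (M : Model R z lam lamI del) (ε : Bool) (a b c : M.I) (H : M.I → R) :
    M.T ε a b (fun k l => M.T ε l c fun m n => M.cup k m * H n) = M.cup b c * H a := by
  have h1 : ∀ k l, M.T ε l c (fun m n => M.cup k m * H n) =
      M.T (!ε) k l (fun m n => M.cup n c * H m) := fun k l => M.turnCup ε k l c H
  simp only [h1, M.r2]

theorem slideCap (M : Model R z lam lamI del) (ε : Bool) (a : M.I) (H : M.I → M.I → M.I → R) :
    M.cap (fun k l => M.T ε l a fun m n => M.T ε k m fun d e => H d e n) =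
      M.cap (fun k l => H a k l) := by
  rw [M.turnCap ε a (fun k m n => M.T ε k m fun d e => H d e n)]
  have h : ∀ k l, M.T (!ε) a k (fun m n => M.T ε m n fun d e => H d e l) = H a k l := fun k l => by
    have := M.r2 (!ε) a k (fun d e => H d e l)
    rwa [Bool.not_not] at this
  simp only [h]

theorem slideCap' (M : Model R z lam lamI del) (ε : Bool) (a : M.I) (H : M.I → M.I → M.I → R) :
    M.cap (fun k l => M.T ε a k fun m n => M.T ε n l fun d e => H m d e) =
      M.cap (fun k l => H k l a) := by
  have h0 := M.turnCap (!ε) a (fun m n l => M.T ε n l fun d e => H m d e)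
  rw [Bool.not_not] at h0
  rw [← h0]
  have h : ∀ k l, M.T (!ε) l a (fun m n => M.T ε m n fun d e => H k d e) = H k l a := fun k l => by
    have := M.r2 (!ε) l a (fun d e => H k d e)
    rwa [Bool.not_not] at this
  simp only [h]

/-- Turning a crossing round the minimum gives a negative crossing, which the skein relation makes
positive again. -/
theorem T_cup_comm (M : Model R z lam lamI del) (a b c : M.I) (H : M.I → R) :
    M.T true a b (fun k l => M.cup l c * H k) + z * (M.cup a b * H c) =
      M.T true b c (fun k l => M.cup a k * H l) + z * (M.cup b c * H a) := by
  rw [M.turnCup true a b c H, M.skein a b, M.zig c H, Bool.not_true]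
  ring

/-- One of the two crossings is made negative by the skein relation; it cancels the other, and the
remaining term is a curl on a minimum. -/
theorem T_true_true (M : Model R z lam lamI del) (a b : M.I) (G : M.I → M.I → R) :
    M.T true a b (fun k l => M.T true k l G) =
      G a b + z * M.T true a b G + -z * (lam * (M.cup a b * M.cap G)) := by
  have h : (fun k l => M.T true k l G) = fun k l =>
      M.T false k l G + z * (G k l + (-1) * (M.cup k l * M.cap G)) := by
    funext k l; exact M.skein k l G
  have h2 := M.cupCurl true a b
  simp only [curlFactor, if_true] at h2
  rw [h, M.T_add, M.T_mul, M.T_add, M.T_mul, T_mul_right, ← Bool.not_true, M.r2, h2]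
  ring

theorem cap_mul_right (M : Model R z lam lamI del) (G : M.I → M.I → R) (c : R) :
    M.cap (fun k l => G k l * c) = M.cap G * c := by
  simp only [mul_comm _ c, M.cap_mul]

theorem cap_T (M : Model R z lam lamI del) (a : M.I) (H : M.I → M.I → M.I → R) :
    M.cap (fun k l => M.T true a k fun m n => H m n l) =
      M.cap (fun k l => M.T true l a fun m n => H k m n) + z * M.cap (fun k l => H a k l)
        + -z * M.cap (fun k l => H k l a) := by
  rw [M.turnCap true a H]
  have h : (fun k l => M.T true a k fun m n => H m n l) = fun k l =>
      M.T false a k (fun m n => H m n l) +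
        z * (H a k l + (-1) * (M.cup a k * M.cap (fun m n => H m n l))) := by
    funext k l; exact M.skein a k (fun m n => H m n l)
  rw [h, M.cap_add, M.cap_mul, M.cap_add, M.cap_mul, M.zag a (fun l => M.cap (fun m n => H m n l)),
    Bool.not_true]
  ring

/-- Turning the crossing round the minimum reverses its sign, so the curl on a vertical string has
the factor of `capCurl` with `lam` and `lamI` exchanged. -/
theorem cap_T_cup (M : Model R z lam lamI del) (ε : Bool) (a : M.I) (H : M.I → R) :
    M.cap (fun k l => M.T ε a k fun d m => M.cup m l * H d) = curlFactor lamI lam ε * H a := by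
  have h : (fun k l => M.T ε a k fun d m => M.cup m l * H d) = fun k l =>
      M.T (!ε) k l (fun m n => M.cup a m * H n) := by
    funext k l
    rw [M.turnCup, Bool.not_not]
  rw [h, M.capCurl, M.zag]
  cases ε <;> rfl

theorem cap_T_cup' (M : Model R z lam lamI del) (ε : Bool) (a : M.I) (H : M.I → R) :
    M.cap (fun k l => M.T ε l a fun d m => M.cup k d * H m) = curlFactor lamI lam ε * H a := by
  have h : (fun k l => M.T ε l a fun d m => M.cup k d * H m) = fun k l =>
      M.T (!ε) k l (fun m n => M.cup n a * H m) := by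
    funext k l; exact M.turnCup ε k l a H
  rw [h, M.capCurl, M.zig]
  cases ε <;> rfl

/-! ### Extension of a vertex model by a pair of opposite labels -/

/-- The labels of the extended model: `some` label of the old model or one of two new ones. -/
abbrev EI (M : Model R z lam lamI del) : Type := M.I ⊕ Bool

variable (M : Model R z lam lamI del) (q qi : R)

/-- The functional of the labels below a crossing, in the extended model. -/
def extT : Bool → M.EI → M.EI → (M.EI → M.EI → R) → R
  | true, .inr true, .inr true, G => q * G (.inr true) (.inr true)
  | true, .inr false, .inr false, G => q * G (.inr false) (.inr false)
  | true, .inr true, .inl a, G => G (.inl a) (.inr true)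
  | true, .inl a, .inr true, G => G (.inr true) (.inl a) + z * G (.inl a) (.inr true)
  | true, .inl a, .inr false, G => G (.inr false) (.inl a)
  | true, .inr false, .inl a, G => G (.inl a) (.inr false) + z * G (.inr false) (.inl a)
  | true, .inl a, .inl b, G => M.T true a b (fun k l => G (.inl k) (.inl l)) +
      (-z * (lam * qi) * M.cup a b) * G (.inr false) (.inr true)
  | true, .inr true, .inr false, G => qi * G (.inr false) (.inr true)
  | true, .inr false, .inr true, G => qi * G (.inr true) (.inr false) +
      z * (1 - lam * qi) * G (.inr false) (.inr true) +
      -z * M.cap (fun k l => G (.inl k) (.inl l))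
  | false, .inr true, .inr true, G => qi * G (.inr true) (.inr true)
  | false, .inr false, .inr false, G => qi * G (.inr false) (.inr false)
  | false, .inr true, .inl a, G => G (.inl a) (.inr true) + -z * G (.inr true) (.inl a)
  | false, .inl a, .inr true, G => G (.inr true) (.inl a)
  | false, .inl a, .inr false, G => G (.inr false) (.inl a) + -z * G (.inl a) (.inr false)
  | false, .inr false, .inl a, G => G (.inl a) (.inr false)
  | false, .inl a, .inl b, G => M.T false a b (fun k l => G (.inl k) (.inl l)) +
      (z * M.cup a b) * G (.inr true) (.inr false)
  | false, .inr true, .inr false, G => q * G (.inr false) (.inr true) +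
      z * (lamI * q - 1) * G (.inr true) (.inr false) +
      z * (lamI * q) * M.cap (fun k l => G (.inl k) (.inl l))
  | false, .inr false, .inr true, G => q * G (.inr true) (.inr false)

/-- The functional of the labels below a maximum, in the extended model. -/
def extCap (G : M.EI → M.EI → R) : R :=
  G (.inr true) (.inr false) + (lam * qi) * G (.inr false) (.inr true) +
    M.cap (fun k l => G (.inl k) (.inl l))

/-- The weight of a minimum, in the extended model. -/
def extCup : M.EI → M.EI → R
  | .inl a, .inl b => M.cup a b
  | .inr false, .inr true => 1
  | .inr true, .inr false => lamI * q
  | _, _ => 0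

variable {q qi}

/-- The equation is checked on the 27 patterns of old and new labels. For three old labels the
corrections through the new pair cancel because strings slide over minima. If an old label stands
beside the pair `false`, `true`, the sum over old pairs slides past it. The other cases follow by
expansion and the relations between the parameters. -/
theorem ext_r3 (hq : q * qi = 1) (hz : z = q - qi) (hl : lam * lamI = 1)
    (hd : z * del = z + lamI - lam) (a b c : M.EI)
    (G : M.EI → M.EI → M.EI → R) :
    M.extT q qi true a b (fun k l => M.extT q qi true l c fun m f =>
      M.extT q qi true k m fun d e => G d e f) =
    M.extT q qi true b c (fun k l => M.extT q qi true a k fun d m =>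
      M.extT q qi true m l fun e f => G d e f) := by
  have hcup : ∀ a b, M.T true a b M.cup = lam * M.cup a b := fun a b => M.cupCurl true a b
  have hcap : ∀ G : M.I → M.I → R, M.cap (fun k l => M.T true k l G) = lam * M.cap G :=
    fun G => M.capCurl true G
  rcases a with a | _ | _ <;> rcases b with b | _ | _ <;> rcases c with c | _ | _ <;>
    simp only [extT, M.T_add, M.T_mul, M.cap_add, M.cap_mul, T_mul_right, mul_assoc]
  case inl.inl.inl =>
    have h1 := M.r3 a b c (fun d e f => G (.inl d) (.inl e) (.inl f))
    have h2 := M.slideCup true a b c (fun d => G (.inl d) (.inr false) (.inr true))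
    have h3 := M.slideCup' true a b c (fun d => G (.inr false) (.inr true) (.inl d))
    have h4 := M.T_cup_comm a b c (fun d => G (.inr false) (.inl d) (.inr true))
    linear_combination h1 + z * lam * qi * (h2 - h3 - h4)
  case inl.inr.false.inr.true =>
    simp only [M.slideCap', M.zag, M.cap_T_cup, curlFactor, if_true]
    grind
  case inr.false.inr.true.inl =>
    simp only [M.slideCap, M.zig, M.cap_T_cup', curlFactor, if_true]
    grind
  all_goals try simp only [T_true_true, hcup, hcap, M.cap_mul_right, M.cap_T, M.circle, M.zag, M.zig]
  all_goals first | ring1 | grind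

theorem ext_r2 (hq : q * qi = 1) (hz : z = q - qi) (hl : lam * lamI = 1)
    (hd : z * del = z + lamI - lam) (ε) (a b : M.EI) (G : M.EI → M.EI → R) :
    M.extT q qi ε a b (fun k l => M.extT q qi (!ε) k l G) = G a b := by
  have hcup : ∀ ε a b, M.T ε a b M.cup = curlFactor lam lamI ε * M.cup a b := M.cupCurl
  have hcap : ∀ ε (G : M.I → M.I → R), M.cap (fun k l => M.T ε k l G) =
    curlFactor lam lamI ε * M.cap G := M.capCurl
  have h1 := M.r2 true
  have h2 := M.r2 false
  simp only [Bool.not_true, Bool.not_false] at h1 h2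
  cases ε <;> rcases a with a | _ | _ <;> rcases b with b | _ | _ <;>
    simp only [extT, Bool.not_true, Bool.not_false, M.T_add, M.T_mul, M.cap_add, M.cap_mul,
      T_mul_right, cap_mul_right, mul_assoc, hcup, hcap, curlFactor, h1, h2, if_true,
      Bool.false_eq_true, if_false, M.circle] <;> first | ring1 | grind

theorem ext_skein (hq : q * qi = 1) (hz : z = q - qi) (hl : lam * lamI = 1)
    (a b : M.EI) (G : M.EI → M.EI → R) :
    M.extT q qi true a b G = M.extT q qi false a b G +
      z * (G a b + (-1) * (M.extCup (q := q) a b * M.extCap (qi := qi) G)) := by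
  rcases a with a | _ | _ <;> rcases b with b | _ | _ <;>
    simp only [extT, extCap, extCup, M.skein] <;> first | ring1 | grind

theorem ext_zig (hq : q * qi = 1) (hl : lam * lamI = 1) (a) (H : M.EI → R) :
    M.extCap (qi := qi) (fun k l => M.extCup (q := q) l a * H k) = H a := by
  rcases a with a | _ | _ <;> simp only [extCap, extCup, M.zig, M.cap_zero, zero_mul] <;> grind

theorem ext_zag (hq : q * qi = 1) (hl : lam * lamI = 1) (a) (H : M.EI → R) :
    M.extCap (qi := qi) (fun k l => M.extCup (q := q) a k * H l) = H a := by
  rcases a with a | _ | _ <;> simp only [extCap, extCup, M.zag, M.cap_zero, zero_mul] <;> grind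

theorem ext_turnCap (hq : q * qi = 1) (hz : z = q - qi) (hl : lam * lamI = 1)
    (ε a) (H : M.EI → M.EI → M.EI → R) :
    M.extCap (qi := qi) (fun k l => M.extT q qi ε l a fun m n => H k m n) =
    M.extCap (qi := qi) (fun k l => M.extT q qi (!ε) a k fun m n => H m n l) := by
  have h1 := M.turnCap true
  have h2 := M.turnCap false
  simp only [Bool.not_true, Bool.not_false] at h1 h2
  cases ε <;> rcases a with a | _ | _ <;>
    simp only [extCap, extT, Bool.not_true, Bool.not_false, M.cap_add, M.cap_mul, mul_assoc,
      M.zig, M.zag, h1, h2] <;> first | ring1 | grind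

theorem ext_turnCup (hq : q * qi = 1) (hz : z = q - qi) (hl : lam * lamI = 1)
    (ε a b c) (H : M.EI → R) :
    M.extT q qi ε b c (fun m n => M.extCup (q := q) a m * H n) =
    M.extT q qi (!ε) a b (fun m n => M.extCup (q := q) n c * H m) := by
  have h1 := M.turnCup true
  have h2 := M.turnCup false
  simp only [Bool.not_true, Bool.not_false] at h1 h2
  cases ε <;> rcases a with a | _ | _ <;> rcases b with b | _ | _ <;> rcases c with c | _ | _ <;>
    simp only [extCup, extT, Bool.not_true, Bool.not_false, mul_assoc, M.T_zero,
      M.cap_zero, M.zig, M.zag, h1, h2, zero_mul] <;> first | ring1 | grind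

/-- The new pair also meets a circle of old labels; `hd` eliminates the product `z * del` that it
contributes. -/
theorem ext_capCurl (hq : q * qi = 1) (hz : z = q - qi) (hl : lam * lamI = 1)
    (hd : z * del = z + lamI - lam) (ε) (G : M.EI → M.EI → R) :
    M.extCap (qi := qi) (fun k l => M.extT q qi ε k l G) =
      curlFactor (lam * qi ^ 2) (lamI * q ^ 2) ε * M.extCap (qi := qi) G := by
  have hcap : ∀ ε (G : M.I → M.I → R), M.cap (fun k l => M.T ε k l G) =
    curlFactor lam lamI ε * M.cap G := M.capCurl
  cases ε <;>
    simp only [extT, extCap, M.cap_add, M.cap_mul, M.cap_mul_right, mul_assoc, hcap, curlFactor,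
      if_true, Bool.false_eq_true, if_false, M.circle] <;> grind

theorem ext_cupCurl (hq : q * qi = 1) (hz : z = q - qi) (hl : lam * lamI = 1)
    (hd : z * del = z + lamI - lam) (ε) (a b : M.EI) :
    M.extT q qi ε a b (M.extCup (q := q)) =
      curlFactor (lam * qi ^ 2) (lamI * q ^ 2) ε * M.extCup (q := q) a b := by
  have hcup : ∀ ε a b, M.T ε a b (fun k l => M.cup k l) = curlFactor lam lamI ε * M.cup a b :=
    M.cupCurl
  have hc : M.cap (fun k l => M.cup k l) = del := M.circle
  cases ε <;> rcases a with a | _ | _ <;> rcases b with b | _ | _ <;>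
    simp only [extT, extCup, hcup, hc, curlFactor, if_true, Bool.false_eq_true, if_false] <;>
    first | ring1 | grind

theorem ext_circle :
    M.extCap (qi := qi) (M.extCup (q := q)) = lamI * q + lam * qi + del := by
  have hc : M.cap (fun k l => M.cup k l) = del := M.circle
  simp only [extCap, extCup, hc]; ring


theorem extT_add (ε) (a b : M.EI) (G H : M.EI → M.EI → R) :
    M.extT q qi ε a b (fun k l => G k l + H k l) = M.extT q qi ε a b G + M.extT q qi ε a b H := by
  cases ε <;> rcases a with a | _ | _ <;> rcases b with b | _ | _ <;>
    simp only [extT, M.T_add, M.cap_add] <;> ring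

theorem extT_mul (ε) (a b : M.EI) (c : R) (G : M.EI → M.EI → R) :
    M.extT q qi ε a b (fun k l => c * G k l) = c * M.extT q qi ε a b G := by
  cases ε <;> rcases a with a | _ | _ <;> rcases b with b | _ | _ <;>
    simp only [extT, M.T_mul, M.cap_mul] <;> ring

/-- The vertex model with two more labels. -/
def extend (hq : q * qi = 1) (hz : z = q - qi) (hl : lam * lamI = 1)
    (hd : z * del = z + lamI - lam) :
    Model R z (lam * qi ^ 2) (lamI * q ^ 2) (lamI * q + lam * qi + del) where
  I := M.EI
  finite := by
    have := M.finite
    infer_instance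
  T := M.extT q qi
  cap := M.extCap (qi := qi)
  cup := M.extCup (q := q)
  T_add := M.extT_add
  T_mul := M.extT_mul
  cap_add G H := by simp only [extCap, M.cap_add]; ring
  cap_mul c G := by simp only [extCap, M.cap_mul]; ring
  zig := M.ext_zig hq hl
  zag := M.ext_zag hq hl
  turnCap := M.ext_turnCap hq hz hl
  turnCup := M.ext_turnCup hq hz hl
  r2 := M.ext_r2 hq hz hl hd
  r3 := M.ext_r3 hq hz hl hd
  skein := M.ext_skein hq hz hl
  capCurl := M.ext_capCurl hq hz hl hd
  cupCurl := M.ext_cupCurl hq hz hl hd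
  circle := M.ext_circle

/-- The vertex model without labels. -/
def empty (q qi : R) : Model R (q - qi) q qi 0 where
  I := Empty
  finite := inferInstance
  T _ a := a.elim
  cap _ := 0
  cup a := a.elim
  T_add _ a := a.elim
  T_mul _ a := a.elim
  cap_add _ _ := by simp
  cap_mul _ _ := by simp
  zig a := a.elim
  zag a := a.elim
  turnCap _ a := a.elim
  turnCup _ a := a.elim
  r2 _ a := a.elim
  r3 a := a.elim
  skein a := a.elim
  capCurl _ _ := by simp
  cupCurl _ a := a.elim
  circle := rfl

/-- After the ring homomorphism `f`, crossings exchange labels and a maximum has the sum of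
its values on the pairs of a label and its opposite. -/
structure Flat {S : Type} [CommRing S] (f : R →+* S) (bar : M.I → M.I) : Prop where
  T : ∀ ε a b G, f (M.T ε a b G) = f (G b a)
  cap : ∀ G (_ : Fintype M.I), f (M.cap G) = ∑ k, f (G k (bar k))

/-- The two new labels become the last pair, and the older pairs are kept. -/
theorem exists_pairs_sum_bool {X : Type} {m : ℕ} (bar : X → X) (p : Fin m → Bool → X)
    (hp : ∀ i j b c, p i b = p j c → i = j ∧ b = c) (hpb : ∀ i b, bar (p i b) = p i (!b)) :
    ∃ p' : Fin (m + 1) → Bool → X ⊕ Bool, (∀ i j b c, p' i b = p' j c → i = j ∧ b = c) ∧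
      ∀ i b, Sum.map bar not (p' i b) = p' i (!b) := by
  refine ⟨Fin.lastCases .inr fun i b => .inl (p i b), ?_, ?_⟩
  · intro i j b c
    refine Fin.lastCases ?_ (fun i => ?_) i <;> refine Fin.lastCases ?_ (fun j => ?_) j
    · simp
    · simp
    · simp
    · simpa using hp i j b c
  · intro i b
    refine Fin.lastCases ?_ (fun i => ?_) i
    · simp
    · simpa using hpb i b

/-- There are vertex models with arbitrarily many labels. -/
theorem exists_model {S : Type} [CommRing S] (f : R →+* S) (hf : f q = 1) (hq : q * qi = 1)
    (m : ℕ) : ∃ (lam lamI d : R) (M : Model R (q - qi) lam lamI d) (bar : M.I → M.I)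
      (p : Fin m → Bool → M.I), lam * lamI = 1 ∧ lam = q * qi ^ (2 * m) ∧
      (q - qi) * d = (q - qi) + lamI - lam ∧ M.Flat f bar ∧ Function.Involutive bar ∧
      (∀ i j b c, p i b = p j c → i = j ∧ b = c) ∧
      ∀ i b, bar (p i b) = p i (!b) := by
  have hfi : f qi = 1 := by
    have := congrArg f hq
    rwa [map_mul, hf, one_mul, map_one] at this
  induction m with
  | zero =>
    -- Without labels a circle has the value `0`, and `λ = q` satisfies the relation of `Λ`.
    exact ⟨q, qi, 0, empty q qi, id, fun i => i.elim0, hq, by simp, by ring,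
      ⟨fun _ a => a.elim, fun G _ => by
        exact f.map_zero.trans (Finset.sum_eq_zero fun k _ => Empty.elim k).symm⟩,
      fun a => rfl, fun i => i.elim0, fun i => i.elim0⟩
  | succ m ih =>
    obtain ⟨lam, lamI, d, M, bar, p, hl, hlam, hd, hflat, hbar, hp, hpb⟩ := ih
    have hfl : f lam = 1 := by simp [hlam, hf, hfi]
    have hfI : f lamI = 1 := by
      have := congrArg f hl
      rwa [map_mul, hfl, one_mul, map_one] at this
    obtain ⟨p', hp', hpb'⟩ := exists_pairs_sum_bool bar p hp hpb
    refine ⟨_, _, _, M.extend hq rfl hl hd, Sum.map bar not,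
      p', ?_, ?_, ?_, ⟨?_, ?_⟩, ?_, ?_, ?_⟩
    · grind
    · rw [hlam]; ring
    · grind
    · intro ε a b G
      cases ε <;> rcases a with a | _ | _ <;> rcases b with b | _ | _ <;>
        simp [extend, extT, hf, hfi, hfl, hfI, hflat.T]
    · intro G inst
      have : Fintype M.I := @Fintype.ofFinite _ M.finite
      -- At `q = 1` the new labels contribute their two orders, each with weight `1`.
      have hG : f (M.extCap (qi := qi) G) =
          ∑ k : M.I ⊕ Bool, f (G k (Sum.map bar not k)) := by
        simp only [extCap, map_add, map_mul, hfl, hfi, hflat.cap _ this]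
        rw [Fintype.sum_sum_type]
        simp
        ring
      rw [Subsingleton.elim inst (inferInstanceAs (Fintype (M.I ⊕ Bool)))]
      exact hG
    · rintro (a | a)
      · exact congrArg Sum.inl (hbar a)
      · exact congrArg Sum.inr (Bool.not_not a)
    · exact hp'
    · exact hpb'

end Model

/-! ### Linear maps on the tangle module -/

/-- A function of the words that respects the relations gives a linear map. -/
theorem exists_linearMap {V : Type} [AddCommGroup V] [Module Scal V] {m n : ℕ}
    (g : List Piece → V)
    (hmove : ∀ u x y v, Move x y → Runs (u ++ x ++ v) m n → Runs (u ++ y ++ v) m n →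
      g (u ++ x ++ v) = g (u ++ y ++ v))
    (hskein : ∀ u v i, Runs (u ++ [⟨.cross true, i⟩] ++ v) m n →
      Runs (u ++ v) m n → Runs (u ++ [⟨.cup, i⟩, ⟨.cap, i⟩] ++ v) m n →
      g (u ++ [⟨.cross true, i⟩] ++ v) - g (u ++ [⟨.cross false, i⟩] ++ v) =
        sZ • (g (u ++ v) - g (u ++ [⟨.cup, i⟩, ⟨.cap, i⟩] ++ v)))
    (hcurl : ∀ u v i ε, Runs (u ++ [⟨.cap, i⟩, ⟨.cross ε, i + 1⟩, ⟨.cup, i⟩] ++ v) m n →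
      Runs (u ++ v) m n →
      g (u ++ [⟨.cap, i⟩, ⟨.cross ε, i + 1⟩, ⟨.cup, i⟩] ++ v) =
        curlFactor sLamInv sLam ε • g (u ++ v))
    (hcurl' : ∀ u v i ε, Runs (u ++ [⟨.cap, i + 1⟩, ⟨.cross ε, i⟩, ⟨.cup, i + 1⟩] ++ v) m n →
      Runs (u ++ v) m n →
      g (u ++ [⟨.cap, i + 1⟩, ⟨.cross ε, i⟩, ⟨.cup, i + 1⟩] ++ v) =
        curlFactor sLamInv sLam ε • g (u ++ v))
    (hcircle : ∀ u v i, Runs (u ++ [⟨.cap, i⟩, ⟨.cup, i⟩] ++ v) m n → Runs (u ++ v) m n →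
      g (u ++ [⟨.cap, i⟩, ⟨.cup, i⟩] ++ v) = sDel • g (u ++ v)) :
    ∃ f : TMod m n →ₗ[Scal] V, ∀ w, Runs w m n → f (cls m n w) = g w := by
  let g' : Tangle m n → V := Quot.lift (fun D => g D.word) fun D E ⟨u, v, x, y, h, hD, hE⟩ => by
    show g D.word = g E.word
    have h1 := D.runs
    have h2 := E.runs
    rw [hD] at h1 ⊢
    rw [hE] at h2 ⊢
    exact hmove u x y v h h1 h2
  have hg' : ∀ D : Diagram m n, g' D.toTangle = g D.word := fun D => rfl
  let F : (Tangle m n →₀ Scal) →ₗ[Scal] V := Finsupp.linearCombination Scal g'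
  have hF : ∀ D : Diagram m n, F (Finsupp.single D.toTangle 1) = g D.word := fun D => by
    rw [Finsupp.linearCombination_single, one_smul, hg']
  have key : ∀ x, Relator m n x → F (show Tangle m n →₀ Scal from x) = 0 := by
    intro x hx
    have hsub : ∀ (D E : Diagram m n) (c : Scal), g D.word = c • g E.word →
        F ((Finsupp.single D.toTangle (1 : Scal)) - c • Finsupp.single E.toTangle (1 : Scal)) = 0 :=
      fun D E c h => by rw [map_sub, map_smul, hF, hF, h, sub_self]
    cases hx with
    | skein u v i P N Z I hP hN hZ hI =>
      have : F ((Finsupp.single P.toTangle (1 : Scal)) - Finsupp.single N.toTangle (1 : Scal) -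
          sZ • (Finsupp.single Z.toTangle (1 : Scal) - Finsupp.single I.toTangle (1 : Scal))) = 0 := by
        rw [map_sub, map_sub, map_smul, map_sub, hF, hF, hF, hF, hP, hN, hZ, hI, sub_eq_zero]
        exact hskein u v i (hP ▸ P.runs) (hZ ▸ Z.runs) (hI ▸ I.runs)
      exact this
    | rightCurl i K D h =>
      refine hsub K D sLamInv ?_
      rcases h with ⟨u, v, hK, hD⟩ | ⟨u, v, hK, hD⟩
      all_goals
        simp only [List.append_nil] at hD
        rw [hK, hD]
      · exact hcurl u v i true (hK ▸ K.runs) (hD ▸ D.runs)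
      · exact hcurl' u v i true (hK ▸ K.runs) (hD ▸ D.runs)
    | leftCurl i K D h =>
      refine hsub K D sLam ?_
      rcases h with ⟨u, v, hK, hD⟩ | ⟨u, v, hK, hD⟩
      all_goals
        simp only [List.append_nil] at hD
        rw [hK, hD]
      · exact hcurl u v i false (hK ▸ K.runs) (hD ▸ D.runs)
      · exact hcurl' u v i false (hK ▸ K.runs) (hD ▸ D.runs)
    | circle i K D h =>
      refine hsub K D sDel ?_
      obtain ⟨u, v, hK, hD⟩ := h
      simp only [List.append_nil] at hD
      rw [hK, hD]
      exact hcircle u v i (hK ▸ K.runs) (hD ▸ D.runs)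
  let S : Submodule Scal (Tangle m n →₀ Scal) :=
    Submodule.span Scal {x | Relator m n (show Tangle m n →₀ Coeff from x)}
  have hS : S ≤ LinearMap.ker F := Submodule.span_le.2 fun x hx => key x hx
  let f : ((Tangle m n →₀ Scal) ⧸ S) →ₗ[Scal] V := S.liftQ F hS
  refine ⟨f, fun w hw => ?_⟩
  rw [cls_eq hw]
  exact (hF ⟨w, hw⟩)

/-! ### States of a vertex model -/

namespace Model

variable {R : Type} [CommRing R] {z lam lamI del : R} (M : Model R z lam lamI del)

/-- The operator of a piece, from functions of the labels below to functions of the labels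
above. -/
def act : Shape → ℕ → (List M.I → R) → List M.I → R
  | s, i + 1, G, a :: X => act s i (fun Y => G (a :: Y)) X
  | .cross ε, 0, G, a :: b :: X => M.T ε a b fun k l => G (k :: l :: X)
  | .cap, 0, G, X => M.cap fun k l => G (k :: l :: X)
  | .cup, 0, G, a :: b :: X => M.cup a b * G X
  | _, _, _, _ => 0

/-- The operator of a word. -/
def ev : List Piece → (List M.I → R) → List M.I → R
  | [], G => G
  | p :: w, G => M.act p.shape p.left (ev w G)

theorem ev_append (x y : List Piece) (G : List M.I → R) : M.ev (x ++ y) G = M.ev x (M.ev y G) := by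
  induction x with
  | nil => rfl
  | cons p x ih => simp [ev, ih]

@[simp] theorem act_cross (ε : Bool) (G : List M.I → R) (a b X) :
    M.act (.cross ε) 0 G (a :: b :: X) = M.T ε a b fun k l => G (k :: l :: X) := by simp [act]

@[simp] theorem act_cap (G : List M.I → R) (X) :
    M.act .cap 0 G X = M.cap fun k l => G (k :: l :: X) := by
  rcases X with _ | ⟨a, X⟩ <;> simp [act]

@[simp] theorem act_cup (G : List M.I → R) (a b X) :
    M.act .cup 0 G (a :: b :: X) = M.cup a b * G X := by simp [act]

@[simp] theorem act_succ (s : Shape) (i : ℕ) (G : List M.I → R) (a X) :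
    M.act s (i + 1) G (a :: X) = M.act s i (fun Y => G (a :: Y)) X := by
  cases s <;> simp [act]

theorem act_append (s : Shape) (i : ℕ) (U X : List M.I) (G : List M.I → R) :
    M.act s (i + U.length) G (U ++ X) = M.act s i (fun Y => G (U ++ Y)) X := by
  induction U generalizing G with
  | nil => rfl
  | cons a U ih =>
    rw [List.length_cons, ← add_assoc, List.cons_append, act_succ, ih]
    rfl

theorem ev_sh (U : List M.I) (w : List Piece) (G : List M.I → R) (X : List M.I) :
    M.ev (sh U.length w) G (U ++ X) = M.ev w (fun Y => G (U ++ Y)) X := by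
  induction w generalizing X with
  | nil => rfl
  | cons p w ih =>
    rw [sh_cons, ev, ev]
    simp only [act_append, ih]

/-- The weights are the values on indicator functions; this is where finiteness of the set of labels
is needed. -/
theorem functional_eq_sum {I : Type} [Fintype I] [DecidableEq I] (φ : (I → I → R) → R)
    (hadd : ∀ G H, φ (fun k l => G k l + H k l) = φ G + φ H)
    (hmul : ∀ c G, φ (fun k l => c * G k l) = c * φ G) :
    ∃ c : I × I → R, ∀ G, φ G = ∑ i : I × I, c i * G i.1 i.2 := by
  refine ⟨fun i => φ (fun k l => if i = (k, l) then 1 else 0), fun G => ?_⟩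
  let L : (I × I → R) →ₗ[R] R :=
    { toFun := fun G => φ fun k l => G (k, l)
      map_add' := fun G H => hadd _ _
      map_smul' := fun c G => hmul c _ }
  have := LinearMap.pi_apply_eq_sum_univ L fun p => G p.1 p.2
  calc φ G = _ := this
    _ = _ := Finset.sum_congr rfl fun i _ => mul_comm _ _

/-- Every operator is a sum over the labels below the piece. -/
theorem exists_weights (s : Shape) (A : List M.I) (hA : A.length = s.ins) :
    ∃ (ι : Type) (_ : Fintype ι) (c : ι → R) (y : ι → List M.I), (∀ j, (y j).length = s.outs) ∧
      ∀ G W, M.act s 0 G (A ++ W) = ∑ j, c j * G (y j ++ W) := by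
  classical
  have : Fintype M.I := @Fintype.ofFinite _ M.finite
  cases s with
  | cross ε =>
    obtain ⟨a, b, rfl⟩ := List.length_eq_two.1 hA
    obtain ⟨c, hc⟩ := functional_eq_sum (M.T ε a b) (M.T_add ε a b) (M.T_mul ε a b)
    refine ⟨M.I × M.I, inferInstance, c, fun i => [i.1, i.2], fun _ => rfl, fun G W => ?_⟩
    rw [List.cons_append, List.cons_append, List.nil_append, act_cross, hc]
    rfl
  | cap =>
    obtain ⟨c, hc⟩ := functional_eq_sum M.cap M.cap_add M.cap_mul
    refine ⟨M.I × M.I, inferInstance, c, fun i => [i.1, i.2], fun _ => rfl, fun G W => ?_⟩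
    rw [List.length_eq_zero_iff.1 hA, List.nil_append, act_cap, hc]
    rfl
  | cup =>
    obtain ⟨a, b, rfl⟩ := List.length_eq_two.1 hA
    refine ⟨Unit, inferInstance, fun _ => M.cup a b, fun _ => [], fun _ => rfl, fun G W => ?_⟩
    simp

theorem act_add (s : Shape) (i : ℕ) (G H : List M.I → R) (X : List M.I) :
    M.act s i (fun Y => G Y + H Y) X = M.act s i G X + M.act s i H X := by
  induction i generalizing G H X with
  | zero =>
    rcases s with _ | _ | _ <;> rcases X with _ | ⟨a, _ | ⟨b, X⟩⟩ <;>
      simp [act, M.T_add, M.cap_add, mul_add]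
  | succ i ih =>
    rcases X with _ | ⟨a, X⟩
    · cases s <;> simp [act]
    · simp [ih]

theorem act_mul (s : Shape) (i : ℕ) (c : R) (G : List M.I → R) (X : List M.I) :
    M.act s i (fun Y => c * G Y) X = c * M.act s i G X := by
  induction i generalizing G X with
  | zero =>
    rcases s with _ | _ | _ <;> rcases X with _ | ⟨a, _ | ⟨b, X⟩⟩ <;>
      simp [act, M.T_mul, M.cap_mul, mul_left_comm]
  | succ i ih =>
    rcases X with _ | ⟨a, X⟩
    · cases s <;> simp [act]
    · simp [ih]

theorem ev_add (w : List Piece) (G H : List M.I → R) :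
    M.ev w (fun Y => G Y + H Y) = fun X => M.ev w G X + M.ev w H X := by
  induction w with
  | nil => rfl
  | cons p w ih =>
    funext X
    simp only [ev, ih, act_add]

theorem ev_mul (w : List Piece) (c : R) (G : List M.I → R) :
    M.ev w (fun Y => c * G Y) = fun X => c * M.ev w G X := by
  induction w with
  | nil => rfl
  | cons p w ih =>
    funext X
    simp only [ev, ih, act_mul]

/-- The operator looks at `G` only on lists of the length found below the piece, so identities that
need enough strings can be applied inside longer words. -/
theorem act_congr {s : Shape} {i : ℕ} {G H : List M.I → R} {X : List M.I}
    (h : i + s.ins ≤ X.length)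
    (hGH : ∀ Y, Y.length = X.length - s.ins + s.outs → G Y = H Y) :
    M.act s i G X = M.act s i H X := by
  induction i generalizing G H X with
  | zero =>
    obtain ⟨ι, _, c, y, hy, hs⟩ := M.exists_weights s (X.take s.ins) (by simp; omega)
    have e : X = X.take s.ins ++ X.drop s.ins := (List.take_append_drop _ _).symm
    rw [e, hs, hs]
    refine Finset.sum_congr rfl fun j _ => ?_
    rw [hGH]
    simp [hy]; omega
  | succ i ih =>
    rcases X with _ | ⟨a, X⟩
    · simp at h
    · rw [act_succ, act_succ]
      simp only [List.length_cons] at h hGH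
      exact ih (by omega) fun Y hY => hGH _ (by simp; omega)

theorem ev_congr {w : List Piece} {m n : ℕ} (hw : Runs w m n) {G H : List M.I → R}
    (hGH : ∀ Y, Y.length = n → G Y = H Y) {X : List M.I} (hX : X.length = m) :
    M.ev w G X = M.ev w H X := by
  induction w generalizing m X with
  | nil => exact hGH X (hX.trans hw)
  | cons p w ih =>
    obtain ⟨h1, h2⟩ := hw
    refine M.act_congr (by rw [hX]; exact h1) fun Y hY => ih h2 (by rw [hY, hX]; rfl)

/-- Both operators are finite weighted sums that change disjoint segments of the list, so the two
sides differ by the order of summation. -/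
theorem ev_slide (s t : Shape) (i k : ℕ) (G : List M.I → R) {X : List M.I}
    (hX : i + s.ins + k + t.ins ≤ X.length) :
    M.ev [⟨s, i⟩, ⟨t, i + s.outs + k⟩] G X = M.ev [⟨t, i + s.ins + k⟩, ⟨s, i⟩] G X := by
  obtain ⟨U, X, rfl, hU⟩ : ∃ U X', X = U ++ X' ∧ U.length = i :=
    ⟨X.take i, X.drop i, by simp, by simp; omega⟩
  obtain ⟨A, X, rfl, hA⟩ : ∃ U X', X = U ++ X' ∧ U.length = s.ins :=
    ⟨X.take s.ins, X.drop s.ins, by simp, by simp at hX ⊢; omega⟩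
  obtain ⟨B, X, rfl, hB⟩ : ∃ U X', X = U ++ X' ∧ U.length = k :=
    ⟨X.take k, X.drop k, by simp, by simp at hX ⊢; omega⟩
  obtain ⟨C, W, rfl, hC⟩ : ∃ U X', X = U ++ X' ∧ U.length = t.ins :=
    ⟨X.take t.ins, X.drop t.ins, by simp, by simp at hX ⊢; omega⟩
  obtain ⟨ι, _, c, y, hy, hs⟩ := M.exists_weights s A hA
  obtain ⟨κ, _, d, x, hx, ht⟩ := M.exists_weights t C hC
  have hs' : ∀ F W, M.act s i F (U ++ (A ++ W)) = ∑ j, c j * F (U ++ (y j ++ W)) := fun F W => by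
    have := M.act_append s 0 U (A ++ W) F
    rw [hU, zero_add] at this
    rw [this, hs]
  have ht' : ∀ F Z n, Z.length = n → M.act t n F (Z ++ (C ++ W)) = ∑ j, d j * F (Z ++ (x j ++ W)) :=
    fun F Z n hZ => by
      have := M.act_append t 0 Z (C ++ W) F
      rw [hZ, zero_add] at this
      rw [this, ht]
  have h1 : ∀ j, M.act t (i + s.outs + k) G (U ++ (y j ++ (B ++ (C ++ W)))) =
      ∑ l, d l * G (U ++ (y j ++ (B ++ (x l ++ W)))) := fun j => by
    have := ht' G (U ++ (y j ++ B)) (i + s.outs + k) (by simp [hU, hy, hB]; omega)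
    simpa only [List.append_assoc] using this
  have h2 := ht' (M.act s i G) (U ++ (A ++ B)) (i + s.ins + k) (by simp [hU, hA, hB]; omega)
  simp only [List.append_assoc] at h2
  simp only [ev]
  rw [hs', h2]
  simp only [h1, hs', Finset.mul_sum]
  rw [Finset.sum_comm]
  refine Finset.sum_congr rfl fun l _ => Finset.sum_congr rfl fun j _ => ?_
  ring

/-- An equation of operators can be checked without strings to the left. -/
theorem ev_eq_of_sh {x y x₀ y₀ : List Piece} {i m : ℕ} (hx : x = sh i x₀) (hy : y = sh i y₀)
    {X : List M.I} (hX : i + m ≤ X.length) {c : R} 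
    (h : ∀ (X : List M.I) (G : List M.I → R), m ≤ X.length → M.ev x₀ G X = c * M.ev y₀ G X)
    (G : List M.I → R) : M.ev x G X = c * M.ev y G X := by
  obtain ⟨U, X, rfl, rfl⟩ : ∃ U X', X = U ++ X' ∧ U.length = i :=
    ⟨X.take i, X.drop i, by simp, by simp; omega⟩
  rw [hx, hy, ev_sh, ev_sh]
  exact h X _ (by simpa using hX)

/-- By `r2` the operators of negative crossings invert those of positive ones, so this is the
inverse of `r3`. -/
theorem r3_false (a b c : M.I) (G : M.I → M.I → M.I → R) :
    M.T false a b (fun k l => M.T false l c fun m f => M.T false k m fun d e => G d e f) =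
      M.T false b c (fun k l => M.T false a k fun d m => M.T false m l fun e f => G d e f) := by
  let A (ε : Bool) (H : M.I → M.I → M.I → R) : M.I → M.I → M.I → R :=
    fun a b c => M.T ε a b fun k l => H k l c
  let B (ε : Bool) (H : M.I → M.I → M.I → R) : M.I → M.I → M.I → R :=
    fun a b c => M.T ε b c fun k l => H a k l
  have hA : ∀ ε H, A ε (A (!ε) H) = H := fun ε H => by
    funext a b c; exact M.r2 ε a b fun k l => H k l c
  have hB : ∀ ε H, B ε (B (!ε) H) = H := fun ε H => by
    funext a b c; exact M.r2 ε b c fun k l => H a k l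
  have hAB : ∀ H, A true (B true (A true H)) = B true (A true (B true H)) := fun H => by
    funext a b c; exact M.r3 a b c H
  suffices A false (B false (A false G)) = B false (A false (B false G)) from
    congrFun (congrFun (congrFun this a) b) c
  have hK : A true (B true (A true (A false (B false (A false G))))) = G := by
    exact (congrArg (fun K => A true (B true K)) (hA true _)).trans
      ((congrArg (A true) (hB true _)).trans (hA true G))
  rw [hAB] at hK
  have h := hB false (A true (B true (A false (B false (A false G)))))
  rw [Bool.not_false, hK] at h
  rw [h]
  exact ((congrArg (B false) (hA false _)).trans (hB false _)).symm

theorem _root_.Kauffman.Move.runs_unique {x y : List Piece} (h : Move x y) {m n n' : ℕ}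
    (hx : Runs x m n) (hy : Runs y m n') : n = n' := by
  cases h <;> simp only [Runs, Piece.Fits, Piece.after, Shape.ins, Shape.outs] at hx hy <;> omega

theorem exists_cons₃ {α : Type} {X : List α} (h : 3 ≤ X.length) :
    ∃ a b c W, X = a :: b :: c :: W := by
  rcases X with _ | ⟨a, _ | ⟨b, _ | ⟨c, W⟩⟩⟩ <;> simp at h ⊢

theorem ev_move {x y : List Piece} (h : Move x y) {m n : ℕ} (hx : Runs x m n) (hy : Runs y m n)
    (G : List M.I → R) {X : List M.I} (hX : X.length = m) : M.ev x G X = M.ev y G X := by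
  have loc : ∀ {x₀ y₀ : List Piece} {i k : ℕ}, x = sh i x₀ → y = sh i y₀ → i + k ≤ m →
      (∀ (X : List M.I) (G : List M.I → R), k ≤ X.length → M.ev x₀ G X = M.ev y₀ G X) →
      M.ev x G X = M.ev y G X := fun h1 h2 h3 h4 => by
    have := M.ev_eq_of_sh h1 h2 (X := X) (c := 1) (hX ▸ h3) (fun X G h => by rw [one_mul, h4 X G h]) G
    rwa [one_mul] at this
  cases h with
  | slide s t i k => exact M.ev_slide s t i k G (by rw [hX]; exact hy.1)
  | zigzag i =>
    refine loc (x₀ := [⟨.cap, 0⟩, ⟨.cup, 1⟩]) (y₀ := []) (i := i) (k := 1) (by simp [add_comm]) (by simp) ?_ ?_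
    · simp [Runs, Piece.Fits, Piece.after, Shape.ins, Shape.outs] at hx; omega
    · rintro (_ | ⟨a, X⟩) G h
      · simp at h
      · simpa [ev] using M.zig a _
  | zagzig i =>
    refine loc (x₀ := [⟨.cap, 1⟩, ⟨.cup, 0⟩]) (y₀ := []) (i := i) (k := 1) (by simp [add_comm]) (by simp) ?_ ?_
    · simp [Runs, Piece.Fits, Piece.after, Shape.ins, Shape.outs] at hx; omega
    · rintro (_ | ⟨a, X⟩) G h
      · simp at h
      · simpa [ev] using M.zag a _
  | turnCap ε i =>
    refine loc (x₀ := [⟨.cap, 0⟩, ⟨.cross ε, 1⟩]) (y₀ := [⟨.cap, 1⟩, ⟨.cross !ε, 0⟩]) (i := i) (k := 1)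
      (by simp [add_comm]) (by simp [add_comm]) ?_ ?_
    · simp [Runs, Piece.Fits, Piece.after, Shape.ins, Shape.outs] at hx; omega
    · rintro (_ | ⟨a, X⟩) G h
      · simp at h
      · simpa [ev] using M.turnCap ε a fun k l m => G (k :: l :: m :: X)
  | turnCup ε i =>
    refine loc (x₀ := [⟨.cross ε, 1⟩, ⟨.cup, 0⟩]) (y₀ := [⟨.cross !ε, 0⟩, ⟨.cup, 1⟩]) (i := i) (k := 3)
      (by simp [add_comm]) (by simp [add_comm]) ?_ ?_
    · simp [Runs, Piece.Fits, Piece.after, Shape.ins, Shape.outs] at hx; omega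
    · intro X G h
      obtain ⟨a, b, c, X, rfl⟩ := exists_cons₃ h
      simpa [ev] using M.turnCup ε a b c fun m => G (m :: X)
  | reidemeisterTwo ε i =>
    refine loc (x₀ := [⟨.cross ε, 0⟩, ⟨.cross !ε, 0⟩]) (y₀ := []) (i := i) (k := 2)
      (by simp) (by simp) ?_ ?_
    · simp [Runs, Piece.Fits, Piece.after, Shape.ins, Shape.outs] at hx; omega
    · rintro (_ | ⟨a, _ | ⟨b, X⟩⟩) G h
      · simp at h
      · simp at h
      · simpa [ev] using M.r2 ε a b fun k l => G (k :: l :: X)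
  | reidemeisterThree ε i =>
    refine loc (x₀ := [⟨.cross ε, 0⟩, ⟨.cross ε, 1⟩, ⟨.cross ε, 0⟩])
      (y₀ := [⟨.cross ε, 1⟩, ⟨.cross ε, 0⟩, ⟨.cross ε, 1⟩]) (i := i) (k := 3)
      (by simp [add_comm]) (by simp [add_comm]) ?_ ?_
    · simp [Runs, Piece.Fits, Piece.after, Shape.ins, Shape.outs] at hx; omega
    · intro X G h
      obtain ⟨a, b, c, X, rfl⟩ := exists_cons₃ h
      cases ε
      · simpa [ev] using M.r3_false a b c fun d e f => G (d :: e :: f :: X)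
      · simpa [ev] using M.r3 a b c fun d e f => G (d :: e :: f :: X)

theorem ev_skein {i : ℕ} (G : List M.I → R) {X : List M.I} (hX : i + 2 ≤ X.length) :
    M.ev [⟨.cross true, i⟩] G X = M.ev [⟨.cross false, i⟩] G X +
      z * (G X + -1 * M.ev [⟨.cup, i⟩, ⟨.cap, i⟩] G X) := by
  obtain ⟨U, X, rfl, rfl⟩ : ∃ U X', X = U ++ X' ∧ U.length = i :=
    ⟨X.take i, X.drop i, by simp, by simp; omega⟩
  have e := fun x => M.ev_sh U x G X
  have h1 := e [⟨.cross true, 0⟩]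
  have h2 := e [⟨.cross false, 0⟩]
  have h3 := e [⟨.cup, 0⟩, ⟨.cap, 0⟩]
  simp only [sh_cons, sh_nil, zero_add] at h1 h2 h3
  rw [h1, h2, h3]
  rcases X with _ | ⟨a, _ | ⟨b, X⟩⟩
  · simp at hX
  · simp at hX
  · simpa [ev] using M.skein a b fun k l => G (U ++ k :: l :: X)

theorem ev_circle {i : ℕ} (G : List M.I → R) {X : List M.I} (hX : i ≤ X.length) :
    M.ev [⟨.cap, i⟩, ⟨.cup, i⟩] G X = del * G X := by
  refine M.ev_eq_of_sh (x₀ := [⟨.cap, 0⟩, ⟨.cup, 0⟩]) (y := []) (y₀ := []) (i := i) (m := 0)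
    (by simp) (by simp) (by simpa using hX) (fun X G _ => ?_) G
  simpa [ev, M.cap_mul_right] using congrArg (· * G X) M.circle

theorem ev_curl {i : ℕ} (ε : Bool) (G : List M.I → R) {X : List M.I} (hX : i + 1 ≤ X.length) :
    M.ev [⟨.cap, i⟩, ⟨.cross ε, i + 1⟩, ⟨.cup, i⟩] G X = curlFactor lamI lam ε * G X := by
  refine M.ev_eq_of_sh (x₀ := [⟨.cap, 0⟩, ⟨.cross ε, 1⟩, ⟨.cup, 0⟩]) (y := []) (y₀ := []) (i := i)
    (m := 1) (by simp [add_comm]) (by simp) hX (fun X G h => ?_) G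
  rcases X with _ | ⟨a, X⟩
  · simp at h
  · simpa [ev] using M.cap_T_cup' ε a fun m => G (m :: X)

theorem ev_curl' {i : ℕ} (ε : Bool) (G : List M.I → R) {X : List M.I} (hX : i + 1 ≤ X.length) :
    M.ev [⟨.cap, i + 1⟩, ⟨.cross ε, i⟩, ⟨.cup, i + 1⟩] G X = curlFactor lamI lam ε * G X := by
  refine M.ev_eq_of_sh (x₀ := [⟨.cap, 1⟩, ⟨.cross ε, 0⟩, ⟨.cup, 1⟩]) (y := []) (y₀ := []) (i := i)
    (m := 1) (by simp [add_comm]) (by simp) hX (fun X G h => ?_) G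
  rcases X with _ | ⟨a, X⟩
  · simp at h
  · simpa [ev] using M.cap_T_cup ε a fun m => G (m :: X)

/-- The evaluation of tangles by a vertex model. -/
theorem exists_eval (φ : Scal →+* R) (hz : φ sZ = z) (hlam : φ sLam = lam)
    (hlamI : φ sLamInv = lamI) (hdel : φ sDel = del) (N : ℕ) (G : List M.I → R) :
    ∃ f : TMod 0 N →+ R, (∀ c x, f (c • x) = φ c * f x) ∧
      ∀ w, Runs w 0 N → f (cls 0 N w) = M.ev w G [] := by
  let _ : Module Scal R := Module.compHom R φ
  have hsmul : ∀ (c : Scal) (x : R), c • x = φ c * x := fun _ _ => rfl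
  have hcf : ∀ ε, φ (curlFactor sLamInv sLam ε) = curlFactor lamI lam ε := by
    rintro (_ | _)
    · exact hlam
    · exact hlamI
  have hmul : ∀ (w : List Piece) (c : R) (G : List M.I → R) X,
    M.ev w (fun Y => c * G Y) X = c * M.ev w G X := fun w c G X => congrFun (M.ev_mul w c G) X
  have hadd : ∀ (w : List Piece) (G H : List M.I → R) X,
    M.ev w (fun Y => G Y + H Y) X = M.ev w G X + M.ev w H X :=
      fun w G H X => congrFun (M.ev_add w G H) X
  have key : ∀ (u x v : List Piece), M.ev (u ++ x ++ v) G [] =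
      M.ev u (M.ev x (M.ev v G)) [] := fun u x v => by rw [ev_append, ev_append]
  have key' : ∀ (u v : List Piece), M.ev (u ++ v) G [] = M.ev u (M.ev v G) [] :=
    fun u v => by rw [ev_append]
  refine (exists_linearMap (m := 0) (n := N) (V := R) (fun w => M.ev w G []) ?_ ?_ ?_ ?_ ?_).elim
    fun f hf => ⟨f.toAddMonoidHom, fun c x => f.map_smul c x, hf⟩
  · intro u x y v h hx hy
    obtain ⟨b, hux, hv⟩ := runs_append.1 hx
    obtain ⟨a, hu, hx⟩ := runs_append.1 hux
    obtain ⟨b', huy, hv'⟩ := runs_append.1 hy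
    obtain ⟨a', hu', hy⟩ := runs_append.1 huy
    obtain rfl := hu.unique hu'
    obtain rfl := h.runs_unique hx hy
    simp only [key]
    exact M.ev_congr hu (fun Y hY => M.ev_move h hx hy _ hY) rfl
  · intro u v i hP hZ hI
    obtain ⟨b, hux, hv⟩ := runs_append.1 hP
    obtain ⟨a, hu, hx⟩ := runs_append.1 hux
    simp only [key, key', hsmul, hz]
    have : ∀ Y : List M.I, Y.length = a → M.ev [⟨.cross true, i⟩] (M.ev v G) Y =
        M.ev [⟨.cross false, i⟩] (M.ev v G) Y + z * (M.ev v G Y +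
          -1 * M.ev [⟨.cup, i⟩, ⟨.cap, i⟩] (M.ev v G) Y) := fun Y hY =>
      M.ev_skein _ (by rw [hY]; exact hx.1)
    rw [M.ev_congr hu this rfl, hadd, hmul, hadd, hmul]
    ring
  · intro u v i ε hP hZ
    obtain ⟨b, hux, hv⟩ := runs_append.1 hP
    obtain ⟨a, hu, hx⟩ := runs_append.1 hux
    simp only [key, key', hsmul, hcf]
    rw [← hmul]
    refine M.ev_congr hu (fun Y hY => M.ev_curl ε _ ?_) rfl
    simp [Runs, Piece.Fits, Piece.after, Shape.ins, Shape.outs] at hx; omega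
  · intro u v i ε hP hZ
    obtain ⟨b, hux, hv⟩ := runs_append.1 hP
    obtain ⟨a, hu, hx⟩ := runs_append.1 hux
    simp only [key, key', hsmul, hcf]
    rw [← hmul]
    refine M.ev_congr hu (fun Y hY => M.ev_curl' ε _ ?_) rfl
    simp [Runs, Piece.Fits, Piece.after, Shape.ins, Shape.outs] at hx; omega
  · intro u v i hP hZ
    obtain ⟨b, hux, hv⟩ := runs_append.1 hP
    obtain ⟨a, hu, hx⟩ := runs_append.1 hux
    simp only [key, key', hsmul, hdel]
    rw [← hmul]
    refine M.ev_congr hu (fun Y hY => M.ev_circle _ ?_) rfl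
    simpa [Runs, Piece.Fits, Piece.after, Shape.ins, Shape.outs, hY] using hx.1

end Model

/-! ### The coefficient ring -/

/-- The relator of `Λ`. -/
def coeffRel : PreCoeff := LaurentPolynomial.T (-1) - LaurentPolynomial.T 1 -
  LaurentPolynomial.C (MvPolynomial.X 0 * (MvPolynomial.X 1 - 1))

/-- The quotient map onto `Λ`. -/
def toScal : PreCoeff →+* Scal := Ideal.Quotient.mk (Ideal.span {coeffRel})

theorem toScal_surjective : Function.Surjective toScal := Ideal.Quotient.mk_surjective

theorem toScal_eq_zero {p : PreCoeff} : toScal p = 0 ↔ coeffRel ∣ p :=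
  Ideal.Quotient.eq_zero_iff_dvd coeffRel p

theorem toScal_T_one : toScal (LaurentPolynomial.T 1) = sLam := rfl
theorem toScal_T_neg_one : toScal (LaurentPolynomial.T (-1)) = sLamInv := rfl
theorem toScal_zee : toScal (LaurentPolynomial.C (MvPolynomial.X 0)) = sZ := rfl
theorem toScal_del : toScal (LaurentPolynomial.C (MvPolynomial.X 1)) = sDel := rfl

theorem sZ_mul_sDel : sZ * sDel = sZ + sLamInv - sLam := by
  have h : toScal coeffRel = 0 := toScal_eq_zero.2 dvd_rfl
  simp only [coeffRel, map_sub, map_mul, map_one, toScal_T_one, toScal_T_neg_one, toScal_zee,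
    toScal_del] at h
  linear_combination -h

/-- A ring homomorphism on `Λ` is given by the values of `λ`, `λ⁻¹`, `z` and `δ`. -/
theorem exists_ringHom {R : Type} [CommRing R] {z lam lamI d : R} (hl : lam * lamI = 1)
    (hd : z * d = z + lamI - lam) :
    ∃ φ : Scal →+* R, φ sZ = z ∧ φ sLam = lam ∧ φ sLamInv = lamI ∧ φ sDel = d := by
  let x : Rˣ := ⟨lam, lamI, hl, by rw [mul_comm, hl]⟩
  let F : PreCoeff →+* R :=
    LaurentPolynomial.eval₂ (MvPolynomial.eval₂Hom (Int.castRingHom R) ![z, d]) x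
  have h1 : F (LaurentPolynomial.T 1) = lam := by simp [F, x]
  have h2 : F (LaurentPolynomial.T (-1)) = lamI := by simp [F, x]
  have h3 : F (LaurentPolynomial.C (MvPolynomial.X 0)) = z := by simp [F]
  have h4 : F (LaurentPolynomial.C (MvPolynomial.X 1)) = d := by simp [F]
  refine ⟨Ideal.Quotient.lift (Ideal.span {coeffRel}) F fun a ha => ?_, h3, h1, h2, h4⟩
  obtain ⟨b, rfl⟩ := Ideal.mem_span_singleton'.1 ha
  rw [map_mul]
  convert mul_zero _
  simp only [coeffRel, map_sub, map_mul, map_one, h1, h2, h3, h4]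
  linear_combination -hd

/-- Multiplication by the unit `T 1` turns the relator into a polynomial with constant coefficient
`1`. -/
theorem curlRel_mul_T {D : Type} [CommRing D] (c d : D) :
    (LaurentPolynomial.T (-1) - LaurentPolynomial.T 1 - LaurentPolynomial.C (c * d) : D[T;T⁻¹]) *
      LaurentPolynomial.T 1 =
    Polynomial.toLaurent (1 - Polynomial.X ^ 2 - Polynomial.C c * (Polynomial.C d * Polynomial.X)) := by
  simp only [map_sub, map_one, map_mul, map_pow, Polynomial.toLaurent_X,
    Polynomial.toLaurent_C, LaurentPolynomial.T_pow, sub_mul, ← LaurentPolynomial.T_add]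
  norm_num
  ring

theorem regular_aux {A : Type} [CommRing A] {c f P G Ti Tj T p g : A} (hp : P = p * Ti)
    (hg : G = g * Tj) (h : c * p = f * g) : c * (P * (Tj * T)) = f * T * (G * Ti) := by
  rw [hp, hg]
  linear_combination (T * Ti * Tj) * h

/-- A prime constant can be cancelled modulo the relator. After clearing denominators, `C c` divides
a product with the polynomial `f'`; it does not divide `f'`, whose constant coefficient is `1`, so
it divides the cofactor and cancels. -/
theorem curlRel_dvd {D : Type} [CommRing D] [IsDomain D] {c d : D} (hc : Prime c) {p f : D[T;T⁻¹]}
    (hf : f = LaurentPolynomial.T (-1) - LaurentPolynomial.T 1 - LaurentPolynomial.C (c * d))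
    (h : f ∣ LaurentPolynomial.C c * p) : f ∣ p := by
  obtain ⟨g, hg⟩ := h
  obtain ⟨i, p', hp⟩ := LaurentPolynomial.exists_T_pow p
  obtain ⟨j, g', hg'⟩ := LaurentPolynomial.exists_T_pow g
  obtain ⟨f', hf'⟩ : ∃ f' : Polynomial D, f' = 1 - Polynomial.X ^ 2 -
      Polynomial.C c * (Polynomial.C d * Polynomial.X) := ⟨_, rfl⟩
  have hfT : Polynomial.toLaurent f' = f * LaurentPolynomial.T 1 := by
    rw [hf', hf, curlRel_mul_T]
  have key : Polynomial.C c * (p' * (Polynomial.X ^ j * Polynomial.X)) =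
      f' * (g' * Polynomial.X ^ i) := by
    apply Polynomial.toLaurent_injective
    rw [map_mul, map_mul, map_mul, map_mul Polynomial.toLaurent f', map_mul, hfT,
      Polynomial.toLaurent_C, Polynomial.toLaurent_X_pow, Polynomial.toLaurent_X_pow,
      Polynomial.toLaurent_X]
    exact regular_aux hp hg' hg
  have hz : Prime (Polynomial.C c) := Polynomial.prime_C_iff.2 hc
  have hzf : ¬ Polynomial.C c ∣ f' := fun h => by
    have := Polynomial.C_dvd_iff_dvd_coeff _ _ |>.1 h 0
    simp only [hf', Polynomial.coeff_sub, Polynomial.coeff_one_zero, Polynomial.coeff_X_pow,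
      Polynomial.coeff_C_mul, Polynomial.coeff_X_zero, mul_zero, sub_zero] at this
    exact hc.not_isUnit (isUnit_of_dvd_one (by simpa using this))
  obtain ⟨k, hk⟩ := (hz.dvd_or_dvd (Dvd.intro _ key)).resolve_left hzf
  rw [hk, mul_left_comm f'] at key
  have key2 : p' * (Polynomial.X ^ j * Polynomial.X) = f' * k := mul_left_cancel₀ hz.ne_zero key
  have key3 : Polynomial.toLaurent (p' * (Polynomial.X ^ j * Polynomial.X)) =
    Polynomial.toLaurent (f' * k) := by rw [key2]
  rw [map_mul, map_mul, map_mul Polynomial.toLaurent f', hfT, Polynomial.toLaurent_X_pow,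
    Polynomial.toLaurent_X, hp, mul_assoc, mul_assoc] at key3
  have hu : IsUnit (LaurentPolynomial.T i * (LaurentPolynomial.T j * LaurentPolynomial.T 1) :
      D[T;T⁻¹]) := (LaurentPolynomial.isUnit_T _).mul
        ((LaurentPolynomial.isUnit_T _).mul (LaurentPolynomial.isUnit_T _))
  exact hu.dvd_mul_right.1 (Dvd.intro _ key3.symm)

/-- The relator is that of `curlRel_dvd` with the prime `c = z`. -/
theorem eq_zero_of_sZ_mul {a : Scal} (h : sZ * a = 0) : a = 0 := by
  obtain ⟨p, rfl⟩ := toScal_surjective a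
  rw [← toScal_zee, ← map_mul, toScal_eq_zero] at h
  rw [toScal_eq_zero]
  exact curlRel_dvd MvPolynomial.X_prime rfl h

/-- Up to powers of `λ` and `z`, each element of `Λ` is a polynomial in `λ` and `z`. -/
theorem exists_polynomial (a : Scal) : ∃ (i j : ℕ) (r : Polynomial (Polynomial ℤ)),
    sLam ^ i * sZ ^ j * a =
      Polynomial.eval₂ (Polynomial.eval₂RingHom (Int.castRingHom Scal) sZ) sLam r := by
  set ψ := Polynomial.eval₂RingHom (Polynomial.eval₂RingHom (Int.castRingHom Scal) sZ) sLam with hψ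
  have hψX : ψ Polynomial.X = sLam := by simp [hψ]
  have hψC : ψ (Polynomial.C Polynomial.X) = sZ := by simp [hψ]
  have hl := sLam_mul_sLamInv
  let Q : Scal → Prop := fun a => ∃ (i j : ℕ) (r : Polynomial (Polynomial ℤ)),
    sLam ^ i * sZ ^ j * a = ψ r
  have hadd : ∀ a b, Q a → Q b → Q (a + b) := by
    rintro a b ⟨i, j, r, h⟩ ⟨i', j', r', h'⟩
    refine ⟨i + i', j + j', Polynomial.X ^ i' * Polynomial.C Polynomial.X ^ j' * r +
      Polynomial.X ^ i * Polynomial.C Polynomial.X ^ j * r', ?_⟩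
    simp only [map_add, map_mul, map_pow, hψX, hψC, ← h, ← h']
    ring
  have hmul : ∀ a b, Q a → Q b → Q (a * b) := by
    rintro a b ⟨i, j, r, h⟩ ⟨i', j', r', h'⟩
    refine ⟨i + i', j + j', r * r', ?_⟩
    rw [map_mul, ← h, ← h']
    ring
  have hlam : Q sLam := ⟨0, 0, Polynomial.X, by rw [hψX]; ring⟩
  have hlamI : Q sLamInv := ⟨1, 0, 1, by rw [map_one]; linear_combination hl⟩
  have hz : Q sZ := ⟨0, 0, Polynomial.C Polynomial.X, by rw [hψC]; ring⟩
  -- The relation of `Λ` gives `λ z δ = λ z + 1 - λ ^ 2`.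
  have hd : Q sDel := ⟨1, 1, Polynomial.C Polynomial.X * Polynomial.X + 1 - Polynomial.X ^ 2, by
    simp only [map_add, map_sub, map_mul, map_pow, map_one, hψX, hψC]
    linear_combination sLam * sZ_mul_sDel + hl⟩
  have hint : ∀ n : ℤ, Q n := fun n => ⟨0, 0, n, by rw [map_intCast]; ring⟩
  have hpoly : ∀ p : MvPolynomial (Fin 2) ℤ, Q (toScal (LaurentPolynomial.C p)) := by
    intro p
    induction p using MvPolynomial.induction_on with
    | C n => simpa using hint n
    | add p q hp hq => rw [map_add, map_add]; exact hadd _ _ hp hq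
    | mul_X p i hp =>
      rw [map_mul, map_mul]
      refine hmul _ _ hp ?_
      fin_cases i
      · exact hz
      · exact hd
  obtain ⟨p, rfl⟩ := toScal_surjective a
  change Q (toScal p)
  induction p using LaurentPolynomial.induction_on with
  | h_C p => exact hpoly p
  | h_add hp hq => rw [map_add]; exact hadd _ _ hp hq
  | h_C_mul_T n p h =>
    rw [LaurentPolynomial.T_add, ← mul_assoc, map_mul]
    exact hmul _ _ h hlam
  | h_C_mul_T_Z n p h =>
    rw [sub_eq_add_neg, LaurentPolynomial.T_add, ← mul_assoc, map_mul]
    exact hmul _ _ h hlamI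

/-- `q - q⁻¹` is transcendental. -/
theorem eval_sub_injective : Function.Injective (Polynomial.eval₂RingHom
    (Int.castRingHom ℤ[T;T⁻¹]) (LaurentPolynomial.T 1 - LaurentPolynomial.T (-1))) := by
  rw [injective_iff_map_eq_zero]
  intro p hp
  -- Specialising `q` to the positive integers gives infinitely many distinct rational roots.
  have hroot : ∀ k : ℕ, (p.map (Int.castRingHom ℚ)).eval ((k + 1 : ℚ) - (k + 1 : ℚ)⁻¹) = 0 := by
    intro k
    let x : ℚˣ := Units.mk0 (k + 1 : ℚ) (by positivity)
    let F : ℤ[T;T⁻¹] →+* ℚ := LaurentPolynomial.eval₂ (Int.castRingHom ℚ) x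
    have hF : F (LaurentPolynomial.T 1 - LaurentPolynomial.T (-1)) = (k + 1 : ℚ) - (k + 1 : ℚ)⁻¹ := by
      simp [F, x]
    have := congrArg F hp
    rw [Polynomial.coe_eval₂RingHom, Polynomial.hom_eval₂, hF, map_zero] at this
    rw [Polynomial.eval_map, ← this]
    congr 1
    exact RingHom.ext_int _ _
  have hinj : Function.Injective fun k : ℕ => (k + 1 : ℚ) - (k + 1 : ℚ)⁻¹ := by
    refine (strictMono_nat_of_lt_succ fun k => ?_).injective
    have : ((k + 1 : ℕ) + 1 : ℚ)⁻¹ ≤ (k + 1 : ℚ)⁻¹ := by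
      apply inv_anti₀ (by positivity); push_cast; linarith
    push_cast at this ⊢
    linarith
  have h0 : p.map (Int.castRingHom ℚ) = 0 := by
    refine Polynomial.eq_zero_of_infinite_isRoot _ ?_
    exact (Set.infinite_range_of_injective hinj).mono (by rintro _ ⟨k, rfl⟩; exact hroot k)
  exact (Polynomial.map_eq_zero_iff (RingHom.injective_int _)).1 h0

/-- The ring homomorphisms to the Laurent polynomials used for the vertex models are jointly
injective. -/
theorem eq_zero_of_forall_ringHom {a : Scal} {m₀ : ℕ}
    (h : ∀ m, m₀ ≤ m → ∃ φ : Scal →+* ℤ[T;T⁻¹],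
      φ sZ = LaurentPolynomial.T 1 - LaurentPolynomial.T (-1) ∧
      φ sLam = LaurentPolynomial.T 1 * LaurentPolynomial.T (-1) ^ (2 * m) ∧ φ a = 0) : a = 0 := by
  obtain ⟨i, j, r, hr⟩ := exists_polynomial a
  set z : ℤ[T;T⁻¹] := LaurentPolynomial.T 1 - LaurentPolynomial.T (-1)
  set θ := Polynomial.eval₂RingHom (Int.castRingHom ℤ[T;T⁻¹]) z with hθ
  have hroot : ∀ m, m₀ ≤ m → (r.map θ).eval
      (LaurentPolynomial.T 1 * LaurentPolynomial.T (-1) ^ (2 * m)) = 0 := by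
    intro m hm
    obtain ⟨φ, h1, h2, h3⟩ := h m hm
    have := congrArg φ hr
    rw [map_mul, h3, mul_zero, Polynomial.hom_eval₂, h2] at this
    rw [Polynomial.eval_map, this]
    congr 1
    ext
    · simp
    · simp [hθ, h1]
  -- The values of `λ` are monomials with the distinct exponents `1 - 2 * m`, so a polynomial over a
  -- domain has infinitely many roots.
  have h0 : r.map θ = 0 := by
    refine Polynomial.eq_zero_of_infinite_isRoot _ ?_
    refine (Set.infinite_range_of_injective (f := fun k : ℕ => (LaurentPolynomial.T 1 *
      LaurentPolynomial.T (-1) ^ (2 * (m₀ + k)) : ℤ[T;T⁻¹])) fun k l hkl => ?_).mono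
        (by rintro _ ⟨k, rfl⟩; exact hroot _ (by omega))
    simp only [LaurentPolynomial.T_pow, ← LaurentPolynomial.T_add] at hkl
    have := congrArg LaurentPolynomial.degree hkl
    rw [LaurentPolynomial.degree_T, LaurentPolynomial.degree_T] at this
    have := WithBot.coe_injective this
    push_cast at this
    omega
  rw [(Polynomial.map_eq_zero_iff eval_sub_injective).1 h0, Polynomial.eval₂_zero] at hr
  -- The powers of `λ` and `z` introduced to clear denominators are removed, `λ` being a unit and
  -- `z` no zero divisor.
  have hu : IsUnit (sLam ^ i) := lamUnit.isUnit.pow i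
  rw [mul_assoc, hu.mul_right_eq_zero] at hr
  clear hu
  induction j with
  | zero => simpa using hr
  | succ j ih => exact ih (eq_zero_of_sZ_mul (by rw [← hr]; ring))


/-! ### Linear independence of layered words -/

/-- The labels `L` at the bottom of a diagram agree with the pattern `l` of its arcs. -/
def Compat {I : Type} (bar : I → I) (l : List ℕ) (L : List I) : Prop :=
  (l.zip L).Pairwise fun x y => x.1 = y.1 → y.2 = bar x.2

theorem append_inj_iff {α : Type*} {a b c d : List α} (h : a.length = b.length) :
    a ++ c = b ++ d ↔ a = b ∧ c = d :=
  ⟨fun e => List.append_inj e h, fun ⟨h1, h2⟩ => by rw [h1, h2]⟩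

/-- As `a` occurs nowhere else, the only new condition concerns its two ends. -/
theorem compat_insert {I : Type} {bar : I → I} {u v w : List ℕ} {a : ℕ} {U V W : List I} {x y : I}
    (hU : U.length = u.length) (hV : V.length = v.length) (ha : ∀ b ∈ u ++ v ++ w, a < b) :
    Compat bar (u ++ a :: (v ++ a :: w)) (U ++ x :: (V ++ y :: W)) ↔
      Compat bar (u ++ v ++ w) (U ++ V ++ W) ∧ y = bar x := by
  have e1 : (u ++ a :: (v ++ a :: w)).zip (U ++ x :: (V ++ y :: W)) =
      u.zip U ++ (a, x) :: (v.zip V ++ (a, y) :: w.zip W) := by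
    rw [List.zip_append hU.symm, List.zip_cons_cons, List.zip_append hV.symm, List.zip_cons_cons]
  have e2 : (u ++ v ++ w).zip (U ++ V ++ W) = u.zip U ++ (v.zip V ++ w.zip W) := by
    rw [List.append_assoc, List.append_assoc, List.zip_append hU.symm, List.zip_append hV.symm]
  have h : ∀ {k : List ℕ} {K : List I}, (∀ b ∈ k, a < b) → ∀ p ∈ k.zip K, a ≠ p.1 :=
    fun hk p hp => (hk _ (List.of_mem_zip (a := p.1) (b := p.2) hp).1).ne
  have hu := h (k := u) (K := U) fun b hb => ha b (by simp [hb])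
  have hv := h (k := v) (K := V) fun b hb => ha b (by simp [hb])
  have hw := h (k := w) (K := W) fun b hb => ha b (by simp [hb])
  rw [Compat, Compat, e1, e2]
  simp only [List.pairwise_append, List.pairwise_cons, List.mem_append, List.mem_cons]
  constructor
  · rintro ⟨h1, ⟨h2, h3, ⟨h4, h5⟩, h6⟩, h7⟩
    refine ⟨⟨h1, ⟨h3, h5, fun p hp q hq => h6 p hp q (.inr hq)⟩, fun p hp q hq =>
      h7 p hp q (.inr (hq.imp_right .inr))⟩, h2 (a, y) (.inr (.inl rfl)) rfl⟩
  · rintro ⟨⟨h1, ⟨h3, h5, h6⟩, h7⟩, rfl⟩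
    refine ⟨h1, ⟨?_, h3, ⟨?_, h5⟩, ?_⟩, ?_⟩
    · rintro p (hp | rfl | hp) e
      · exact absurd e (hv p hp)
      · rfl
      · exact absurd e (hw p hp)
    · exact fun p hp e => absurd e (hw p hp)
    · rintro p hp q (rfl | hq) e
      · exact absurd e.symm (hv p hp)
      · exact h6 p hp q hq e
    · rintro p hp q (rfl | hq | rfl | hq) e
      · exact absurd e.symm (hu p hp)
      · exact h7 p hp q (.inl hq) e
      · exact absurd e.symm (hu p hp)
      · exact h7 p hp q (.inr hq) e

namespace Model

variable {R : Type} [CommRing R] {z lam lamI del : R} {M : Model R z lam lamI del}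

/-- Crossings are flips after `f`, so the pulled string carries its label unchanged past the others.
-/
theorem Flat.pullR {S : Type} [CommRing S] {f : R →+* S} {bar : M.I → M.I} (h : M.Flat f bar)
    (Z V W : List M.I) (y : M.I) (G : List M.I → R) :
    f (M.ev (pullR Z.length V.length) G (Z ++ y :: (V ++ W))) = f (G (Z ++ V ++ y :: W)) := by
  induction V generalizing Z with
  | nil => simp [Kauffman.pullR, ev]
  | cons a V ih =>
    rw [List.length_cons, pullR_succ', ev]
    have := M.act_append (.cross true) 0 Z (y :: a :: (V ++ W))
      (M.ev (Kauffman.pullR (Z.length + 1) V.length) G)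
    rw [zero_add] at this
    rw [List.cons_append, this, act_cross, h.T]
    have := ih (Z ++ [a])
    simpa using this

theorem Flat.topArc {S : Type} [CommRing S] {f : R →+* S} {bar : M.I → M.I} (h : M.Flat f bar)
    [Fintype M.I] (U V W : List M.I) (G : List M.I → R) :
    f (M.ev (topArc U.length V.length) G (U ++ V ++ W)) =
      ∑ x, f (G (U ++ x :: (V ++ bar x :: W))) := by
  rw [Kauffman.topArc, ev, List.append_assoc]
  have := M.act_append .cap 0 U (V ++ W) (M.ev (Kauffman.pullR (U.length + 1) V.length) G)
  rw [zero_add] at this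
  rw [this, act_cap, h.cap]
  refine Finset.sum_congr rfl fun x _ => ?_
  have := h.pullR (U ++ [x]) V W (bar x) G
  simpa using this

open Classical in
/-- The value of a layered word counts the compatible labellings of its end points. -/
theorem Flat.std {S : Type} [CommRing S] {f : R →+* S} {bar : M.I → M.I} (h : M.Flat f bar)
    {l : List ℕ} {s : List Piece} (hs : Std l s) (G : List M.I → R) (L : List M.I) (c : S)
    (hL : L.length = l.length)
    (hG : ∀ X : List M.I, X.length = l.length → f (G X) = if X = L then c else 0) :
    f (M.ev s G []) = if Compat bar l L then c else 0 := by
  have : Fintype M.I := @Fintype.ofFinite _ M.finite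
  induction hs generalizing G L c with
  | nil =>
    rw [List.length_nil, List.length_eq_zero_iff] at hL
    subst hL
    simpa [ev, Compat] using hG [] rfl
  | cons u v w a s hs ha ih =>
    obtain ⟨U, L, rfl, hU⟩ : ∃ U L', L = U ++ L' ∧ U.length = u.length :=
      ⟨L.take u.length, L.drop u.length, by simp, by simp at hL ⊢; omega⟩
    rcases L with _ | ⟨x, L⟩
    · simp [hU] at hL
    obtain ⟨V, L, rfl, hV⟩ : ∃ V L', L = V ++ L' ∧ V.length = v.length :=
      ⟨L.take v.length, L.drop v.length, by simp, by simp at hL ⊢; omega⟩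
    rcases L with _ | ⟨y, W⟩
    · simp [hU, hV] at hL
    have hW : W.length = w.length := by simp at hL; omega
    rw [ev_append]
    -- After `f`, the top layer turns the indicator of the full labelling into the indicator of the
    -- labelling without the two ends of the arc, with weight `0` unless these ends have opposite
    -- labels.
    rw [ih (M.ev (Kauffman.topArc u.length v.length) G) (U ++ V ++ W) (if y = bar x then c else 0)
      (by simp [hU, hV, hW])]
    · simp only [compat_insert hU hV ha]
      split_ifs <;> simp_all
    · intro X hX
      obtain ⟨U', X, rfl, hU'⟩ : ∃ U L', X = U ++ L' ∧ U.length = u.length :=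
        ⟨X.take u.length, X.drop u.length, by simp, by simp at hX ⊢; omega⟩
      obtain ⟨V', W', rfl, hV'⟩ : ∃ V L', X = V ++ L' ∧ V.length = v.length :=
        ⟨X.take v.length, X.drop v.length, by simp, by simp at hX ⊢; omega⟩
      have := h.topArc U' V' W' G
      rw [hU', hV', List.append_assoc] at this
      rw [this]
      have hsum : ∀ k, f (G (U' ++ k :: (V' ++ bar k :: W'))) =
          if k = x then (if U' ++ (V' ++ W') = U ++ V ++ W then if y = bar x then c else 0 else 0)
          else 0 := fun k => by
        rw [hG _ (by simp at hX ⊢; omega)]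
        have e1 : U' ++ k :: (V' ++ bar k :: W') = U ++ x :: (V ++ y :: W) ↔
            U' = U ∧ k = x ∧ V' = V ∧ bar k = y ∧ W' = W := by
          rw [append_inj_iff (hU'.trans hU.symm), List.cons.injEq,
            append_inj_iff (hV'.trans hV.symm), List.cons.injEq]
        have e2 : U' ++ (V' ++ W') = U ++ V ++ W ↔ U' = U ∧ V' = V ∧ W' = W := by
          rw [List.append_assoc, append_inj_iff (hU'.trans hU.symm),
            append_inj_iff (hV'.trans hV.symm)]
        simp only [e1, e2]
        by_cases hk : k = x
        · subst hk
          simp only [if_true, true_and]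
          by_cases h1 : U' = U <;> by_cases h2 : V' = V <;> by_cases h3 : W' = W <;>
            simp [h1, h2, h3, eq_comm]
        · simp [hk]
      simp only [hsum]
      simp

end Model

theorem forall₂_append_left {α β : Type*} {P : α → β → Prop} {u v : List α} {L : List β}
    (h : List.Forall₂ P (u ++ v) L) :
    ∃ U V, List.Forall₂ P u U ∧ List.Forall₂ P v V ∧ L = U ++ V := by
  have h1 := List.forall₂_take u.length h
  have h2 := List.forall₂_drop u.length h
  rw [List.take_left] at h1
  rw [List.drop_left] at h2
  exact ⟨_, _, h1, h2, (List.take_append_drop _ _).symm⟩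

/-- Each arc receives its own pair of opposite labels, so that the labelling remembers which ends
belong together. -/
theorem exists_compat {I : Type} {m : ℕ} (bar : I → I) (p : Fin m → Bool → I)
    (hpb : ∀ i b, bar (p i b) = p i (!b)) {l : List ℕ} {s : List Piece} (hs : Std l s)
    (hm : ∀ x ∈ l, x < m) : ∃ L : List I,
      List.Forall₂ (fun x y => ∃ (h : x < m) (b : Bool), y = p ⟨x, h⟩ b) l L ∧ Compat bar l L := by
  induction hs with
  | nil => exact ⟨[], .nil, List.Pairwise.nil⟩
  | cons u v w a s hs ha ih =>
    obtain ⟨L, h1, h2⟩ := ih fun x hx => hm x (by simp at hx ⊢; tauto)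
    obtain ⟨X, W, h3, hW, rfl⟩ := forall₂_append_left h1
    obtain ⟨U, V, hU, hV, rfl⟩ := forall₂_append_left h3
    have ham := hm a (by simp)
    refine ⟨U ++ p ⟨a, ham⟩ true :: (V ++ p ⟨a, ham⟩ false :: W), ?_, ?_⟩
    · exact List.rel_append hU (.cons ⟨ham, true, rfl⟩ (List.rel_append hV (.cons ⟨ham, false, rfl⟩ hW)))
    · rw [compat_insert hU.length_eq.symm hV.length_eq.symm ha]
      exact ⟨h2, (hpb _ true).symm⟩

theorem compat_getElem {I : Type} {bar : I → I} {l : List ℕ} {L : List I} (h : Compat bar l L)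
    {i j : ℕ} (hij : i < j) (hj : j < l.length) (hL : L.length = l.length) (e : l[i] = l[j]) :
    L[j] = bar L[i] := by
  have := List.pairwise_iff_getElem.1 h i j (by simp; omega) (by simp; omega) hij
  simpa [e] using this

/-- Layered words with different patterns are linearly independent. -/
theorem coeff_eq_zero_of_sum_std {ι : Type} [Fintype ι] {N : ℕ} {l : ι → List ℕ}
    {s : ι → List Piece} (hs : ∀ c, Std (l c) (s c)) (hN : ∀ c, (l c).length = N)
    (hinj : ∀ c d, (∀ i j : ℕ, (l c)[i]? = (l c)[j]? → (l d)[i]? = (l d)[j]?) → c = d)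
    {a : ι → Scal} (ha : ∑ c, a c • cls 0 N (s c) = 0) (c : ι) : a c = 0 := by
  classical
  -- For `m ≥ m₀` the model has a separate pair of labels for every arc of every pattern.
  obtain ⟨m₀, hm₀⟩ : ∃ m₀ : ℕ, ∀ c, ∀ x ∈ l c, x < m₀ := by
    refine ⟨∑ c, (l c).sum + 1, fun c x hx => Nat.lt_succ_of_le ?_⟩
    exact (List.le_sum_of_mem hx).trans
      (Finset.single_le_sum (f := fun c => (l c).sum) (fun _ _ => Nat.zero_le _) (Finset.mem_univ c))
  refine eq_zero_of_forall_ringHom (m₀ := m₀) fun m hm => ?_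
  have hq : (LaurentPolynomial.T 1 : ℤ[T;T⁻¹]) * LaurentPolynomial.T (-1) = 1 := by
    rw [← LaurentPolynomial.T_add]; rfl
  let f : ℤ[T;T⁻¹] →+* ℤ := LaurentPolynomial.eval₂ (RingHom.id ℤ) 1
  have hf : f (LaurentPolynomial.T 1) = 1 := by simp [f]
  obtain ⟨lam, lamI, d, M, bar, p, hl, hlam, hd, hflat, hbar, hp, hpb⟩ :=
    Model.exists_model f hf hq m
  obtain ⟨φ, h1, h2, h3, h4⟩ := exists_ringHom hl hd
  refine ⟨φ, h1, h2.trans hlam, ?_⟩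
  have hL := fun c => exists_compat bar p hpb (hs c) fun x hx => (hm₀ c x hx).trans_le hm
  choose L hL hLc using hL
  have hlen : ∀ c, (L c).length = N := fun c => (hL c).length_eq.symm.trans (hN c)
  -- Ends paired by `c` carry opposite labels in `L e`, so they lie on the same arc of `e`; `hinj`
  -- then gives `c = e`.
  have hcomp : ∀ c e, Compat bar (l c) (L e) ↔ c = e := by
    refine fun c e => ⟨fun h => hinj c e ?_, fun h => h ▸ hLc c⟩
    have key : ∀ i j (hi : i < N) (hj : j < N), i < j →
        (l c)[i]'(by rw [hN]; exact hi) = (l c)[j]'(by rw [hN]; exact hj) →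
        (l e)[i]'(by rw [hN]; exact hi) = (l e)[j]'(by rw [hN]; exact hj) := by
      intro i j hi hj hij h0
      have h5 := compat_getElem h hij (by rw [hN]; exact hj) ((hlen e).trans (hN c).symm) h0
      obtain ⟨h6, b, h7⟩ := List.forall₂_iff_get.1 (hL e) |>.2 i (by rw [hN]; exact hi)
        (by rw [hlen]; exact hi)
      obtain ⟨h8, b', h9⟩ := List.forall₂_iff_get.1 (hL e) |>.2 j (by rw [hN]; exact hj)
        (by rw [hlen]; exact hj)
      simp only [List.get_eq_getElem] at h6 h7 h8 h9
      rw [h7, h9, hpb] at h5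
      exact (Fin.mk.inj_iff.1 (hp _ _ _ _ h5).1).symm
    intro i j h0
    by_cases hi : i < N
    · rw [List.getElem?_eq_getElem (by rw [hN]; exact hi)] at h0
      obtain ⟨hj, h0⟩ := List.getElem?_eq_some_iff.1 h0.symm
      rw [hN] at hj
      rw [List.getElem?_eq_getElem (by rw [hN]; exact hi),
        List.getElem?_eq_getElem (by rw [hN]; exact hj)]
      congr 1
      rcases lt_trichotomy i j with h | h | h
      · exact key i j hi hj h h0.symm
      · subst h; rfl
      · exact (key j i hj hi h h0).symm
    · have hj : ¬ j < N := fun hj => by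
        rw [List.getElem?_eq_none (by rw [hN]; omega)] at h0
        rw [eq_comm, List.getElem?_eq_none_iff, hN] at h0
        omega
      rw [List.getElem?_eq_none (by rw [hN]; omega), List.getElem?_eq_none (by rw [hN]; omega)]
  choose F hF hF' using fun e => M.exists_eval φ h1 h2 h3 h4 N fun X => if X = L e then 1 else 0
  let A : Matrix ι ι ℤ[T;T⁻¹] := Matrix.of fun e c => F e (cls 0 N (s c))
  have hA : A.mulVec (fun c => φ (a c)) = 0 := by
    funext e
    have := congrArg (F e) ha
    rw [map_sum, map_zero] at this
    simp only [hF] at this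
    exact (Finset.sum_congr rfl fun c _ => mul_comm _ _).trans this
  -- At `q = 1` the matrix of values is the identity, so its determinant over `ℤ[T;T⁻¹]` is not
  -- zero.
  have hfA : f.mapMatrix A = 1 := by
    ext e c
    rw [RingHom.mapMatrix_apply, Matrix.map_apply, show A e c = F e (cls 0 N (s c)) from rfl,
      hF' e _ (hN c ▸ (hs c).runs),
      hflat.std (hs c) _ (L e) 1 ((hlen e).trans (hN c).symm) (fun X _ => by split_ifs <;> simp),
      Matrix.one_apply]
    simp only [hcomp, eq_comm]
  have hdet : A.det ≠ 0 := fun h => by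
    have := f.map_det A
    rw [hfA, h, map_zero, Matrix.det_one] at this
    exact zero_ne_one this
  exact congrFun (Matrix.eq_zero_of_mulVec_eq_zero hdet hA) c


/-! ### Folding -/

theorem Move.sh {x y : List Piece} (h : Move x y) (j : ℕ) : Move (sh j x) (sh j y) := by
  cases h with
  | slide s t i k =>
    have := Move.slide s t (i + j) k
    rw [add_right_comm i j, add_right_comm i j, add_right_comm (i + s.outs) j,
      add_right_comm (i + s.ins) j] at this
    exact this
  | zigzag i => simpa [add_right_comm] using Move.zigzag (i + j)
  | zagzig i => simpa [add_right_comm] using Move.zagzig (i + j)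
  | turnCap ε i => simpa [add_right_comm] using Move.turnCap ε (i + j)
  | turnCup ε i => simpa [add_right_comm] using Move.turnCup ε (i + j)
  | reidemeisterTwo ε i => simpa [add_right_comm] using Move.reidemeisterTwo ε (i + j)
  | reidemeisterThree ε i => simpa [add_right_comm] using Move.reidemeisterThree ε (i + j)

theorem sim_of_relator {N N' : ℕ} {x y : List Piece} (c : Scal) (hx : Runs x N N')
    (hy : Runs y N N')
    (h : ∀ m n (D E : Diagram m n), D.Differ x y E →
      Relator m n (D.elt - (show Coeff from c) • E.elt)) : Sim c N x y :=
  Sim.of_diagram hx hy fun u v m n D E hD hE => sub_smul_of_relator (h m n D E ⟨u, v, hD, hE⟩)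

theorem sim_curl {N i : ℕ} (ε : Bool) (h : i < N) :
    Sim (curlFactor sLamInv sLam ε) N [⟨.cap, i⟩, ⟨.cross ε, i + 1⟩, ⟨.cup, i⟩] [] := by
  refine sim_of_relator (N' := N) _ ?_ rfl fun m n D E hDE => ?_
  · simp only [Runs, Piece.Fits, Piece.after, Shape.ins, Shape.outs]; omega
  · cases ε
    · exact .leftCurl i D E (.inl hDE)
    · exact .rightCurl i D E (.inl hDE)

theorem sim_curl' {N i : ℕ} (ε : Bool) (h : i < N) :
    Sim (curlFactor sLamInv sLam ε) N [⟨.cap, i + 1⟩, ⟨.cross ε, i⟩, ⟨.cup, i + 1⟩] [] := by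
  refine sim_of_relator (N' := N) _ ?_ rfl fun m n D E hDE => ?_
  · simp only [Runs, Piece.Fits, Piece.after, Shape.ins, Shape.outs]; omega
  · cases ε
    · exact .leftCurl i D E (.inr hDE)
    · exact .rightCurl i D E (.inr hDE)

/-- Putting diagrams to the right of `j` strings, between two fixed words, is linear. -/
theorem exists_frame {m n m' : ℕ} (n' : ℕ) {pre : List Piece} {j : ℕ} (post : List Piece)
    (hpre : Runs pre m' (j + m)) : ∃ f : TMod m n →ₗ[Scal] TMod m' n',
      ∀ w, Runs w m n → f (cls m n w) = cls m' n' (pre ++ sh j w ++ post) := by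
  have key : ∀ {u : List Piece} {N : ℕ}, Runs u m N → Runs (pre ++ sh j u) m' (j + N) :=
    fun hu => hpre.append (hu.sh j)
  have e3 : ∀ u x v : List Piece, pre ++ sh j (u ++ x ++ v) ++ post =
      pre ++ sh j u ++ sh j x ++ (sh j v ++ post) := fun u x v => by simp
  have e2 : ∀ u v : List Piece, pre ++ sh j (u ++ v) ++ post =
      pre ++ sh j u ++ (sh j v ++ post) := fun u v => by simp
  have sim : ∀ (c : Scal) (u x v : List Piece), Runs (u ++ x ++ v) m n →
      (∀ N N', Runs x N N' → Sim c (j + N) (sh j x) []) →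
      cls m' n' (pre ++ sh j (u ++ x ++ v) ++ post) =
        c • cls m' n' (pre ++ sh j (u ++ v) ++ post) := by
    intro c u x v hr h
    obtain ⟨b, hux, hv⟩ := runs_append.1 hr
    obtain ⟨a, hu, hx⟩ := runs_append.1 hux
    rw [e3, e2, h a b hx (pre ++ sh j u) (sh j v ++ post) m' n' (key hu), List.append_nil]
  refine exists_linearMap (fun w => cls m' n' (pre ++ sh j w ++ post)) ?_ ?_ ?_ ?_ ?_
  · intro u x y v h hx hy
    obtain ⟨b, hux, hv⟩ := runs_append.1 hx
    obtain ⟨a, hu, hx⟩ := runs_append.1 hux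
    obtain ⟨b', huy, hv'⟩ := runs_append.1 hy
    obtain ⟨a', hu', hy⟩ := runs_append.1 huy
    obtain rfl := hu.unique hu'
    obtain rfl := h.runs_unique hx hy
    have := Sim.of_move (h.sh j) (hx.sh j) (hy.sh j) (pre ++ sh j u) (sh j v ++ post) m' n' (key hu)
    rw [e3, e3, this, one_smul]
  · intro u v i hP _ _
    obtain ⟨b, hux, hv⟩ := runs_append.1 hP
    obtain ⟨a, hu, hx⟩ := runs_append.1 hux
    have h1 : i + 2 ≤ a := hx.1
    have := cls_skein (i := i + j) (v := sh j v ++ post) (by omega) n' (key hu)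
    rw [e3, e3, e3, e2]
    exact this
  · intro u v i ε hr _
    refine sim _ _ _ _ hr fun N N' h => ?_
    simp only [Runs, Piece.Fits, Piece.after, Shape.ins, Shape.outs] at h
    simpa [add_right_comm] using sim_curl (N := j + N) (i := i + j) ε (by omega)
  · intro u v i ε hr _
    refine sim _ _ _ _ hr fun N N' h => ?_
    simp only [Runs, Piece.Fits, Piece.after, Shape.ins, Shape.outs] at h
    simpa [add_right_comm] using sim_curl' (N := j + N) (i := i + j) ε (by omega)
  · intro u v i hr _
    refine sim _ _ _ _ hr fun N N' h => ?_
    simp only [Runs, Piece.Fits, Piece.after, Shape.ins, Shape.outs] at h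
    simpa using sim_circle (N := j + N) (i := i + j) (by omega)

/-- Nested maxima. -/
def caps : ℕ → List Piece
  | 0 => []
  | n + 1 => ⟨.cap, 0⟩ :: sh 1 (caps n)

/-- Nested minima. -/
def cups : ℕ → List Piece
  | 0 => []
  | n + 1 => ⟨.cup, n⟩ :: cups n

theorem runs_caps (n b : ℕ) : Runs (caps n) b (2 * n + b) := by
  induction n generalizing b with
  | zero => simp [caps, Runs]
  | succ n ih =>
    refine ⟨Nat.zero_le _, ?_⟩
    have := (ih (b + 1)).sh 1
    convert this using 1
    · simp only [Piece.after, Shape.ins, Shape.outs]; omega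
    · omega

theorem runs_cups (n b : ℕ) : Runs (cups n) (2 * n + b) b := by
  induction n with
  | zero => simp [cups, Runs]
  | succ n ih =>
    refine ⟨by simp [Piece.Fits, Shape.ins]; omega, ?_⟩
    convert ih using 1
    simp [Piece.after, Shape.ins, Shape.outs]; omega

/-- The first minimum is moved up past the inner maxima and cancels against the outermost maximum;
the remaining ones follow by induction. -/
theorem eqv_caps_cups (n b : ℕ) : Eqv (n + b) (sh n (caps n) ++ cups n) [] := by
  induction n generalizing b with
  | zero => exact Eqv.refl _ _
  | succ n ih =>
    have h1 : sh (n + 1) (caps (n + 1)) ++ cups (n + 1) =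
        [⟨.cap, n + 1⟩] ++ (sh (n + 2) (caps n) ++ [⟨.cup, n⟩]) ++ cups n := by
      simp [caps, cups, add_left_comm]
    have h2 : Eqv (n + 2 + (b + 1)) ([⟨.cup, n⟩] ++ sh n (caps n)) (sh (n + 2) (caps n) ++ [⟨.cup, n⟩]) :=
      eqv_interchange (a := n + 2) (a' := n) (b := b + 1)
        ⟨by simp [Piece.Fits, Shape.ins], by simp [Runs, Piece.after, Shape.ins, Shape.outs]⟩
        (runs_caps n _)
    have h3 := h2.symm.ctx (N := n + 1 + b) (u := [⟨.cap, n + 1⟩])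
      ⟨by simp [Piece.Fits, Shape.ins], by simp [Runs, Piece.after, Shape.ins, Shape.outs]; omega⟩
      (cups n)
    have h4 := (eqv_zagzig (N := n + 1 + b) (i := n) (by omega)).right (sh n (caps n) ++ cups n)
    have h5 := ih (b + 1)
    rw [h1]
    refine h3.trans (.trans ?_ (.trans h4 ?_))
    · exact .of_eq (by simp)
    · rw [show n + 1 + b = n + (b + 1) by omega]
      simpa using h5

theorem eqv_caps_cups' (n j b : ℕ) :
    Eqv (j + n + b) (sh j (caps n) ++ sh (j + n) (cups n)) [] := by
  induction n generalizing j b with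
  | zero => exact Eqv.refl _ _
  | succ n ih =>
    have h1 : sh j (caps (n + 1)) ++ sh (j + (n + 1)) (cups (n + 1)) =
        [⟨.cap, j⟩] ++ (sh (j + 1) (caps n) ++ sh (j + 1 + 2 * n) [⟨.cup, 0⟩]) ++
          sh (j + 1 + n) (cups n) := by
      simp [caps, cups, add_comm, add_left_comm]
      omega
    have h2 : Eqv (j + 1 + (n + b + 2)) (sh (j + 1) (caps n) ++ sh (j + 1 + 2 * n) [⟨.cup, 0⟩])
        (sh (j + 1) [⟨.cup, 0⟩] ++ sh (j + 1) (caps n)) :=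
      eqv_interchange (a := j + 1) (a' := j + 1 + 2 * n) (b := n + b + 2) (b' := n + b)
        (by simpa using (runs_caps n 0).sh (j + 1))
        ⟨by simp [Piece.Fits, Shape.ins], by simp [Runs, Piece.after, Shape.ins, Shape.outs]⟩
    have h3 := h2.ctx (N := j + (n + 1) + b) (u := [⟨.cap, j⟩])
      ⟨by simp [Piece.Fits, Shape.ins]; omega, by simp [Runs, Piece.after, Shape.ins, Shape.outs]; omega⟩
      (sh (j + 1 + n) (cups n))
    have h4 := (eqv_zigzag (N := j + (n + 1) + b) (i := j) (by omega)).right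
      (sh (j + 1) (caps n) ++ sh (j + 1 + n) (cups n))
    have h5 := ih (j + 1) b
    rw [h1]
    refine h3.trans (.trans ?_ (.trans h4 ?_))
    · exact .of_eq (by simp)
    · rw [show j + (n + 1) + b = j + 1 + n + b by omega]
      simpa using h5

/-- The strings at the top of a diagram are bent down to the left. -/
def foldWord (n : ℕ) (w : List Piece) : List Piece := caps n ++ sh n w

/-- The first strings at the bottom of a diagram are bent up to the left. -/
def unfoldWord (n : ℕ) (w : List Piece) : List Piece := sh n w ++ cups n

theorem runs_foldWord {n k : ℕ} {w : List Piece} (h : Runs w n k) : Runs (foldWord n w) 0 (n + k) := by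
  have := runs_caps n 0
  rw [add_zero, two_mul] at this
  exact this.append (h.sh n)

theorem runs_unfoldWord {n k : ℕ} {w : List Piece} (h : Runs w 0 (n + k)) :
    Runs (unfoldWord n w) n k := by
  have := h.sh n
  rw [add_zero, ← add_assoc, ← two_mul] at this
  exact this.append (runs_cups n k)

theorem eqv_unfold_fold {n k : ℕ} {w : List Piece} (h : Runs w n k) :
    Eqv n (unfoldWord n (foldWord n w)) w := by
  have h1 := eqv_interchange (x := cups n) (a := 2 * n) (a' := 0) (by simpa using runs_cups n 0) h
  rw [sh_zero] at h1
  have h2 := h1.symm.left (N := n) (u := sh n (caps n))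
    (by have := (runs_caps n 0).sh n; rwa [add_zero, add_zero, add_comm n (2 * n)] at this)
  have h3 := (eqv_caps_cups n 0).right w
  rw [add_zero] at h3
  refine .trans (.of_eq ?_) (h2.trans (.trans (.of_eq ?_) (h3.trans (.of_eq ?_))))
  · simp [unfoldWord, foldWord, two_mul]
  · simp
  · simp

theorem eqv_fold_unfold {n k : ℕ} {w : List Piece} (h : Runs w 0 (n + k)) :
    Eqv 0 (foldWord n (unfoldWord n w)) w := by
  have h1 := eqv_interchange (x := caps n) (a := 0) (a' := 2 * n) (by simpa using runs_caps n 0) h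
  rw [sh_zero, zero_add] at h1
  have h2 := h1.right (sh n (cups n))
  have h3 := (eqv_caps_cups' n 0 k).left (N := 0) (u := w) (by simpa using h)
  refine .trans (.of_eq ?_) (h2.trans (.trans (.of_eq ?_) (h3.trans (.of_eq ?_))))
  · simp [unfoldWord, foldWord, two_mul]
  · simp
  · simp


/-! ### Connectors and patterns -/

/-- The position of an end point after folding. -/
def pos {n : ℕ} : Fin n ⊕ Fin n → ℕ
  | .inl i => n - 1 - i
  | .inr j => n + j

theorem pos_lt {n : ℕ} (x : Fin n ⊕ Fin n) : pos x < n + n := by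
  rcases x with i | j <;> simp only [pos] <;> omega

theorem pos_injective {n : ℕ} : Function.Injective (pos (n := n)) := by
  rintro (i | i) (j | j) h <;> simp only [pos] at h
  · congr 1; omega
  · omega
  · omega
  · congr 1; omega

theorem exists_pos {n k : ℕ} (h : k < n + n) : ∃ x : Fin n ⊕ Fin n, pos x = k := by
  by_cases hk : k < n
  · exact ⟨.inl ⟨n - 1 - k, by omega⟩, by simp only [pos]; omega⟩
  · exact ⟨.inr ⟨k - n, by omega⟩, by simp only [pos]; omega⟩

/-- The labels `l` of the folded end points are equal exactly on the pairs of the connector. -/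
structure Pattern {n : ℕ} (c : Connector n) (l : List ℕ) : Prop where
  length : l.length = n + n
  eq_iff : ∀ x y, l[pos x]? = l[pos y]? ↔ y = x ∨ y = c.partner x

theorem Connector.ext' {n : ℕ} {c d : Connector n} (h : ∀ x, c.partner x = d.partner x) : c = d := by
  cases c; cases d; congr; exact funext h

instance (n : ℕ) : Finite (Connector n) :=
  Finite.of_injective Connector.partner fun _ _ h => Connector.ext' (congrFun h)

theorem Pattern.eq_of_imp {n : ℕ} {c d : Connector n} {l m : List ℕ} (hc : Pattern c l)
    (hd : Pattern d m) (h : ∀ i j : ℕ, l[i]? = l[j]? → m[i]? = m[j]?) : c = d := by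
  refine Connector.ext' fun x => ?_
  have := h _ _ ((hc.eq_iff x (c.partner x)).2 (.inr rfl))
  exact ((hd.eq_iff x _).1 this).resolve_left (c.partner_ne x)

theorem count_eq_card (a : ℕ) (l : List ℕ) :
    l.count a = ((Finset.range l.length).filter fun k => l[k]? = some a).card := by
  induction l using List.reverseRecOn with
  | nil => simp
  | append_singleton l b ih =>
    have h : (Finset.range l.length).filter (fun k => (l ++ [b])[k]? = some a) =
        (Finset.range l.length).filter fun k => l[k]? = some a :=
      Finset.filter_congr fun k hk => by rw [List.getElem?_append_left (Finset.mem_range.1 hk)]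
    rw [List.length_append, List.length_singleton, Finset.range_add_one, Finset.filter_insert, h,
      List.count_append, ih, List.getElem?_append_right le_rfl]
    by_cases hb : b = a
    · simp [hb]
    · simp [hb]

theorem Pattern.double {n : ℕ} {c : Connector n} {l : List ℕ} (h : Pattern c l) : Double l := by
  intro a ha
  obtain ⟨k, hk, rfl⟩ := List.mem_iff_getElem.1 ha
  obtain ⟨x, rfl⟩ := exists_pos (h.length ▸ hk)
  rw [count_eq_card, ← Finset.card_pair (pos_injective.ne (c.partner_ne x).symm)]
  congr 1
  ext k
  rw [Finset.mem_filter, Finset.mem_range, Finset.mem_insert, Finset.mem_singleton, h.length,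
    ← List.getElem?_eq_getElem hk, eq_comm (b := l[pos x]?)]
  constructor
  · rintro ⟨hk, h1⟩
    obtain ⟨y, rfl⟩ := exists_pos hk
    rcases (h.eq_iff x y).1 h1 with rfl | rfl <;> simp
  · rintro (rfl | rfl)
    · exact ⟨pos_lt _, rfl⟩
    · exact ⟨pos_lt _, (h.eq_iff x _).2 (.inr rfl)⟩

theorem exists_pattern {n : ℕ} (c : Connector n) : ∃ l, Pattern c l := by
  classical
  let pt : Fin (n + n) → Fin n ⊕ Fin n := fun k => (exists_pos k.2).choose
  have hpt : ∀ k, pos (pt k) = k := fun k => (exists_pos k.2).choose_spec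
  -- Each pair is labelled by the smaller of its two positions.
  let g : Fin n ⊕ Fin n → ℕ := fun x => min (pos x) (pos (c.partner x))
  have hg : ∀ x y, g x = g y ↔ y = x ∨ y = c.partner x := by
    intro x y
    constructor
    · intro h
      simp only [g] at h
      rcases min_choice (pos x) (pos (c.partner x)) with h1 | h1 <;>
        rcases min_choice (pos y) (pos (c.partner y)) with h2 | h2 <;>
        rw [h1, h2] at h <;> have h := pos_injective h
      · exact .inl h.symm
      · exact .inr (by rw [h, c.partner_partner])
      · exact .inr h.symm
      · exact .inl (by rw [← c.partner_partner x, h, c.partner_partner])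
    · rintro (rfl | rfl)
      · rfl
      · simp only [g, c.partner_partner, min_comm]
  have hl : ∀ x, (List.ofFn fun k => g (pt k))[pos x]? = some (g x) := by
    intro x
    rw [List.getElem?_eq_getElem (by simpa using pos_lt x)]
    simp only [List.getElem_ofFn, Option.some_inj]
    exact congrArg g (pos_injective (hpt _))
  exact ⟨List.ofFn fun k => g (pt k), by simp, fun x y => by rw [hl, hl, Option.some_inj, hg]⟩

theorem exists_connector {n : ℕ} {l : List ℕ} (hl : Double l) (hn : l.length = n + n) :
    ∃ c : Connector n, Pattern c l := by
  have key : ∀ x : Fin n ⊕ Fin n, ∃ y, y ≠ x ∧ ∀ z, l[pos x]? = l[pos z]? ↔ z = x ∨ z = y := by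
    intro x
    have hx : pos x < l.length := hn ▸ pos_lt x
    have hc := hl _ (List.getElem_mem hx)
    rw [count_eq_card, ← List.getElem?_eq_getElem hx] at hc
    have hmem : ∀ z, pos z ∈ (Finset.range l.length).filter (fun k => l[k]? = l[pos x]?) ↔
        l[pos x]? = l[pos z]? := fun z => by
      rw [Finset.mem_filter, Finset.mem_range, hn, and_iff_right (pos_lt z), eq_comm]
    -- The label at `x` occurs at exactly two positions; the one different from `pos x` gives the
    -- partner.
    obtain ⟨i, j, hij, h⟩ := Finset.card_eq_two.1 hc
    have hi : i < n + n := by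
      have : i ∈ ({i, j} : Finset ℕ) := by simp
      rw [← h, Finset.mem_filter, Finset.mem_range, hn] at this
      exact this.1
    have hj : j < n + n := by
      have : j ∈ ({i, j} : Finset ℕ) := by simp
      rw [← h, Finset.mem_filter, Finset.mem_range, hn] at this
      exact this.1
    obtain ⟨y, rfl⟩ := exists_pos hi
    obtain ⟨y', rfl⟩ := exists_pos hj
    simp only [h, Finset.mem_insert, Finset.mem_singleton, pos_injective.eq_iff] at hmem
    rcases (hmem x).2 rfl with rfl | rfl
    · exact ⟨y', fun e => hij (by rw [e]), fun z => (hmem z).symm⟩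
    · exact ⟨y, fun e => hij (by rw [e]), fun z => (hmem z).symm.trans or_comm⟩
  choose f hf hf' using key
  have hff : ∀ x, f (f x) = x := fun x => by
    have h1 : l[pos x]? = l[pos (f x)]? := (hf' x (f x)).2 (.inr rfl)
    exact (((hf' (f x) x).1 h1.symm).resolve_left (hf x).symm).symm
  exact ⟨⟨f, hff, hf⟩, hn, fun x y => hf' x y⟩

/-- Labellings of the same pairing differ by an injective renaming. Together with the freedom of `σ`
in `exists_lowEq` this makes one layered word per connector sufficient for spanning. -/
theorem Pattern.exists_map {n : ℕ} {c : Connector n} {l m : List ℕ} (hl : Pattern c l)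
    (hm : Pattern c m) : ∃ σ, Set.InjOn σ {x | x ∈ l} ∧ l.map σ = m := by
  classical
  have heq : ∀ i j, i < n + n → j < n + n → (l[i]? = l[j]? ↔ m[i]? = m[j]?) := by
    intro i j hi hj
    obtain ⟨x, rfl⟩ := exists_pos hi
    obtain ⟨y, rfl⟩ := exists_pos hj
    rw [hl.eq_iff, hm.eq_iff]
  have hlt : ∀ {a}, a ∈ l → l.idxOf a < n + n := fun ha => hl.length ▸ List.idxOf_lt_length_of_mem ha
  have hget : ∀ {a}, a ∈ l → l[l.idxOf a]? = some a := fun ha => by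
    rw [List.getElem?_eq_getElem (List.idxOf_lt_length_of_mem ha), List.getElem_idxOf]
  refine ⟨fun a => (m[l.idxOf a]?).getD 0, ?_, ?_⟩
  · intro a ha b hb h
    have h1 := hlt ha
    have h2 := hlt hb
    simp only [List.getElem?_eq_getElem (hm.length.symm ▸ h1 : l.idxOf a < m.length),
      List.getElem?_eq_getElem (hm.length.symm ▸ h2 : l.idxOf b < m.length), Option.getD_some] at h
    have := (heq _ _ h1 h2).2 (by
      rw [List.getElem?_eq_getElem (hm.length.symm ▸ h1 : l.idxOf a < m.length),
        List.getElem?_eq_getElem (hm.length.symm ▸ h2 : l.idxOf b < m.length), h])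
    rw [hget ha, hget hb] at this
    exact Option.some_injective _ this
  · refine List.ext_getElem (by rw [List.length_map, hl.length, hm.length]) fun i h1 h2 => ?_
    rw [List.length_map] at h1
    rw [List.getElem_map]
    have h3 : l[i] ∈ l := List.getElem_mem h1
    have := (heq (l.idxOf l[i]) i (hlt h3) (hm.length ▸ h2)).1 (by
      rw [hget h3, List.getElem?_eq_getElem h1])
    rw [this, List.getElem?_eq_getElem h2, Option.getD_some]

/-! ### Bases -/

theorem eq_top_of_cls_mem {m n : ℕ} {P : Submodule Scal (TMod m n)} (h : ∀ w, cls m n w ∈ P) :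
    P = ⊤ := by
  refine eq_top_iff.2 fun x _ => ?_
  let S : Submodule Scal (Tangle m n →₀ Scal) :=
    Submodule.span Scal {x | Relator m n (show Tangle m n →₀ Coeff from x)}
  let π : (Tangle m n →₀ Scal) →ₗ[Scal] TMod m n := S.mkQ
  obtain ⟨y, rfl⟩ : ∃ y, π y = x := Submodule.Quotient.mk_surjective _ x
  induction y using Finsupp.induction_linear with
  | zero => rw [map_zero]; exact P.zero_mem
  | add y y' h h' => rw [map_add]; exact P.add_mem (h trivial) (h' trivial)
  | single t c =>
    induction t using Quot.inductionOn with
    | h D =>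
      have h1 : Finsupp.single (D.toTangle) c = c • Finsupp.single D.toTangle (1 : Scal) := by
        rw [Finsupp.smul_single, smul_eq_mul, mul_one]
      have h2 : π (Finsupp.single D.toTangle (1 : Scal)) = D.toTMod := rfl
      change π (Finsupp.single D.toTangle c) ∈ P
      rw [h1, map_smul, h2, Diagram.toTMod_eq_cls]
      exact P.smul_mem _ (h _)

/-- Diagrams that are layered after folding, one for each connector, form a basis. -/
theorem exists_basis_of_std {n : ℕ} (T : Connector n → Diagram n n) (l : Connector n → List ℕ)
    (s : Connector n → List Piece) (hs : ∀ c, Std (l c) (s c)) (hp : ∀ c, Pattern c (l c))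
    (hT : ∀ c, Eqv 0 (foldWord n (T c).word) (s c)) :
    ∃ B : Module.Basis (Connector n) Scal (TMod n n), ∀ c, B c = (T c).toTMod := by
  have := Fintype.ofFinite (Connector n)
  have hcaps : Runs (caps n) 0 (n + n) := by
    have := runs_caps n 0
    rwa [add_zero, two_mul] at this
  -- `F` folds and `U` unfolds; they are inverse to each other on the diagrams `T c` up to units,
  -- which suffices to transfer independence and spanning.
  obtain ⟨F, hF⟩ := exists_frame (m := n) (n := n) (n + n) [] hcaps
  obtain ⟨U, hU⟩ := exists_frame (m := 0) (n := n + n) (m' := n) n (pre := []) (j := n) (cups n) rfl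
  simp only [List.append_nil, List.nil_append] at hF hU
  replace hF : ∀ w, Runs w n n → F (cls n n w) = cls 0 (n + n) (foldWord n w) := hF
  replace hU : ∀ w, Runs w 0 (n + n) → U (cls 0 (n + n) w) = cls n n (unfoldWord n w) := hU
  choose u hu using hT
  have hFT : ∀ c, F (T c).toTMod = (u c).val • cls 0 (n + n) (s c) := fun c => by
    rw [Diagram.toTMod_eq_cls, hF _ (T c).runs]
    simpa using hu c [] [] 0 (n + n) rfl
  have hUs : ∀ c, ∃ k : Scalˣ, U (cls 0 (n + n) (s c)) = k.val • (T c).toTMod := fun c => by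
    have h1 : cls 0 (n + n) (s c) = (u c)⁻¹.val • F (T c).toTMod := by
      rw [hFT, smul_smul, Units.inv_mul, one_smul]
    obtain ⟨k, hk⟩ := eqv_unfold_fold (T c).runs
    have h2 := hk [] [] n n rfl
    simp only [List.append_nil, List.nil_append] at h2
    refine ⟨(u c)⁻¹ * k, ?_⟩
    rw [h1, map_smul, Diagram.toTMod_eq_cls, hF _ (T c).runs,
      hU _ (runs_foldWord (T c).runs),
      Units.val_mul, mul_smul]
    exact congrArg _ h2
  have hli : LinearIndependent Scal fun c => (T c).toTMod := by
    rw [Fintype.linearIndependent_iff]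
    intro a ha c
    have h1 := congrArg F ha
    simp only [map_sum, map_smul, hFT, smul_smul, map_zero] at h1
    have h2 := coeff_eq_zero_of_sum_std hs (fun c => (hp c).length)
      (fun c d h => (hp c).eq_of_imp (hp d) h) h1 c
    exact (u c).mul_left_eq_zero.1 h2
  have hspan : ⊤ ≤ Submodule.span Scal (Set.range fun c => (T c).toTMod) := by
    have hP : ∀ w, cls 0 (n + n) w ∈
        (Submodule.span Scal (Set.range fun c => (T c).toTMod)).comap U := by
      refine cls_mem_of_std _ fun l' hl' hn => ?_
      obtain ⟨c, hc⟩ := exists_connector hl' hn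
      obtain ⟨σ, h1, h2⟩ := hc.exists_map (hp c)
      refine ⟨σ, h1, s c, h2 ▸ hs c, ?_⟩
      obtain ⟨k, hk⟩ := hUs c
      rw [Submodule.mem_comap, hk]
      exact Submodule.smul_mem _ _ (Submodule.subset_span ⟨c, rfl⟩)
    have hcls : ∀ w, Runs w n n → cls n n w ∈
        Submodule.span Scal (Set.range fun c => (T c).toTMod) := fun w hw => by
      obtain ⟨k, hk⟩ := (eqv_unfold_fold hw).symm
      have h2 := hk [] [] n n rfl
      simp only [List.append_nil, List.nil_append] at h2
      rw [h2]
      refine Submodule.smul_mem _ _ ?_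
      have := hP (foldWord n w)
      rwa [Submodule.mem_comap, hU _ (runs_foldWord hw)] at this
    refine (eq_top_of_cls_mem fun w => ?_).ge
    by_cases hw : Runs w n n
    · exact hcls w hw
    · rw [cls_eq_zero hw]
      exact Submodule.zero_mem _
  exact ⟨Module.Basis.mk hli hspan, fun c => Module.Basis.mk_apply hli hspan c⟩


/-! ### The number of connectors -/

theorem cycleType_eq_replicate_iff {n : ℕ} (σ : Equiv.Perm (Fin n ⊕ Fin n)) :
    σ.cycleType = Multiset.replicate n 2 ↔ (∀ x, σ (σ x) = x) ∧ ∀ x, σ x ≠ x := by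
  have hsq : σ ^ 2 = 1 ↔ ∀ x, σ (σ x) = x := by
    rw [Equiv.ext_iff]
    simp [sq]
  have hsupp : σ.support.card = n + n ↔ ∀ x, σ x ≠ x := by
    have hc : n + n = Fintype.card (Fin n ⊕ Fin n) := by simp
    rw [hc, Finset.card_eq_iff_eq_univ, Finset.eq_univ_iff_forall]
    simp only [Equiv.Perm.mem_support]
  rw [← hsq, ← hsupp]
  constructor
  · intro h
    refine ⟨Equiv.Perm.pow_prime_eq_one_iff.2 fun c hc => Multiset.eq_of_mem_replicate (h ▸ hc), ?_⟩
    rw [← σ.sum_cycleType, h, Multiset.sum_replicate, smul_eq_mul, mul_two]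
  · rintro ⟨h1, h2⟩
    have h3 := Equiv.Perm.cycleType_of_pow_prime_eq_one h1
    rw [← σ.sum_cycleType, h3, Multiset.sum_replicate, smul_eq_mul] at h2
    rw [h3, show σ.cycleType.card = n by omega]

/-- Connectors are permutations of cycle type `2 + ⋯ + 2`. -/
def connectorEquiv (n : ℕ) : Connector n ≃
    {σ : Equiv.Perm (Fin n ⊕ Fin n) // σ.cycleType = Multiset.replicate n 2} where
  toFun c := ⟨Function.Involutive.toPerm c.partner c.partner_partner,
    (cycleType_eq_replicate_iff _).2 ⟨c.partner_partner, c.partner_ne⟩⟩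
  invFun σ := ⟨σ.1, ((cycleType_eq_replicate_iff _).1 σ.2).1, ((cycleType_eq_replicate_iff _).1 σ.2).2⟩
  left_inv _ := rfl
  right_inv _ := Subtype.ext (Equiv.ext fun _ => rfl)

/-- The conjugacy class of cycle type `2 + ⋯ + 2` on `2n` points has `(2n)! / (2 ^ n * n!)`
elements, and `2 ^ n * n!` is the double factorial of `2n`. -/
theorem card_connector (n : ℕ) : Nat.card (Connector n) = Nat.doubleFactorial (2 * n - 1) := by
  classical
  rw [Nat.card_congr (connectorEquiv n), Nat.card_eq_fintype_card, Fintype.card_subtype]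
  have h := Equiv.Perm.card_of_cycleType_mul_eq (Fin n ⊕ Fin n) (Multiset.replicate n 2)
  rw [if_pos ⟨by simp [mul_two], fun a ha => (Multiset.eq_of_mem_replicate ha).ge⟩] at h
  rcases n with _ | n
  · simpa using h
  · have h1 : (Multiset.replicate (n + 1) 2).toFinset = {2} := by
      rw [Multiset.toFinset_replicate]; simp
    rw [h1, Finset.prod_singleton, Multiset.count_replicate_self, Multiset.prod_replicate,
      Multiset.sum_replicate, Fintype.card_sum, Fintype.card_fin, smul_eq_mul, mul_two,
      Nat.sub_self, Nat.factorial_zero, one_mul, ← Nat.doubleFactorial_two_mul] at h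
    have h2 := Nat.factorial_eq_mul_doubleFactorial (2 * n + 1)
    rw [show 2 * n + 1 + 1 = 2 * (n + 1) by ring] at h2
    rw [show n + 1 + (n + 1) = 2 * (n + 1) by ring, h2, mul_comm] at h
    exact Nat.eq_of_mul_eq_mul_left (Nat.doubleFactorial_pos _) h

/-! ### The module is free -/

/-- A spanning family with as many elements as a basis is a basis. -/
theorem exists_basis_of_span {R M ι : Type} [CommRing R] [AddCommGroup M] [Module R M] [Finite ι]
    (B : Module.Basis ι R M) {v : ι → M} (hv : Submodule.span R (Set.range v) = ⊤) :
    ∃ B' : Module.Basis ι R M, ∀ i, B' i = v i := by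
  have : Module.Finite R M := Module.Finite.of_basis B
  let f : M →ₗ[R] M := B.constr R v
  have hs : Function.Surjective f := by
    rw [← LinearMap.range_eq_top, Module.Basis.constr_range, hv]
  -- The map from the basis to the spanning family is a surjective endomorphism of a finitely
  -- generated module, hence injective.
  have hi : Function.Injective f := OrzechProperty.injective_of_surjective_endomorphism f hs
  exact ⟨B.map (LinearEquiv.ofBijective f ⟨hi, hs⟩), fun i =>
    (Module.Basis.map_apply _ _ _).trans (B.constr_basis R v i)⟩

/-- Unfolding one layered word for each connector gives such a family. -/
theorem exists_basis (n : ℕ) : Nonempty (Module.Basis (Connector n) Scal (TMod n n)) := by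
  choose l hl using fun c : Connector n => exists_pattern c
  choose s hs using fun c => exists_std (hl c).double
  have hr : ∀ c, Runs (s c) 0 (n + n) := fun c => (hl c).length ▸ (hs c).runs
  obtain ⟨B, -⟩ := exists_basis_of_std (fun c => ⟨unfoldWord n (s c), runs_unfoldWord (hr c)⟩)
    l s hs hl fun c => eqv_fold_unfold (hr c)
  exact ⟨B⟩

/-- The values `z = 0`, `λ = 1`, `δ = 0` in `ℤ` satisfy the relation of `Λ`; nontriviality is needed
to read off the rank from a basis. -/
instance : Nontrivial Scal := by
  obtain ⟨φ, -⟩ := exists_ringHom (R := ℤ) (z := 0) (lam := 1) (lamI := 1) (d := 0) (by simp)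
    (by simp)
  exact φ.domain_nontrivial

theorem rank_tMod (n : ℕ) :
    Module.rank Scal (TMod n n) = (Nat.doubleFactorial (2 * n - 1) : Cardinal) := by
  obtain ⟨B⟩ := exists_basis n
  have := Fintype.ofFinite (Connector n)
  rw [rank_eq_card_basis B, ← Nat.card_eq_fintype_card, card_connector]


/-! ### Neighbouring points of a diagram -/

theorem foldl_after_eq {w : List Piece} : ∀ {m n : ℕ}, Runs w m n →
    w.foldl (fun w p => p.after w) m = n := by
  induction w with
  | nil => intro m n h; exact h
  | cons p w ih => intro m n h; exact ih h.2

namespace Diagram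

variable {m n : ℕ} (D : Diagram m n)

theorem width_zero : D.width 0 = m := rfl

theorem width_length : D.width D.word.length = n := by
  unfold width
  rw [List.take_length]
  exact foldl_after_eq D.runs

variable {D}

theorem width_succ {k : ℕ} {p : Piece} (hp : D.word[k]? = some p) :
    D.width (k + 1) = p.after (D.width k) := by
  unfold width
  rw [List.take_add_one, hp]
  simp

theorem fits {k : ℕ} {p : Piece} (hp : D.word[k]? = some p) : p.Fits (D.width k) := by
  have hk : k < D.word.length := by
    by_contra h
    rw [List.getElem?_eq_none (by omega)] at hp
    cases hp
  have h := D.runs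
  rw [← List.take_append_drop k D.word] at h
  rw [runs_append] at h
  obtain ⟨w, h1, h2⟩ := h
  rw [List.drop_eq_getElem_cons hk] at h2
  have := foldl_after_eq h1
  rw [List.getElem?_eq_getElem hk] at hp
  injection hp with hp
  rw [hp] at h2
  unfold width
  rw [this]
  exact h2.1

end Diagram

open Classical in
/-- The other end of the strand of the piece `p` that starts downwards at the point `r` above
`p`. -/
def Piece.down (p : Piece) (r : ℕ × ℕ) : ℕ × ℕ :=
  if r.2 < p.left then (r.1 + 1, r.2)
  else if p.left + p.shape.ins ≤ r.2 then (r.1 + 1, r.2 - p.shape.ins + p.shape.outs)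
  else if p.shape = .cup then (r.1, 2 * p.left + 1 - r.2) else (r.1 + 1, 2 * p.left + 1 - r.2)

open Classical in
/-- The other end of the strand of the piece `p` that starts upwards at the point `r` below
`p`. -/
def Piece.up (p : Piece) (r : ℕ × ℕ) : ℕ × ℕ :=
  if r.2 < p.left then (r.1 - 1, r.2)
  else if p.left + p.shape.outs ≤ r.2 then (r.1 - 1, r.2 - p.shape.outs + p.shape.ins)
  else if p.shape = .cap then (r.1, 2 * p.left + 1 - r.2) else (r.1 - 1, 2 * p.left + 1 - r.2)

namespace Diagram

variable {m n : ℕ} (D : Diagram m n)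

/-- `r` and `r'` are the ends of a strand of the piece below level `k`. -/
def NbrAt (k : ℕ) (r r' : ℕ × ℕ) : Prop :=
  ∃ p, D.word[k]? = some p ∧
    ((r.1 = k ∧ r.2 < D.width k ∧ r' = p.down r) ∨
      (r.1 = k + 1 ∧ r.2 < D.width (k + 1) ∧ r' = p.up r))

variable {D}

theorem NbrAt.symm {k : ℕ} {r r' : ℕ × ℕ} (h : D.NbrAt k r r') : D.NbrAt k r' r := by
  obtain ⟨p, hp, h⟩ := h
  have hf := fits hp
  have hw := width_succ hp
  refine ⟨p, hp, ?_⟩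
  obtain ⟨r1, r2⟩ := r
  obtain ⟨r1', r2'⟩ := r'
  rcases p with ⟨s, i⟩
  simp only [Piece.after, Piece.Fits, Piece.down, Piece.up] at *
  rcases s with ε | _ | _ <;> simp only [Shape.ins, Shape.outs, reduceCtorEq, if_false, if_true] at * <;>
  rcases h with ⟨h1, h2, h3⟩ | ⟨h1, h2, h3⟩ <;> split_ifs at h3 <;>
  simp only [Prod.mk.injEq] at h3 <;> obtain ⟨rfl, rfl⟩ := h3 <;>
  (try omega) <;> split_ifs <;>
  (try simp only [Prod.mk.injEq, and_true]) <;> (try simp) <;> omega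

theorem NbrAt.level {k : ℕ} {r r' : ℕ × ℕ} (h : D.NbrAt k r r') : r.1 = k ∨ r.1 = k + 1 := by
  obtain ⟨p, _, h | h⟩ := h <;> simp [h.1]

theorem NbrAt.lt_length {k : ℕ} {r r' : ℕ × ℕ} (h : D.NbrAt k r r') : k < D.word.length := by
  obtain ⟨p, hp, _⟩ := h
  by_contra h
  rw [List.getElem?_eq_none (by omega)] at hp
  cases hp

theorem NbrAt.isPoint {k : ℕ} {r r' : ℕ × ℕ} (h : D.NbrAt k r r') : D.IsPoint r := by
  have h0 := h.lt_length
  obtain ⟨p, hp, ⟨h1, h2, h3⟩ | ⟨h1, h2, h3⟩⟩ := h <;> refine ⟨by omega, ?_⟩ <;> rwa [h1]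

theorem NbrAt.ne {k : ℕ} {r r' : ℕ × ℕ} (h : D.NbrAt k r r') : r ≠ r' := by
  obtain ⟨p, hp, h⟩ := h
  obtain ⟨r1, r2⟩ := r
  obtain ⟨r1', r2'⟩ := r'
  simp only [Piece.down, Piece.up] at h
  rw [Ne, Prod.mk.injEq]
  rcases h with ⟨h1, h2, h3⟩ | ⟨h1, h2, h3⟩ <;> split_ifs at h3 <;>
  simp only [Prod.mk.injEq] at h3 <;> omega

theorem NbrAt.unique {k : ℕ} {r r₁ r₂ : ℕ × ℕ} (h₁ : D.NbrAt k r r₁) (h₂ : D.NbrAt k r r₂) :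
    r₁ = r₂ := by
  obtain ⟨p, hp, h⟩ := h₁
  obtain ⟨p', hp', h'⟩ := h₂
  rw [hp] at hp'
  injection hp' with hp'
  subst hp'
  rcases h with ⟨h1, h2, h3⟩ | ⟨h1, h2, h3⟩ <;> rcases h' with ⟨h1', h2', h3'⟩ | ⟨h1', h2', h3'⟩ <;>
  first | omega | rw [h3, h3']

theorem Strand.nbrAt {r r' : ℕ × ℕ} (h : D.Strand r r') : ∃ k, D.NbrAt k r r' := by
  cases h with
  | left k p j hp hj =>
    have := fits hp
    unfold Piece.Fits at this
    exact ⟨k, p, hp, .inl ⟨rfl, by simp only; omega, by simp [Piece.down, hj]⟩⟩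
  | right k p j hp hj =>
    refine ⟨k, p, hp, .inl ⟨rfl, hj, ?_⟩⟩
    simp only [Piece.down]
    rw [if_neg (by omega), if_pos (by omega)]
    congr 1
    omega
  | crossRight k ε i hp =>
    have := fits hp
    simp only [Piece.Fits, Shape.ins] at this
    refine ⟨k, _, hp, .inl ⟨rfl, by simp only; omega, ?_⟩⟩
    simp [Piece.down, Shape.ins]
    omega
  | crossLeft k ε i hp =>
    have := fits hp
    simp only [Piece.Fits, Shape.ins] at this
    refine ⟨k, _, hp, .inl ⟨rfl, by simp only; omega, ?_⟩⟩
    simp [Piece.down, Shape.ins]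
    omega
  | cup k i hp =>
    have := fits hp
    simp only [Piece.Fits, Shape.ins] at this
    refine ⟨k, _, hp, .inl ⟨rfl, by simp only; omega, ?_⟩⟩
    simp [Piece.down, Shape.ins]
    omega
  | cap k i hp =>
    have := fits hp
    have hw := width_succ hp
    simp only [Piece.Fits, Shape.ins, Shape.outs, Piece.after] at this hw
    refine ⟨k, _, hp, .inr ⟨rfl, by simp only; omega, ?_⟩⟩
    simp [Piece.up, Shape.outs]
    omega

/-- The strands are described by the functions `down` and `up`, which makes the neighbour of a point
within a given piece unique. -/
theorem adj_iff {r r' : ℕ × ℕ} : D.Adj r r' ↔ ∃ k, D.NbrAt k r r' := by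
  constructor
  · rintro (h | h)
    · exact h.nbrAt
    · obtain ⟨k, h⟩ := h.nbrAt
      exact ⟨k, h.symm⟩
  · have key : ∀ k p r, D.word[k]? = some p → r.1 = k → r.2 < D.width k → D.Adj r (p.down r) := by
      rintro k p ⟨_, j⟩ hp rfl hj
      simp only [Piece.down] at *
      split_ifs with h1 h2 h3
      · exact .inl (.left _ p j hp h1)
      · obtain ⟨a, rfl⟩ := Nat.exists_eq_add_of_le h2
        have := Strand.right (D := D) _ p a hp hj
        rw [show p.left + p.shape.ins + a - p.shape.ins + p.shape.outs =
          p.left + p.shape.outs + a by omega]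
        exact .inl this
      · obtain ⟨s, i⟩ := p
        simp only at h1 h2 h3
        subst h3
        simp only [Shape.ins] at h2
        rcases (show j = i ∨ j = i + 1 by omega) with rfl | rfl
        · rw [show 2 * j + 1 - j = j + 1 by omega]
          exact .inl (.cup _ _ hp)
        · rw [show 2 * i + 1 - (i + 1) = i by omega]
          exact .inr (.cup _ _ hp)
      · obtain ⟨s, i⟩ := p
        simp only at h1 h2 h3
        rcases s with ε | _ | _
        · simp only [Shape.ins] at h2
          rcases (show j = i ∨ j = i + 1 by omega) with rfl | rfl
          · rw [show 2 * j + 1 - j = j + 1 by omega]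
            exact .inl (.crossRight _ ε _ hp)
          · rw [show 2 * i + 1 - (i + 1) = i by omega]
            exact .inl (.crossLeft _ ε _ hp)
        · exact absurd rfl h3
        · simp only [Shape.ins] at h2
          omega
    rintro ⟨k, h⟩
    have hs := h.symm
    obtain ⟨p, hp, ⟨h1, h2, rfl⟩ | ⟨h1, h2, rfl⟩⟩ := h
    · exact key k p r hp h1 h2
    · obtain ⟨p', hp', ⟨h1', h2', h3'⟩ | ⟨h1', h2', h3'⟩⟩ := hs
      · have h := key k p' _ hp' h1' h2'
        rw [← h3'] at h
        exact h.symm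
      · obtain ⟨_, j⟩ := r
        simp only at h1
        subst h1
        -- A strand with both ends below the piece can only be that of a maximum.
        have hc : ¬ j < p.left ∧ ¬ p.left + p.shape.outs ≤ j ∧ p.shape = .cap := by
          simp only [Piece.up] at h1'
          split_ifs at h1' with g1 g2 g3
          · simp at h1'
          · simp at h1'
          · exact ⟨g1, g2, g3⟩
          · simp at h1'
        obtain ⟨g1, g2, g3⟩ := hc
        obtain ⟨s, i⟩ := p
        simp only at g1 g2 g3
        subst g3
        simp only [Shape.outs] at g2
        have hu : Piece.up ⟨.cap, i⟩ (k + 1, j) = (k + 1, 2 * i + 1 - j) := by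
          simp [Piece.up, Shape.outs, g1, g2]
        rw [hu]
        rcases (show j = i ∨ j = i + 1 by omega) with rfl | rfl
        · rw [show 2 * j + 1 - j = j + 1 by omega]
          exact .inl (.cap _ _ hp)
        · rw [show 2 * i + 1 - (i + 1) = i by omega]
          exact .inr (.cap _ _ hp)

theorem Adj.symm {r r' : ℕ × ℕ} (h : D.Adj r r') : D.Adj r' r := Or.symm h

/-- A point has at most two neighbours. -/
theorem adj_three {r q₁ q₂ q₃ : ℕ × ℕ} (h₁ : D.Adj r q₁) (h₂ : D.Adj r q₂) (h₃ : D.Adj r q₃) :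
    q₁ = q₂ ∨ q₁ = q₃ ∨ q₂ = q₃ := by
  obtain ⟨k₁, h₁⟩ := adj_iff.1 h₁
  obtain ⟨k₂, h₂⟩ := adj_iff.1 h₂
  obtain ⟨k₃, h₃⟩ := adj_iff.1 h₃
  have e₁ := h₁.level
  have e₂ := h₂.level
  have e₃ := h₃.level
  rcases (show k₁ = k₂ ∨ k₁ = k₃ ∨ k₂ = k₃ by omega) with rfl | rfl | rfl
  · exact .inl (h₁.unique h₂)
  · exact .inr (.inl (h₁.unique h₃))
  · exact .inr (.inr (h₂.unique h₃))

/-- An end point has at most one neighbour. -/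
theorem adj_endPt {x : Fin m ⊕ Fin n} {q₁ q₂ : ℕ × ℕ} (h₁ : D.Adj (D.endPt x) q₁)
    (h₂ : D.Adj (D.endPt x) q₂) : q₁ = q₂ := by
  obtain ⟨k₁, h₁⟩ := adj_iff.1 h₁
  obtain ⟨k₂, h₂⟩ := adj_iff.1 h₂
  have e₁ := h₁.level
  have e₂ := h₂.level
  have l₁ := h₁.lt_length
  have l₂ := h₂.lt_length
  have : k₁ = k₂ := by
    rcases x with x | x <;> simp only [endPt] at e₁ e₂ <;> omega
  subst this
  exact h₁.unique h₂

/-! ### Times -/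

/-- A traversal has no chords: an inner point has at most two neighbours and the initial end point
at most one, and these are its neighbours in the list. -/
theorem Traverses.eq_add_one_of_adj {l : List (ℕ × ℕ)} (h : D.Traverses l) {x : Fin m ⊕ Fin n}
    (hx : l.head? = some (D.endPt x)) {a b : ℕ} (ha : a < l.length) (hb : b < l.length)
    (hab : a < b) (hadj : D.Adj l[a] l[b]) : b = a + 1 := by
  have hc := List.isChain_iff_getElem.1 h.chain
  have h1 : D.Adj l[a] l[a + 1] := hc a (by omega)
  rcases Nat.eq_zero_or_pos a with rfl | h0
  · have : l[0] = D.endPt x := by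
      rw [List.head?_eq_getElem?, List.getElem?_eq_getElem ha] at hx
      exact Option.some.inj hx
    rw [this] at h1 hadj
    exact (h.nodup.getElem_inj_iff).1 (adj_endPt hadj h1)
  · obtain ⟨a, rfl⟩ := Nat.exists_eq_succ_of_ne_zero h0.ne'
    have h2 : D.Adj l[a + 1] l[a] := (hc a (by omega)).symm
    rcases adj_three hadj h1 h2 with e | e | e <;> have := (h.nodup.getElem_inj_iff).1 e <;> omega

variable (D) in
/-- A numbering of the points of `D` for which consecutive points on a component have consecutive
numbers and each overcrossing comes before the undercrossing. -/
structure Timing (t : ℕ × ℕ → ℕ) : Prop where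
  inj : ∀ r r', D.IsPoint r → D.IsPoint r' → t r = t r' → r = r'
  step : ∀ k r r', D.NbrAt k r r' → t r' = t r + 1 ∨ t r = t r' + 1
  over_first : ∀ k ε i, D.word[k]? = some ⟨.cross ε, i⟩ → t (overPt k ε i) < t (underPt k ε i)

theorem Joined.mem_of_traverses {l : List (ℕ × ℕ)} (h : D.Traverses l) {r r' : ℕ × ℕ}
    (hj : D.Joined r r') (hr : r ∈ l) : r' ∈ l := by
  induction hj with
  | refl => exact hr
  | tail _ h2 ih => exact h.closed _ ih _ h2

theorem Joined.symm {r r' : ℕ × ℕ} (h : D.Joined r r') : D.Joined r' r := by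
  induction h with
  | refl => exact .refl
  | tail _ h2 ih => exact .head h2.symm ih

/-- The time of a point is its place in the concatenation of all traversals. -/
theorem exists_timing (h1 : D.NoClosed) {b : List (Fin m ⊕ Fin n)} (h3 : D.TotallyDescending b) :
    ∃ t, D.Timing t := by
  obtain ⟨A, C, hA, hT, hC, hn, hm, ho⟩ := h3
  -- A traversal in `C` would contain an end point, because every component is an arc.
  have hC0 : C = [] := by
    rcases C with _ | ⟨l, C⟩
    · rfl
    · obtain ⟨h, h'⟩ := hC l (by simp)
      obtain ⟨r, l', rfl⟩ := List.exists_cons_of_ne_nil h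
      obtain ⟨x, hx⟩ := h1 r ((hm r).1 (by simp))
      exact (h' x (hx.symm.mem_of_traverses (hT _ (by simp)) (by simp))).elim
  subst hC0
  simp only [List.append_nil] at *
  refine ⟨fun r => A.flatten.idxOf r, ?_, ?_, ho⟩
  · intro r r' hr hr' h
    exact (List.idxOf_inj ((hm r).2 hr)).1 h
  · intro k r r' h
    have hr := (hm r).2 h.isPoint
    obtain ⟨l, hl, hrl⟩ := List.mem_flatten.1 hr
    have hadj : D.Adj r r' := adj_iff.2 ⟨k, h⟩
    have hrl' := (hT l hl).closed r hrl r' hadj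
    obtain ⟨A1, A2, rfl⟩ := List.append_of_mem hl
    simp only [List.flatten_append, List.flatten_cons] at hn ⊢
    have hd := (List.nodup_append'.1 hn).2.2
    have hi : ∀ q ∈ l, (A1.flatten ++ (l ++ A2.flatten)).idxOf q = A1.flatten.length + l.idxOf q := by
      intro q hq
      rw [List.idxOf_append_of_notMem (fun hq' => hd hq' (by simp [hq])),
        List.idxOf_append_of_mem hq]
    rw [hi r hrl, hi r' hrl']
    obtain ⟨x, hx⟩ : ∃ x, l.head? = some (D.endPt x) := by
      have : l.head? ∈ (A1 ++ l :: A2).map List.head? := List.mem_map_of_mem hl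
      rw [hA] at this
      obtain ⟨x, _, hx⟩ := List.mem_map.1 this
      exact ⟨x, hx.symm⟩
    have ha := List.idxOf_lt_length_iff.2 hrl
    have hb := List.idxOf_lt_length_iff.2 hrl'
    have ea : l[l.idxOf r] = r := List.getElem_idxOf ha
    have eb : l[l.idxOf r'] = r' := List.getElem_idxOf hb
    rcases lt_trichotomy (l.idxOf r) (l.idxOf r') with hlt | heq | hgt
    · have := Traverses.eq_add_one_of_adj (hT l hl) hx ha hb hlt (by rw [ea, eb]; exact hadj)
      omega
    · exact absurd ((List.idxOf_inj hrl).1 heq) h.ne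
    · have := Traverses.eq_add_one_of_adj (hT l hl) hx hb ha hgt (by rw [ea, eb]; exact hadj.symm)
      omega

end Diagram
namespace Diagram

/-! ### The first pieces of a diagram -/

variable {m n : ℕ} (D : Diagram m n) (t : ℕ × ℕ → ℕ)

/-- The points with times `τ` and `τ + 1` are joined by a strand of the first `k` pieces. -/
def Link (k τ : ℕ) : Prop := ∃ j r r', j < k ∧ D.NbrAt j r r' ∧ t r = τ ∧ t r' = τ + 1

/-- `τ` is the time of a point of level at most `k`. -/
def Passed (k τ : ℕ) : Prop := ∃ r, D.IsPoint r ∧ r.1 ≤ k ∧ t r = τ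

open Classical in
/-- The least time from which the point with time `τ` is reached within the first `k` pieces. -/
def startTime (k : ℕ) : ℕ → ℕ
  | 0 => 0
  | τ + 1 => if D.Link t k τ then startTime k τ else τ + 1

variable {D t}

theorem Link.mono {k l τ : ℕ} (h : D.Link t k τ) (hkl : k ≤ l) : D.Link t l τ := by
  obtain ⟨j, r, r', hj, h⟩ := h
  exact ⟨j, r, r', by omega, h⟩

theorem Link.passed {k τ : ℕ} (h : D.Link t k τ) : D.Passed t k τ := by
  obtain ⟨j, r, r', hj, h, h1, h2⟩ := h
  exact ⟨r, h.isPoint, by have := h.level; omega, h1⟩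

theorem Link.passed_succ {k τ : ℕ} (h : D.Link t k τ) : D.Passed t k (τ + 1) := by
  obtain ⟨j, r, r', hj, h, h1, h2⟩ := h
  exact ⟨r', h.symm.isPoint, by have := h.symm.level; omega, h2⟩

theorem startTime_succ_of_link {k τ : ℕ} (h : D.Link t k τ) :
    D.startTime t k (τ + 1) = D.startTime t k τ := by
  rw [startTime, if_pos h]

theorem startTime_succ_of_not_link {k τ : ℕ} (h : ¬ D.Link t k τ) :
    D.startTime t k (τ + 1) = τ + 1 := by
  rw [startTime, if_neg h]

theorem startTime_le (k τ : ℕ) : D.startTime t k τ ≤ τ := by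
  induction τ with
  | zero => simp [startTime]
  | succ τ ih =>
    by_cases h : D.Link t k τ
    · rw [startTime_succ_of_link h]; omega
    · rw [startTime_succ_of_not_link h]

theorem startTime_mono (k : ℕ) : Monotone (D.startTime t k) := by
  refine monotone_nat_of_le_succ fun τ => ?_
  by_cases h : D.Link t k τ
  · rw [startTime_succ_of_link h]
  · rw [startTime_succ_of_not_link h]
    exact (startTime_le k τ).trans (Nat.le_succ τ)

theorem startTime_startTime {k l : ℕ} (hkl : k ≤ l) (τ : ℕ) :
    D.startTime t l (D.startTime t k τ) = D.startTime t l τ := by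
  induction τ with
  | zero => simp [startTime]
  | succ τ ih =>
    by_cases h : D.Link t k τ
    · rw [startTime_succ_of_link h, startTime_succ_of_link (h.mono hkl), ih]
    · rw [startTime_succ_of_not_link h]

theorem startTime_passed {k τ : ℕ} (h : D.Passed t k τ) : D.Passed t k (D.startTime t k τ) := by
  induction τ with
  | zero => exact h
  | succ τ ih =>
    by_cases h' : D.Link t k τ
    · rw [startTime_succ_of_link h']
      exact ih h'.passed
    · rwa [startTime_succ_of_not_link h']

theorem startTime_zero_left (τ : ℕ) : D.startTime t 0 τ = τ := by
  cases τ with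
  | zero => rfl
  | succ τ => exact startTime_succ_of_not_link fun ⟨_, _, _, h, _⟩ => by omega

/-- Between times on the same component all steps are strands. -/
theorem link_of_startTime_eq {k a b : ℕ} (h : D.startTime t k a = D.startTime t k b) :
    ∀ σ, a ≤ σ → σ < b → D.Link t k σ := by
  intro σ h1 h2
  by_contra hl
  have h3 := startTime_succ_of_not_link hl
  have h4 := startTime_mono (D := D) (t := t) k (show σ + 1 ≤ b by omega)
  have h5 := startTime_le (D := D) (t := t) k a
  omega

theorem exists_not_link {k a b : ℕ} (hab : a ≤ b) (h : D.startTime t k a ≠ D.startTime t k b) :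
    ∃ σ, a ≤ σ ∧ σ < b ∧ ¬ D.Link t k σ ∧ D.startTime t k σ = D.startTime t k a := by
  induction b, hab using Nat.le_induction with
  | base => exact absurd rfl h
  | succ b hab ih =>
    by_cases hb : D.startTime t k a = D.startTime t k b
    · refine ⟨b, hab, by omega, fun hl => h ?_, hb.symm⟩
      rw [startTime_succ_of_link hl, hb]
    · obtain ⟨σ, h1, h2, h3⟩ := ih hb
      exact ⟨σ, h1, by omega, h3⟩

/-! ### How components of the upper part of a diagram merge -/

namespace Timing

variable (ht : D.Timing t)
include ht

theorem level_le {k : ℕ} {r : ℕ × ℕ} (hr : D.IsPoint r) (h : D.Passed t k (t r)) : r.1 ≤ k := by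
  obtain ⟨r', h1, h2, h3⟩ := h
  rwa [← ht.inj _ _ h1 hr h3]

/-- A point of level `k` has only one neighbour within the first `k` pieces. -/
theorem not_link {r : ℕ × ℕ} {τ : ℕ} (hr : D.IsPoint r) (h : t r = τ + 1) (h1 : D.Link t r.1 τ) :
    ¬ D.Link t r.1 (τ + 1) := by
  rintro ⟨j₂, p₂, q₂, hj₂, h₂, e₂, e₂'⟩
  obtain ⟨j₁, p₁, q₁, hj₁, h₁, e₁, e₁'⟩ := h1
  have a₁ := ht.inj _ _ h₁.symm.isPoint hr (by omega)
  have a₂ := ht.inj _ _ h₂.isPoint hr (by omega)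
  subst a₁ a₂
  have l₁ := h₁.symm.level
  have l₂ := h₂.level
  obtain rfl : j₁ = j₂ := by omega
  have := h₁.symm.unique h₂
  subst this
  omega

theorem link_min {k j : ℕ} {r r' : ℕ × ℕ} (h : D.NbrAt j r r') (hj : j < k) :
    D.startTime t k (t r) = D.startTime t k (t r') := by
  rcases ht.step _ _ _ h with e | e
  · rw [e, startTime_succ_of_link ⟨j, r, r', hj, h, rfl, e⟩]
  · rw [e, startTime_succ_of_link ⟨j, r', r, hj, h.symm, rfl, e⟩]

theorem startTime_joined {r r' : ℕ × ℕ} (h : D.Joined r r') :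
    D.startTime t D.word.length (t r) = D.startTime t D.word.length (t r') := by
  induction h with
  | refl => rfl
  | tail _ h2 ih =>
    obtain ⟨k, hk⟩ := adj_iff.1 h2
    rw [ih, ht.link_min hk hk.lt_length]

/-- Two components of the first `k` pieces are only joined by piece number `k` if it is a
minimum. -/
theorem exists_cup {k a b : ℕ} (hab : a < b) (ha : D.Passed t k a) (hb : D.Passed t k b)
    (h1 : D.startTime t k a ≠ D.startTime t k b)
    (h2 : D.startTime t (k + 1) a = D.startTime t (k + 1) b) :
    ∃ i r r', D.word[k]? = some ⟨.cup, i⟩ ∧ (r = (k, i) ∧ r' = (k, i + 1) ∨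
      r = (k, i + 1) ∧ r' = (k, i)) ∧ D.startTime t k (t r) = D.startTime t k a ∧
      t r' = t r + 1 := by
  obtain ⟨σ, h3, h4, h5, h6⟩ := exists_not_link hab.le h1
  have hl := link_of_startTime_eq h2
  -- If `σ` were not passed, it would not be linked to its predecessor and would itself be a start
  -- time, larger than that of `a`.
  have hσ : D.Passed t k σ := by
    rcases h3.eq_or_lt with rfl | h3
    · exact ha
    · obtain ⟨σ, rfl⟩ := Nat.exists_eq_succ_of_ne_zero (show σ ≠ 0 by omega)
      by_contra hn
      have : ¬ D.Link t k σ := fun h => hn h.passed_succ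
      rw [Nat.succ_eq_add_one, startTime_succ_of_not_link this] at h6
      have := startTime_le (D := D) (t := t) k a
      omega
  obtain ⟨j, r, r', hj, h, e, e'⟩ := hl σ h3 h4
  have hjk : j = k := by
    by_contra hjk
    exact h5 ⟨j, r, r', by omega, h, e, e'⟩
  subst hjk
  have hr : r.1 = j := by
    have := ht.level_le h.isPoint (e ▸ hσ)
    have := h.level
    omega
  -- Below the piece, `r'` would have only one neighbour in the first `j + 1` pieces; but the times
  -- up to `b` are all linked, and `σ + 1` is not the last of them.
  have hr' : r'.1 = j := by
    rcases h.symm.level with h7 | h7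
    · exact h7
    · exfalso
      have hne : σ + 1 ≠ b := by
        rintro rfl
        have := ht.level_le h.symm.isPoint (e' ▸ hb)
        omega
      refine ht.not_link h.symm.isPoint e' ?_ ?_ <;> rw [h7]
      · exact hl σ h3 h4
      · exact hl (σ + 1) (by omega) (by omega)
  have hne := h.ne
  obtain ⟨p, hp, ⟨-, h7, h8⟩ | ⟨h7, -, -⟩⟩ := h
  swap; · omega
  obtain ⟨r1, r2⟩ := r
  obtain ⟨r1', r2'⟩ := r'
  simp only at hr hr'
  subst hr hr'
  rcases p with ⟨s, i⟩
  simp only [Piece.down] at h8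
  split_ifs at h8 with c1 c2 c3
  · simp at h8
  · simp at h8
  · subst c3
    refine ⟨i, (r1', r2), (r1', r2'), hp, ?_, by rw [e, h6], by rw [e, e']⟩
    simp only [Shape.ins] at c2
    simp only [Prod.mk.injEq, true_and] at h8 ⊢
    omega
  · simp at h8

/-- The two ends of a minimum belong to different components of the pieces above it. -/
theorem startTime_cup_ne (hc : D.NoClosed) {k i : ℕ} (hp : D.word[k]? = some ⟨.cup, i⟩) :
    D.startTime t k (t (k, i)) ≠ D.startTime t k (t (k, i + 1)) := by
  intro heq
  have h : D.NbrAt k (k, i) (k, i + 1) := by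
    obtain ⟨k', h⟩ := (Strand.cup k i hp).nbrAt
    have h1 := h.level
    obtain ⟨p', hp', ⟨h2, h3, h4⟩ | ⟨h2, h3, h4⟩⟩ := h
    · simp only at h2
      subst h2
      exact ⟨p', hp', .inl ⟨rfl, h3, h4⟩⟩
    · have hf := fits hp
      simp only [Piece.Fits, Shape.ins] at hf
      refine ⟨_, hp, .inl ⟨rfl, by simp only; omega, ?_⟩⟩
      simp [Piece.down, Shape.ins]
      omega
  -- The two ends have consecutive times, so lying on one component they are joined by a strand
  -- above. Together with the minimum this strand is a closed component without end points.
  have key : ∃ j, j < k ∧ D.NbrAt j (k, i) (k, i + 1) := by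
    have aux : ∀ r r', D.NbrAt k r r' → t r' = t r + 1 →
        D.startTime t k (t r) = D.startTime t k (t r') → ∃ j, j < k ∧ D.NbrAt j r r' := by
      intro r r' h h1 h2
      obtain ⟨j, q, q', hj, h3, h4, h5⟩ := link_of_startTime_eq h2 (t r) le_rfl (by omega)
      rw [ht.inj _ _ h3.isPoint h.isPoint h4,
        ht.inj _ _ h3.symm.isPoint h.symm.isPoint (by omega)] at h3
      exact ⟨j, hj, h3⟩
    rcases ht.step _ _ _ h with e | e
    · exact aux _ _ h e heq
    · obtain ⟨j, hj, h'⟩ := aux _ _ h.symm e heq.symm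
      exact ⟨j, hj, h'.symm⟩
  obtain ⟨j, hj, h'⟩ := key
  obtain ⟨x, hx⟩ := hc _ h.isPoint
  have hcl : ∀ r r', D.Joined r r' → (r = (k, i) ∨ r = (k, i + 1)) →
      (r' = (k, i) ∨ r' = (k, i + 1)) := by
    intro r r' hj' hr
    induction hj' with
    | refl => exact hr
    | tail _ h2 ih =>
      obtain ⟨l, hl⟩ := adj_iff.1 h2
      have hlev := hl.level
      have hlev' := h'.level
      simp only at hlev'
      rcases ih with rfl | rfl
      · simp only at hlev
        rcases (show l = k ∨ l = j by omega) with rfl | rfl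
        · exact .inr (hl.unique h)
        · exact .inr (hl.unique h')
      · simp only at hlev
        rcases (show l = k ∨ l = j by omega) with rfl | rfl
        · exact .inl (hl.unique h.symm)
        · exact .inl (hl.unique h'.symm)
  have h0 := hcl _ _ hx.symm (.inl rfl)
  have h1 := h.lt_length
  rcases x with x | x <;> simp only [endPt, Prod.mk.injEq] at h0 <;> omega

end Timing
end Diagram

/-! ### The standard form of a totally descending diagram -/

theorem caps_succ (n : ℕ) : caps (n + 1) = caps n ++ [⟨.cap, n⟩] := by
  induction n with
  | zero => rfl
  | succ n ih =>
    conv_lhs => rw [caps, ih]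
    simp [caps]

/-- Nested maxima do not meet each other, so they are layered for every order of the labels. -/
theorem exists_std_caps {L : List ℕ} (h : L.Nodup) :
    ∃ s, Std (L.reverse ++ L) s ∧ Eqv 0 (caps L.length) s := by
  induction L with
  | nil => exact ⟨[], .nil, Eqv.refl _ _⟩
  | cons a L ih =>
    rw [List.nodup_cons] at h
    obtain ⟨s, h1, h2⟩ := ih h.2
    obtain ⟨s', h3, h4⟩ := h1.cap rfl (x := a) (by simpa using h.1)
    refine ⟨s', h3.congr (by simp), ?_⟩
    rw [List.length_cons, caps_succ]
    refine (h2.right _).trans ?_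
    simpa using h4

namespace Diagram

variable {m n : ℕ} (D : Diagram m n) (t : ℕ × ℕ → ℕ)

/-- The components, given by their least times, of the end points of the first `k` pieces. -/
def labels (k : ℕ) : List ℕ :=
  ((List.range m).map fun i => D.startTime t k (t (0, i))).reverse ++
    (List.range (D.width k)).map fun j => D.startTime t k (t (k, j))

variable {D t}

theorem length_labels (k : ℕ) : (D.labels t k).length = m + D.width k := by simp [labels]

/-- Strings beside the piece stay on their components, so outside the piece the labels change only
through the recomputation of start times. -/
theorem exists_labels_eq {k : ℕ} {p : Piece} (ht : D.Timing t) (hp : D.word[k]? = some p) :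
    ∃ u w, u.length = m + p.left ∧
      D.labels t k = u ++ ((List.range p.shape.ins).map fun j =>
        D.startTime t k (t (k, p.left + j))) ++ w ∧
      D.labels t (k + 1) = u.map (D.startTime t (k + 1)) ++ ((List.range p.shape.outs).map fun j =>
        D.startTime t (k + 1) (t (k + 1, p.left + j))) ++ w.map (D.startTime t (k + 1)) := by
  have hf := fits hp
  have hw := width_succ hp
  obtain ⟨r, hr⟩ := Nat.exists_eq_add_of_le hf
  have hw' : D.width (k + 1) = p.left + p.shape.outs + r := by
    rw [hw, hr, Piece.after]; omega
  refine ⟨((List.range m).map fun i => D.startTime t k (t (0, i))).reverse ++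
      (List.range p.left).map fun j => D.startTime t k (t (k, j)),
    (List.range r).map fun j => D.startTime t k (t (k, p.left + p.shape.ins + j)),
    by simp, ?_, ?_⟩
  · rw [labels, hr, List.range_add, List.range_add]
    simp [Function.comp_def]
  · rw [labels, hw', List.range_add, List.range_add]
    simp only [List.map_append, List.map_reverse, List.map_map, Function.comp_def,
      startTime_startTime (Nat.le_succ k), List.append_assoc]
    congr 2
    · refine List.map_congr_left fun j hj => ?_
      rw [List.mem_range] at hj
      refine (ht.link_min (j := k) ⟨p, hp, .inl ⟨rfl, by simp only; omega, ?_⟩⟩ (by omega)).symm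
      simp [Piece.down, hj]
    · congr 1
      refine List.map_congr_left fun j hj => ?_
      rw [List.mem_range] at hj
      refine (ht.link_min (j := k) ⟨p, hp, .inl ⟨rfl, by simp only; omega, ?_⟩⟩ (by omega)).symm
      simp only [Piece.down]
      rw [if_neg (by omega), if_pos (by omega)]
      congr 1
      omega

theorem of_mem_labels {k a : ℕ} (hk : k ≤ D.word.length) (ha : a ∈ D.labels t k) :
    ∃ τ, D.Passed t k τ ∧ a = D.startTime t k τ := by
  simp only [labels, List.mem_append, List.mem_reverse, List.mem_map, List.mem_range] at ha
  obtain ⟨i, hi, rfl⟩ | ⟨j, hj, rfl⟩ := ha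
  · exact ⟨_, ⟨_, ⟨Nat.zero_le _, hi⟩, Nat.zero_le _, rfl⟩, rfl⟩
  · exact ⟨_, ⟨_, ⟨hk, hj⟩, le_rfl, rfl⟩, rfl⟩

theorem passed_of_mem_labels {k a : ℕ} (hk : k ≤ D.word.length) (ha : a ∈ D.labels t k) :
    D.Passed t k a ∧ D.startTime t k a = a := by
  obtain ⟨τ, h, rfl⟩ := of_mem_labels hk ha
  exact ⟨startTime_passed h, startTime_startTime le_rfl τ⟩

theorem strictMonoOn_startTime {k : ℕ} {S : Set ℕ}
    (h : ∀ a ∈ S, ∀ b ∈ S, a < b → D.startTime t k a ≠ D.startTime t k b) :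
    StrictMonoOn (D.startTime t k) S := fun a ha b hb hab =>
  lt_of_le_of_ne (startTime_mono k hab.le) (h a ha b hb hab)

/-- The components of the first `k` pieces are intervals of times, named by their least elements.
The next piece fits the rule for layered words with these labels, and the new start times depend on
the resulting labels in a strictly increasing way, so that `Std.map` applies. -/
theorem Timing.exists_std (ht : D.Timing t) (hc : D.NoClosed) {k : ℕ} (hk : k ≤ D.word.length) :
    ∃ s, Std (D.labels t k) s ∧ Eqv 0 (caps m ++ sh m (D.word.take k)) s := by
  induction k with
  | zero =>
    have h : (List.map (fun i => t (0, i)) (List.range m)).Nodup := by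
      refine (List.nodup_map_iff_inj_on List.nodup_range).2 fun i hi j hj h => ?_
      rw [List.mem_range] at hi hj
      have := ht.inj (0, i) (0, j) ⟨Nat.zero_le _, hi⟩ ⟨Nat.zero_le _, hj⟩ h
      simpa using this
    obtain ⟨s, h1, h2⟩ := exists_std_caps h
    refine ⟨s, h1.congr ?_, by simpa using h2⟩
    simp only [labels, startTime_zero_left, width_zero]
  | succ k ih =>
    obtain ⟨s, hs, he⟩ := ih (by omega)
    obtain ⟨p, hp⟩ : ∃ p, D.word[k]? = some p := ⟨_, List.getElem?_eq_getElem (by omega)⟩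
    obtain ⟨u, w, hu, hl, hl'⟩ := exists_labels_eq ht hp
    have hf := fits hp
    have hw := width_succ hp
    have hE : ∀ s', Eqv 0 (s ++ [⟨p.shape, u.length⟩]) s' →
        Eqv 0 (caps m ++ sh m (D.word.take (k + 1))) s' := by
      intro s' h
      rw [List.take_add_one, hp, sh_append, ← List.append_assoc]
      refine (he.right _).trans ?_
      rw [hu, add_comm] at h
      exact h
    have hmem : ∀ a ∈ D.labels t k, D.Passed t k a ∧ D.startTime t k a = a :=
      fun a ha => passed_of_mem_labels (by omega) ha
    obtain ⟨sh', i⟩ := p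
    -- Only a minimum can merge two components, so otherwise distinct labels remain distinct.
    have hne : sh' ≠ .cup → ∀ a ∈ D.labels t k, ∀ b ∈ D.labels t k, a < b →
        D.startTime t (k + 1) a ≠ D.startTime t (k + 1) b := by
      intro hcup a ha b hb hab h
      obtain ⟨j, r, r', h1, -⟩ := ht.exists_cup hab (hmem a ha).1 (hmem b hb).1
        (by rw [(hmem a ha).2, (hmem b hb).2]; exact hab.ne) h
      rw [hp] at h1
      simp only [Option.some.injEq, Piece.mk.injEq] at h1
      exact hcup h1.1
    have hS := startTime_startTime (D := D) (t := t) (Nat.le_succ k)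
    rcases sh' with ε | _ | _
    · -- a crossing
      simp only [Shape.ins, Shape.outs, List.range_succ, List.range_zero, List.nil_append,
        List.map_append, List.map_cons, List.map_nil, add_zero, Piece.Fits] at hl hl' hE hf
      have hover := ht.over_first k ε i hp
      -- Start times are monotone, so an earlier component has the earlier time at the crossing and,
      -- by `hover`, the overcrossing.
      have hlt : ∀ a b, D.startTime t k a < D.startTime t k b → a < b := fun a b h => by
        by_contra hba
        exact absurd (startTime_mono (D := D) (t := t) k (not_lt.1 hba)) (by omega)
      have hcr : ∀ j, j = i ∨ j = i + 1 → D.startTime t (k + 1) (t (k, j)) =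
          D.startTime t (k + 1) (t (k + 1, 2 * i + 1 - j)) := by
        intro j hj
        refine ht.link_min (j := k) ⟨_, hp, .inl ⟨rfl, by simp only; omega, ?_⟩⟩ (by omega)
        have h1 : ¬ j < i := by omega
        have h2 : ¬ i + 2 ≤ j := by omega
        simp [Piece.down, Shape.ins, h1, h2]
      obtain ⟨s', h1, h2⟩ := hs.cross (u := u) (w := w) (ε := ε) (by rw [hl]; simp; exact ⟨rfl, rfl⟩)
        (fun h => by
          have := hlt _ _ h
          cases ε
          · simp only [overPt, underPt] at hover
            simp at hover
            omega
          · rfl)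
        (fun h => by
          have := hlt _ _ h
          cases ε
          · rfl
          · simp only [overPt, underPt] at hover
            simp at hover
            omega)
      refine ⟨s', (h1.map (f := D.startTime t (k + 1))
        (strictMonoOn_startTime fun a ha b hb => hne (by simp) a ?_ b ?_)).congr ?_, hE s' h2⟩
      · rw [hl]; simp at ha ⊢; tauto
      · rw [hl]; simp at hb ⊢; tauto
      · rw [hl']
        have c1 := hcr i (.inl rfl)
        have c2 := hcr (i + 1) (.inr rfl)
        rw [show 2 * i + 1 - i = i + 1 by omega] at c1
        rw [show 2 * i + 1 - (i + 1) = i by omega] at c2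
        simp [hS, c1, c2]
    · -- a minimum
      simp only [Shape.ins, Shape.outs, List.range_succ, List.range_zero, List.nil_append,
        List.map_append, List.map_cons, List.map_nil, add_zero, Piece.Fits, List.append_nil]
        at hl hl' hE hf
      have hxy := ht.startTime_cup_ne hc hp
      have hlink : D.NbrAt k (k, i) (k, i + 1) := by
        refine ⟨_, hp, .inl ⟨rfl, by simp only; omega, ?_⟩⟩
        simp [Piece.down, Shape.ins]
        omega
      -- The minimum is traversed in one step of time. Hence the later component starts exactly at
      -- its end of the minimum, and no label lies between the two.
      have hadj : ∀ a b, (a = t (k, i) ∧ b = t (k, i + 1) ∨ a = t (k, i + 1) ∧ b = t (k, i)) →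
          D.startTime t k a < D.startTime t k b → b = a + 1 ∧ D.startTime t k b = b := by
        intro a b hab h
        have hlt : a < b := by
          by_contra hba
          exact absurd (startTime_mono (D := D) (t := t) k (not_lt.1 hba)) (by omega)
        have hb : b = a + 1 := by
          have := ht.step _ _ _ hlink
          omega
        subst hb
        refine ⟨rfl, startTime_succ_of_not_link fun hl => ?_⟩
        rw [startTime_succ_of_link hl] at h
        omega
      have hm : D.startTime t (k + 1) (t (k, i)) = D.startTime t (k + 1) (t (k, i + 1)) :=
        ht.link_min hlink (by omega)
      obtain ⟨x, hx⟩ : ∃ x, x = D.startTime t k (t (k, i)) := ⟨_, rfl⟩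
      obtain ⟨y, hy⟩ : ∃ y, y = D.startTime t k (t (k, i + 1)) := ⟨_, rfl⟩
      have hFxy : D.startTime t (k + 1) x = D.startTime t (k + 1) y := by
        rw [hx, hy, hS, hS, hm]
      rw [← hx, ← hy] at hl hxy
      obtain ⟨s', h1, h2⟩ := hs.cup (u := u) (w := w) (x := x) (y := y) (by rw [hl]; simp) hxy (by
        rintro a ha ⟨h1, h2⟩
        have ha2 := (hmem a ha).2
        have key : ∀ c d, (c = t (k, i) ∧ d = t (k, i + 1) ∨ c = t (k, i + 1) ∧ d = t (k, i)) →
            D.startTime t k c < a → a < D.startTime t k d → False := by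
          intro c d hcd h3 h4
          obtain ⟨h5, h6⟩ := hadj c d hcd (h3.trans h4)
          have := startTime_mono (D := D) (t := t) k (show a ≤ c by omega)
          omega
        rcases lt_or_gt_of_ne hxy with h | h
        · refine key _ _ (.inl ⟨rfl, rfl⟩) ?_ ?_ <;> omega
        · refine key _ _ (.inr ⟨rfl, rfl⟩) ?_ ?_ <;> omega)
      have hxl : x ∈ D.labels t k := by rw [hl]; simp
      have hyl : y ∈ D.labels t k := by rw [hl]; simp
      -- The smaller of the merged labels has disappeared, so no two of the remaining ones can
      -- merge.
      have hmm : ∀ a ∈ (u ++ w).map (mergeLabel x y), a ∈ D.labels t k ∧ a ≠ min x y := by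
        intro a ha
        obtain ⟨b, hb, rfl⟩ := List.mem_map.1 ha
        unfold mergeLabel
        split_ifs with hb'
        · refine ⟨?_, by omega⟩
          rcases max_choice x y with h | h <;> rw [h]
          exacts [hxl, hyl]
        · refine ⟨?_, hb'⟩
          rw [hl]
          simp at hb ⊢
          tauto
      refine ⟨s', (h1.map (f := D.startTime t (k + 1))
        (strictMonoOn_startTime fun a ha b hb hab h => ?_)).congr ?_, hE s' h2⟩
      · obtain ⟨ha1, ha2⟩ := hmm a ha
        obtain ⟨hb1, hb2⟩ := hmm b hb
        obtain ⟨j, r, r', h1, h2, h3, h4⟩ := ht.exists_cup hab (hmem a ha1).1 (hmem b hb1).1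
          (by rw [(hmem a ha1).2, (hmem b hb1).2]; exact hab.ne) h
        rw [hp] at h1
        simp only [Option.some.injEq, Piece.mk.injEq, true_and] at h1
        subst h1
        rw [(hmem a ha1).2] at h3
        have h5 : D.startTime t k (t r) ≤ D.startTime t k (t r') :=
          startTime_mono k (by omega)
        rcases h2 with ⟨rfl, rfl⟩ | ⟨rfl, rfl⟩ <;> omega
      · rw [hl', List.map_map, List.map_append]
        have : D.startTime t (k + 1) ∘ mergeLabel x y = D.startTime t (k + 1) := by
          funext a
          simp only [Function.comp, mergeLabel]
          split_ifs with h
          · rw [h]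
            rcases le_total x y with h' | h'
            · rw [min_eq_left h', max_eq_right h', hFxy]
            · rw [min_eq_right h', max_eq_left h', hFxy]
          · rfl
        rw [this]
    · -- a maximum
      simp only [Shape.ins, Shape.outs, List.range_succ, List.range_zero, List.nil_append,
        List.map_append, List.map_cons, List.map_nil, add_zero, Piece.Fits, List.append_nil,
        Piece.after, Nat.sub_zero] at hl hl' hE hf hw
      have hlink : D.NbrAt k (k + 1, i) (k + 1, i + 1) := by
        refine ⟨_, hp, .inr ⟨rfl, by simp only; omega, ?_⟩⟩
        simp [Piece.up, Shape.outs]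
        omega
      -- `r` is the end of the maximum that is traversed first; its time is the fresh label.
      obtain ⟨r, r', hN, htt, h1r, h1r', hm⟩ : ∃ r r', D.NbrAt k r r' ∧ t r' = t r + 1 ∧
          r.1 = k + 1 ∧ r'.1 = k + 1 ∧
          ∀ j, j = i ∨ j = i + 1 → D.startTime t (k + 1) (t (k + 1, j)) =
            D.startTime t (k + 1) (t r) := by
        have := ht.link_min hlink (Nat.lt_succ_self k)
        rcases ht.step _ _ _ hlink with h | h
        · refine ⟨_, _, hlink, h, rfl, rfl, ?_⟩
          rintro j (rfl | rfl)
          exacts [rfl, this.symm]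
        · refine ⟨_, _, hlink.symm, h, rfl, rfl, ?_⟩
          rintro j (rfl | rfl)
          exacts [this, rfl]
      have hLk : D.Link t (k + 1) (t r) := ⟨k, r, r', by omega, hN, rfl, htt⟩
      have hnp : ¬ D.Passed t k (t r) := fun h => by
        have := ht.level_le hN.isPoint h
        omega
      have hnp' : ¬ D.Passed t k (t r + 1) := fun h => by
        rw [← htt] at h
        have := ht.level_le hN.symm.isPoint h
        omega
      -- Neither end of the maximum is linked to another time within the first `k + 1` pieces, so
      -- the new component consists of these two times only.
      have hnl : ∀ a, D.Passed t k a → D.startTime t (k + 1) a ≠ D.startTime t (k + 1) (t r) := by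
        intro a ha h
        have hne : a ≠ t r := fun e => hnp (e ▸ ha)
        have hne' : a ≠ t r + 1 := fun e => hnp' (e ▸ ha)
        rcases lt_or_gt_of_ne hne with hlt | hgt
        · have h3 := link_of_startTime_eq h (t r - 1) (by omega) (by omega)
          refine ht.not_link (τ := t r - 1) hN.isPoint (by omega) ?_ ?_ <;> rw [h1r]
          · exact h3
          · rw [show t r - 1 + 1 = t r by omega]
            exact hLk
        · have h3 := link_of_startTime_eq h.symm (t r + 1) (by omega) (by omega)
          refine ht.not_link (τ := t r) hN.symm.isPoint (by omega) ?_ ?_ <;> rw [h1r']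
          · exact hLk
          · exact h3
      obtain ⟨s', h1, h2⟩ := hs.cap (u := u) (w := w) (x := t r) hl fun h => hnp (hmem _ h).1
      refine ⟨s', (h1.map (f := D.startTime t (k + 1))
        (strictMonoOn_startTime fun a ha b hb hab => ?_)).congr ?_, hE s' h2⟩
      · have ha' : a = t r ∨ a ∈ D.labels t k := by rw [hl]; simp at ha ⊢; tauto
        have hb' : b = t r ∨ b ∈ D.labels t k := by rw [hl]; simp at hb ⊢; tauto
        rcases ha' with rfl | ha' <;> rcases hb' with rfl | hb'
        · exact absurd hab (lt_irrefl _)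
        · exact (hnl b (hmem b hb').1).symm
        · exact hnl a (hmem a ha').1
        · exact hne (by simp) a ha' b hb' hab
      · rw [hl']
        simp [hm]

end Diagram

theorem Diagram.exists_std_of_totallyDescending {n : ℕ} (D : Diagram n n) {c : Connector n}
    {b : List (Fin n ⊕ Fin n)} (h1 : D.NoClosed) (h2 : D.HasConn c) (h3 : D.TotallyDescending b) :
    ∃ l s, Std l s ∧ Pattern c l ∧ Eqv 0 (foldWord n D.word) s := by
  obtain ⟨t, ht⟩ := exists_timing h1 h3
  obtain ⟨s, hs, he⟩ := ht.exists_std h1 le_rfl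
  rw [List.take_length] at he
  refine ⟨_, s, hs, ?_, he⟩
  have hlen : (D.labels t D.word.length).length = n + n := by
    rw [length_labels, width_length]
  have hget : ∀ x, (D.labels t D.word.length)[pos x]? =
      some (D.startTime t D.word.length (t (D.endPt x))) := by
    rintro (i | j)
    · simp only [labels, pos, endPt]
      rw [List.getElem?_append_left (by simp; omega), List.getElem?_reverse (by simp; omega)]
      have hi : n - 1 - (n - 1 - (i : ℕ)) = i := by omega
      simp [hi]
    · simp only [labels, pos, endPt]
      rw [List.getElem?_append_right (by simp)]
      simp [width_length]
  have himp : ∀ x, (D.labels t D.word.length)[pos (c.partner x)]? =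
      (D.labels t D.word.length)[pos x]? := by
    intro x
    rw [hget, hget, ht.startTime_joined (h2 x)]
  refine ⟨hlen, fun x y => ⟨fun h => ?_, ?_⟩⟩
  -- A third end point with the label of `x` and its partner would contradict that each label occurs
  -- twice.
  · by_contra hxy
    push Not at hxy
    have hd := hs.double (D.startTime t D.word.length (t (D.endPt x)))
      (List.mem_of_getElem? (hget x))
    rw [count_eq_card, hlen] at hd
    have : ({pos x, pos (c.partner x), pos y} : Finset ℕ) ⊆
        (Finset.range (n + n)).filter fun k => (D.labels t D.word.length)[k]? =
          some (D.startTime t D.word.length (t (D.endPt x))) := by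
      intro k hk
      simp only [Finset.mem_insert, Finset.mem_singleton] at hk
      rw [Finset.mem_filter, Finset.mem_range, ← hget]
      rcases hk with rfl | rfl | rfl
      · exact ⟨pos_lt _, rfl⟩
      · exact ⟨pos_lt _, himp x⟩
      · exact ⟨pos_lt _, h.symm⟩
    have := Finset.card_le_card this
    rw [hd, Finset.card_eq_three.2 ⟨_, _, _, pos_injective.ne (c.partner_ne x).symm,
      pos_injective.ne hxy.1.symm, pos_injective.ne hxy.2.symm, rfl⟩] at this
    omega
  · rintro (rfl | rfl)
    · rfl
    · exact (himp x).symm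

namespace Diagram

/-! ### Traversals of arcs -/

variable {m n : ℕ} {D : Diagram m n}

theorem isPoint_endPt (x : Fin m ⊕ Fin n) : D.IsPoint (D.endPt x) := by
  rcases x with i | j
  · exact ⟨Nat.zero_le _, i.2⟩
  · exact ⟨le_rfl, by simp only [endPt, width_length]; exact j.2⟩

theorem exists_nbrAt_below {r : ℕ × ℕ} (hr : D.IsPoint r) (h : r.1 < D.word.length) :
    ∃ r', D.NbrAt r.1 r r' :=
  ⟨_, _, List.getElem?_eq_getElem h, .inl ⟨rfl, hr.2, rfl⟩⟩

theorem exists_nbrAt_above {r : ℕ × ℕ} {k : ℕ} (hr : D.IsPoint r) (h : r.1 = k + 1) :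
    ∃ r', D.NbrAt k r r' := by
  have := hr.1
  exact ⟨_, _, List.getElem?_eq_getElem (by omega), .inr ⟨h, h ▸ hr.2, rfl⟩⟩

theorem exists_endPt {r : ℕ × ℕ} (hr : D.IsPoint r) (h : r.1 = 0 ∨ r.1 = D.word.length) :
    ∃ x, D.endPt x = r := by
  obtain ⟨r1, r2⟩ := r
  obtain ⟨h1, h2⟩ := hr
  simp only at h h1 h2
  rcases h with rfl | rfl
  · exact ⟨.inl ⟨r2, h2⟩, rfl⟩
  · rw [width_length] at h2
    exact ⟨.inr ⟨r2, h2⟩, rfl⟩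

theorem Adj.isPoint {r r' : ℕ × ℕ} (h : D.Adj r r') : D.IsPoint r := by
  obtain ⟨k, h⟩ := adj_iff.1 h
  exact h.isPoint

theorem Adj.ne {r r' : ℕ × ℕ} (h : D.Adj r r') : r ≠ r' := by
  obtain ⟨k, h⟩ := adj_iff.1 h
  exact h.ne

theorem Joined.isPoint {r r' : ℕ × ℕ} (h : D.Joined r r') (hr : D.IsPoint r) : D.IsPoint r' := by
  cases h with
  | refl => exact hr
  | tail _ h => exact h.symm.isPoint

theorem joined_of_isChain {l : List (ℕ × ℕ)} {r : ℕ × ℕ} (h : (r :: l).IsChain D.Adj) :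
    ∀ p ∈ r :: l, D.Joined r p := by
  induction l generalizing r with
  | nil => simp only [List.mem_singleton, forall_eq]; exact .refl
  | cons q l ih =>
    rw [List.isChain_cons_cons] at h
    intro p hp
    rcases List.mem_cons.1 hp with rfl | hp
    · exact .refl
    · exact .head h.1 (ih h.2 p hp)

theorem exists_length_le (D : Diagram m n) :
    ∃ N, ∀ l : List (ℕ × ℕ), l.Nodup → (∀ p ∈ l, D.IsPoint p) → l.length ≤ N := by
  refine ⟨((Finset.range (D.word.length + 1)).biUnion fun k =>
    (Finset.range (D.width k)).image fun j => (k, j)).card, fun l hl hp => ?_⟩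
  rw [← List.toFinset_card_of_nodup hl]
  refine Finset.card_le_card fun p hp' => ?_
  have h := hp p (List.mem_toFinset.1 hp')
  simp only [Finset.mem_biUnion, Finset.mem_range, Finset.mem_image]
  exact ⟨p.1, by have := h.1; omega, p.2, h.2, rfl⟩

/-- From each end point a component can be traversed. -/
theorem exists_traverses (D : Diagram m n) (x : Fin m ⊕ Fin n) :
    ∃ l, D.Traverses (D.endPt x :: l) := by
  by_contra! hcon
  -- A chain without repetitions that does not yet contain all neighbours of its points can be
  -- prolonged, necessarily at its last point; as there are only finitely many points, this cannot
  -- go on.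
  have key : ∀ k, ∃ l, (D.endPt x :: l).Nodup ∧ (D.endPt x :: l).IsChain D.Adj ∧ l.length = k := by
    intro k
    induction k with
    | zero => exact ⟨[], by simp, by simp, rfl⟩
    | succ k ih =>
      obtain ⟨l, h1, h2, h3⟩ := ih
      have hc := List.isChain_iff_getElem.1 h2
      have hcl : ¬ ∀ p ∈ D.endPt x :: l, ∀ q, D.Adj p q → q ∈ D.endPt x :: l :=
        fun h => hcon l ⟨h1, h2, h⟩
      push Not at hcl
      obtain ⟨p, hp, q, hq, hn⟩ := hcl
      obtain ⟨a, ha, rfl⟩ := List.mem_iff_getElem.1 hp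
      have hlast : a = l.length := by
        by_contra hlt
        have ha1 : a + 1 < (D.endPt x :: l).length := by
          simp only [List.length_cons] at ha ⊢; omega
        have h4 := hc a (by simpa using ha1)
        have hn1 : q ≠ (D.endPt x :: l)[a + 1] := fun e => hn (e ▸ List.getElem_mem _)
        rcases Nat.eq_zero_or_pos a with rfl | h0
        · exact hn1 (adj_endPt hq h4)
        · obtain ⟨a, rfl⟩ := Nat.exists_eq_succ_of_ne_zero h0.ne'
          have h5 := (hc a (by simp only [Nat.succ_eq_add_one] at ha ⊢; omega)).symm
          rcases adj_three hq h4 h5 with e | e | e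
          · exact hn1 e
          · exact hn (e ▸ List.getElem_mem _)
          · have := h1.getElem_inj_iff.1 e
            omega
      subst hlast
      refine ⟨l ++ [q], ?_, ?_, by simp [h3]⟩
      · rw [← List.cons_append, List.nodup_append']
        exact ⟨h1, by simp, by simpa using hn⟩
      · rw [← List.cons_append, List.isChain_append]
        refine ⟨h2, by simp, ?_⟩
        intro p hp r hr
        simp only [List.head?_cons, Option.mem_def, Option.some.injEq] at hr
        rw [Option.mem_def, List.getLast?_eq_getElem?] at hp
        simp only [List.length_cons, Nat.add_sub_cancel] at hp
        rw [List.getElem?_eq_getElem ha, Option.some.injEq] at hp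
        rw [← hp, ← hr]
        exact hq
  obtain ⟨N, hN⟩ := exists_length_le D
  obtain ⟨l, h1, h2, h3⟩ := key N
  have := hN _ h1 fun p hp => (joined_of_isChain h2 p hp).isPoint (isPoint_endPt x)
  simp only [List.length_cons] at this
  omega

/-- A component that contains an end point contains another one. -/
theorem exists_joined_ne (hw : D.word ≠ []) (x : Fin m ⊕ Fin n) :
    ∃ y, y ≠ x ∧ D.Joined (D.endPt x) (D.endPt y) := by
  obtain ⟨l, hl⟩ := exists_traverses D x
  have h0 : 0 < D.word.length := List.length_pos_iff.2 hw
  have hc := List.isChain_iff_getElem.1 hl.chain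
  have ha : l.length < (D.endPt x :: l).length := by simp
  generalize hr : (D.endPt x :: l)[l.length] = r
  have hrl : r ∈ D.endPt x :: l := hr ▸ List.getElem_mem _
  have hj := joined_of_isChain hl.chain r hrl
  have hrp := hj.isPoint (isPoint_endPt x)
  have hprev : ∀ q, D.Adj r q → ∃ h : 0 < l.length, q = (D.endPt x :: l)[l.length - 1]'(by omega) := by
    intro q hq
    obtain ⟨b, hb, rfl⟩ := List.mem_iff_getElem.1 (hl.closed r hrl q hq)
    have hne : b ≠ l.length := by
      rintro rfl
      exact hq.ne hr.symm
    have hb' : b < l.length := by simp only [List.length_cons] at hb; omega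
    have := Traverses.eq_add_one_of_adj hl rfl hb ha hb' (by rw [hr]; exact hq.symm)
    exact ⟨by omega, by congr 1; omega⟩
  -- The last point of the traversal has no neighbour except its predecessor. At an inner level, its
  -- neighbours above and below would both be this predecessor.
  have hend : r.1 = 0 ∨ r.1 = D.word.length := by
    by_contra! hlev
    have hle := hrp.1
    obtain ⟨d, hd⟩ := exists_nbrAt_below hrp (by omega)
    obtain ⟨k, hk⟩ := Nat.exists_eq_succ_of_ne_zero hlev.1
    obtain ⟨u, hu⟩ := exists_nbrAt_above (k := k) hrp hk
    obtain ⟨h1, ed⟩ := hprev d (adj_iff.2 ⟨_, hd⟩)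
    obtain ⟨_, eu⟩ := hprev u (adj_iff.2 ⟨_, hu⟩)
    obtain rfl : d = u := by rw [ed, eu]
    have l1 := hd.symm.level
    have l2 := hu.symm.level
    obtain ⟨a, ha'⟩ := Nat.exists_eq_succ_of_ne_zero h1.ne'
    simp only [ha', Nat.succ_eq_add_one, Nat.add_sub_cancel] at ed
    rcases Nat.eq_zero_or_pos a with rfl | ha0
    · simp only [List.getElem_cons_zero] at ed
      rw [ed] at l1 l2
      rcases x with x | x <;> simp only [endPt] at l1 l2 <;> omega
    · obtain ⟨a, rfl⟩ := Nat.exists_eq_succ_of_ne_zero ha0.ne'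
      have h2 := (hc a (by simp only [List.length_cons] at ha ⊢; omega)).symm
      simp only [Nat.succ_eq_add_one] at ed
      rw [← ed] at h2
      obtain ⟨j, hj'⟩ := adj_iff.1 h2
      have l3 := hj'.level
      have e : (D.endPt x :: l)[a]'(by simp only [List.length_cons]; omega) = r := by
        rcases (show j = r.1 ∨ j = k by omega) with rfl | rfl
        · exact hj'.unique hd.symm
        · exact hj'.unique hu.symm
      rw [← hr] at e
      have := hl.nodup.getElem_inj_iff.1 e
      omega
  obtain ⟨y, rfl⟩ := exists_endPt hrp hend
  refine ⟨y, ?_, hj⟩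
  rintro rfl
  obtain ⟨q, hq⟩ : ∃ q, D.Adj (D.endPt y) q := by
    rcases y with i | j
    · obtain ⟨q, hq⟩ := exists_nbrAt_below hrp h0
      exact ⟨q, adj_iff.2 ⟨_, hq⟩⟩
    · obtain ⟨k, hk⟩ := Nat.exists_eq_succ_of_ne_zero h0.ne'
      obtain ⟨q, hq⟩ := exists_nbrAt_above hrp (k := k) hk
      exact ⟨q, adj_iff.2 ⟨_, hq⟩⟩
  obtain ⟨h1, -⟩ := hprev q hq
  have : (D.endPt y :: l)[l.length] = (D.endPt y :: l)[0] := hr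
  have := hl.nodup.getElem_inj_iff.1 this
  omega

/-! ### Colourings -/

variable (D) in
/-- A colouring of the points that is constant on the components, such that each crossing is
between two colours, the string with the smaller one being over, and no two crossings are between
the same colours. -/
structure Coloring (L : ℕ × ℕ → ℕ) : Prop where
  adj : ∀ r r', D.Adj r r' → L r = L r'
  over_lt : ∀ k ε i, D.word[k]? = some ⟨.cross ε, i⟩ → L (overPt k ε i) < L (underPt k ε i)
  once : ∀ k ε i k' ε' i', D.word[k]? = some ⟨.cross ε, i⟩ → D.word[k']? = some ⟨.cross ε', i'⟩ →
    s(L (k, i), L (k, i + 1)) = s(L (k', i'), L (k', i' + 1)) → k = k'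

theorem Coloring.joined {L : ℕ × ℕ → ℕ} (h : D.Coloring L) {r r' : ℕ × ℕ} (hj : D.Joined r r') :
    L r = L r' := by
  induction hj with
  | refl => rfl
  | tail _ h2 ih => rw [ih, h.adj _ _ h2]

theorem Coloring.crossOnce {L : ℕ × ℕ → ℕ} (h : D.Coloring L) : D.CrossOnce := by
  constructor
  · intro k ε i hp hj
    have h1 := h.over_lt k ε i hp
    have h2 := h.joined hj
    cases ε <;> simp only [overPt, underPt] at h1 <;> simp at h1 <;> omega
  · intro k ε i k' ε' i' hp hp' hj
    refine h.once k ε i k' ε' i' hp hp' ?_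
    rcases hj with ⟨h1, h2⟩ | ⟨h1, h2⟩ <;> rw [h.joined h1, h.joined h2]
    exact Sym2.eq_swap

/-- The component of `x` ends at another end point of the same colour, which must be the partner. -/
theorem Coloring.hasConn {D : Diagram n n} {L : ℕ × ℕ → ℕ} (h : D.Coloring L) {c : Connector n}
    (hc : ∀ x y, L (D.endPt x) = L (D.endPt y) → y = x ∨ y = c.partner x) (hw : D.word ≠ []) :
    D.HasConn c := by
  intro x
  obtain ⟨y, h1, h2⟩ := exists_joined_ne hw x
  rwa [← (hc x y (h.joined h2)).resolve_left h1]

/-- The arcs are traversed from the base points, so colours do not decrease along the concatenation;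
the overcrossing has the smaller colour and therefore comes first. -/
theorem Coloring.totallyDescending {D : Diagram n n} {L : ℕ × ℕ → ℕ} (h : D.Coloring L)
    {c : Connector n} {b : List (Fin n ⊕ Fin n)} (hb : c.IsBase b) (h1 : D.NoClosed)
    (h2 : D.HasConn c) 
    (hL : b.Pairwise fun x y => L (D.endPt x) < L (D.endPt y)) : D.TotallyDescending b := by
  choose tr htr using exists_traverses D
  have hmem : ∀ x, ∀ p ∈ D.endPt x :: tr x, L p = L (D.endPt x) := fun x p hp =>
    (h.joined (joined_of_isChain (htr x).chain p hp)).symm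
  have hfl : ∀ p, p ∈ (b.map fun x => D.endPt x :: tr x).flatten ↔ D.IsPoint p := by
    intro p
    simp only [List.mem_flatten, List.mem_map, exists_exists_and_eq_and]
    constructor
    · rintro ⟨x, -, hp⟩
      exact (joined_of_isChain (htr x).chain p hp).isPoint (isPoint_endPt x)
    · intro hp
      obtain ⟨x, hx⟩ := h1 p hp
      by_cases hxb : x ∈ b
      · exact ⟨x, hxb, hx.mem_of_traverses (htr x) (by simp)⟩
      · refine ⟨c.partner x, (hb.2 x).2 hxb, ?_⟩
        have h3 := h2 (c.partner x)
        rw [c.partner_partner] at h3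
        exact Joined.mem_of_traverses (htr _) (Relation.ReflTransGen.trans h3 hx) (by simp)
  have hlt : ((b.map fun x => D.endPt x :: tr x).flatten).Pairwise fun p q => L p ≤ L q := by
    rw [List.pairwise_flatten, List.pairwise_map]
    constructor
    · intro l hl
      obtain ⟨x, hx, rfl⟩ := List.mem_map.1 hl
      rw [List.pairwise_iff_getElem]
      intro i j hi hj _
      rw [hmem x _ (List.getElem_mem hi), hmem x _ (List.getElem_mem hj)]
    · refine hL.imp ?_
      intro x y hxy p hp q hq
      rw [hmem x p hp, hmem y q hq]
      exact hxy.le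
  refine ⟨b.map fun x => D.endPt x :: tr x, [], ?_, ?_, by simp, ?_, by simpa using hfl, ?_⟩
  · simp [Function.comp_def]
  · intro l hl
    rw [List.append_nil] at hl
    obtain ⟨x, hx, rfl⟩ := List.mem_map.1 hl
    exact htr x
  · rw [List.append_nil, List.nodup_flatten, List.pairwise_map]
    constructor
    · intro l hl
      obtain ⟨x, hx, rfl⟩ := List.mem_map.1 hl
      exact (htr x).nodup
    · refine hL.imp ?_
      intro x y hxy p hp hq
      have := hmem x p hp
      have := hmem y p hq
      omega
  · intro k ε i hp
    rw [List.append_nil]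
    have ho := h.over_lt k ε i hp
    by_contra hle
    rw [not_lt] at hle
    have hf := fits hp
    have hk : k < D.word.length := by
      by_contra h
      rw [List.getElem?_eq_none (by omega)] at hp
      cases hp
    simp only [Piece.Fits, Shape.ins] at hf
    have hop := (hfl (overPt k ε i)).2 (by cases ε <;> exact ⟨hk.le, by simp [overPt]; omega⟩)
    have hup := (hfl (underPt k ε i)).2 (by cases ε <;> exact ⟨hk.le, by simp [underPt]; omega⟩)
    have hne : overPt k ε i ≠ underPt k ε i := fun e => by rw [e] at ho; omega
    have hlt' := lt_of_le_of_ne hle fun e => hne ((List.idxOf_inj hup).1 e).symm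
    have h5 := (List.pairwise_iff_getElem.1 hlt) _ _ (List.idxOf_lt_length_iff.2 hup)
      (List.idxOf_lt_length_iff.2 hop) hlt'
    rw [List.getElem_idxOf, List.getElem_idxOf] at h5
    omega

end Diagram

/-! ### Coloured words -/

/-- The piece `p` leads from the colours `l` of its upper ends to the colours `l'` of its lower
ends, and `c` lists the pairs of colours that cross in it. -/
inductive PieceColored : Piece → List ℕ → List ℕ → List (Sym2 ℕ) → Prop
  | cross (u w : List ℕ) (x y : ℕ) (hxy : x ≠ y) :
      PieceColored ⟨.cross (decide (x < y)), u.length⟩ (u ++ x :: y :: w) (u ++ y :: x :: w) [s(x, y)]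
  | cup (u w : List ℕ) (x : ℕ) : PieceColored ⟨.cup, u.length⟩ (u ++ x :: x :: w) (u ++ w) []
  | cap (u w : List ℕ) (x : ℕ) : PieceColored ⟨.cap, u.length⟩ (u ++ w) (u ++ x :: x :: w) []

/-- The word leads from the colours `l` at the top to the colours `l'` at the bottom, and `cs`
lists the pairs of colours that cross in it. -/
inductive Colored : List ℕ → List Piece → List ℕ → List (Sym2 ℕ) → Prop
  | nil (l : List ℕ) : Colored l [] l []
  | cons {p : Piece} {l l₁ l' : List ℕ} {w : List Piece} {c cs : List (Sym2 ℕ)}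
      (hp : PieceColored p l l₁ c) (hw : Colored l₁ w l' cs) : Colored l (p :: w) l' (c ++ cs)

theorem PieceColored.colored {p : Piece} {l l' : List ℕ} {c : List (Sym2 ℕ)}
    (h : PieceColored p l l' c) : Colored l [p] l' c := by
  simpa using Colored.cons h (.nil l')

theorem Colored.append {l l' l'' : List ℕ} {w v : List Piece} {cs ds : List (Sym2 ℕ)}
    (h : Colored l w l' cs) (h' : Colored l' v l'' ds) : Colored l (w ++ v) l'' (cs ++ ds) := by
  induction h with
  | nil => exact h'
  | cons hp _ ih =>
    rw [List.append_assoc, List.cons_append]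
    exact .cons hp (ih h')

theorem PieceColored.append_left {p : Piece} {l l' : List ℕ} {c : List (Sym2 ℕ)}
    (h : PieceColored p l l' c) (t : List ℕ) :
    PieceColored ⟨p.shape, p.left + t.length⟩ (t ++ l) (t ++ l') c := by
  cases h with
  | cross u w x y hxy => simpa [add_comm] using PieceColored.cross (t ++ u) w x y hxy
  | cup u w x => simpa [add_comm] using PieceColored.cup (t ++ u) w x
  | cap u w x => simpa [add_comm] using PieceColored.cap (t ++ u) w x

theorem Colored.append_left {l l' : List ℕ} {w : List Piece} {cs : List (Sym2 ℕ)}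
    (h : Colored l w l' cs) (t : List ℕ) : Colored (t ++ l) (sh t.length w) (t ++ l') cs := by
  induction h with
  | nil => exact .nil _
  | cons hp _ ih => exact .cons (hp.append_left t) ih

theorem Colored.runs {l l' : List ℕ} {w : List Piece} {cs : List (Sym2 ℕ)}
    (h : Colored l w l' cs) : Runs w l.length l'.length := by
  induction h with
  | nil => rfl
  | cons hp _ ih =>
    refine ⟨?_, ?_⟩
    · cases hp <;> simp [Piece.Fits, Shape.ins]
    · convert ih using 1
      cases hp <;> simp [Piece.after, Shape.ins, Shape.outs] <;> omega

theorem colored_cups (t r : List ℕ) : Colored (t ++ (t.reverse ++ r)) (cups t.length) r [] := by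
  induction t using List.reverseRecOn with
  | nil => exact .nil r
  | append_singleton t x ih =>
    rw [List.length_append, List.length_singleton, cups]
    refine Colored.cons (c := []) (cs := []) ?_ ih
    simpa using PieceColored.cup t (t.reverse ++ r) x

/-- The string `a` crosses each string of `v` exactly once; the signs are chosen by the order of the
colours. -/
theorem exists_colored_pull {a : ℕ} (v : List ℕ) (ha : a ∉ v) (u w : List ℕ) :
    ∃ p, Colored (u ++ a :: (v ++ w)) p (u ++ (v ++ a :: w)) (v.map fun y => s(a, y)) ∧
      ∀ q ∈ p, q.shape ≠ .cup := by
  induction v generalizing u with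
  | nil => exact ⟨[], .nil _, by simp⟩
  | cons y v ih =>
    rw [List.mem_cons, not_or] at ha
    obtain ⟨p, h1, h2⟩ := ih ha.2 (u ++ [y])
    have h3 : Colored (u ++ y :: a :: (v ++ w)) p (u ++ (y :: v ++ a :: w))
        (v.map fun y => s(a, y)) := by simpa using h1
    exact ⟨_, .cons (.cross u (v ++ w) a y ha.1) h3, List.forall_mem_cons.2 ⟨by simp, h2⟩⟩

/-- An innermost pair of equal labels. -/
theorem Double.exists_split {l : List ℕ} (h : Double l) (hl : l ≠ []) :
    ∃ u v w a, l = u ++ a :: (v ++ a :: w) ∧ v.Nodup ∧ a ∉ u ++ v ++ w ∧ Double (u ++ v ++ w) := by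
  have hex : ∃ k u v w a, l = u ++ a :: (v ++ a :: w) ∧ v.length = k := by
    obtain ⟨a, l', rfl⟩ := List.exists_cons_of_ne_nil hl
    have hc := h a (by simp)
    rw [List.count_cons_self] at hc
    obtain ⟨v, w, rfl⟩ := List.append_of_mem (List.count_pos_iff.1 (show 0 < l'.count a by omega))
    exact ⟨_, [], v, w, a, rfl, rfl⟩
  classical
  -- The two occurrences are chosen as close together as possible; a repetition between them would
  -- be a closer pair.
  obtain ⟨u, v, w, a, hl', hk⟩ := Nat.find_spec hex
  have hc := h a (by rw [hl']; simp)
  rw [hl'] at hc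
  simp only [List.count_append, List.count_cons_self] at hc
  have ha : a ∉ u ++ v ++ w := by
    rw [← List.count_eq_zero, List.count_append, List.count_append]; omega
  refine ⟨u, v, w, a, hl', ?_, ha, ?_⟩
  · by_contra hn
    obtain ⟨y, hy⟩ := List.exists_duplicate_iff_not_nodup.2 hn
    rw [List.duplicate_iff_sublist] at hy
    obtain ⟨v₁, v₂, rfl, h1, h2⟩ := List.cons_sublist_iff.1 hy
    obtain ⟨p, q, rfl⟩ := List.append_of_mem h1
    obtain ⟨p', q', rfl⟩ := List.append_of_mem (List.singleton_sublist.1 h2)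
    refine Nat.find_min hex (m := (q ++ p').length) ?_
      ⟨u ++ a :: p, q ++ p', q' ++ a :: w, y, by rw [hl']; simp, rfl⟩
    rw [← hk]
    simp only [List.length_append, List.length_cons]
    omega
  · intro y hy
    have hne : a ≠ y := fun e => ha (e ▸ hy)
    have := h y (by rw [hl']; simp at hy ⊢; tauto)
    rw [hl'] at this
    simp only [List.count_append, List.count_cons_of_ne hne] at this ⊢
    omega

/-- Every arrangement of pairs of end points on a line is joined by arcs that cross at most
once. -/
theorem exists_colored {l : List ℕ} (h : Double l) :
    ∃ p cs, Colored [] p l cs ∧ (∀ q ∈ p, q.shape ≠ .cup) ∧ cs.Nodup ∧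
      ∀ e ∈ cs, ∀ x ∈ e, x ∈ l := by
  induction hn : l.length using Nat.strong_induction_on generalizing l with
  | _ n ih =>
    rcases eq_or_ne l [] with rfl | hl
    · exact ⟨[], [], .nil _, by simp, by simp, by simp⟩
    · obtain ⟨u, v, w, a, rfl, hv, ha, hd⟩ := h.exists_split hl
      obtain ⟨p, cs, h1, h2, h3, h4⟩ := ih (u ++ v ++ w).length
        (by rw [← hn]; simp only [List.length_append, List.length_cons]; omega) hd rfl
      have hav : a ∉ v := fun h => ha (by simp [h])
      obtain ⟨q, h5, h6⟩ := exists_colored_pull v hav (u ++ [a]) w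
      have h7 := PieceColored.cap u (v ++ w) a
      rw [List.append_assoc] at h1
      refine ⟨_, _, (h1.append h7.colored).append (by simpa using h5), ?_, ?_, ?_⟩
      · intro r hr
        simp only [List.mem_append, List.mem_singleton] at hr
        rcases hr with (hr | rfl) | hr
        exacts [h2 r hr, by simp, h6 r hr]
      -- The new crossings all involve the fresh colour `a`, each with a different colour of `v`.
      · rw [List.append_nil, List.nodup_append']
        refine ⟨h3, hv.map fun x y hxy => ?_, ?_⟩
        · exact Sym2.congr_right.1 hxy
        · intro e he he'
          obtain ⟨y, -, rfl⟩ := List.mem_map.1 he'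
          exact ha (h4 _ he a (by simp))
      · intro e he x hx
        simp only [List.append_nil, List.mem_append, List.mem_map] at he
        rcases he with he | ⟨y, hy, rfl⟩
        · have := h4 e he x hx
          simp at this ⊢
          tauto
        · rcases Sym2.mem_iff.1 hx with rfl | rfl <;> simp [hy]

/-- The pair of colours at the positions `i` and `i + 1`. -/
def colorPair (l : List ℕ) (i : ℕ) : Sym2 ℕ := s(l.getD i 0, l.getD (i + 1) 0)

/-- The list of colours at each level is recorded, so that the colour of a point can be read off
from its level and position. -/
theorem Colored.exists_levels {l l' : List ℕ} {w : List Piece} {cs : List (Sym2 ℕ)}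
    (h : Colored l w l' cs) (hcs : cs.Nodup) :
    ∃ lv : ℕ → List ℕ, lv 0 = l ∧ lv w.length = l' ∧
      (∀ k p, w[k]? = some p → ∃ c, PieceColored p (lv k) (lv (k + 1)) c) ∧
      (∀ k ε i, w[k]? = some ⟨.cross ε, i⟩ → colorPair (lv k) i ∈ cs) ∧
      ∀ k ε i k' ε' i', w[k]? = some ⟨.cross ε, i⟩ → w[k']? = some ⟨.cross ε', i'⟩ →
        colorPair (lv k) i = colorPair (lv k') i' → k = k' := by
  induction h with
  | nil l => exact ⟨fun _ => l, rfl, rfl, by simp, by simp, by simp⟩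
  | @cons p l l₁ l' w c cs hp hw ih =>
    rw [List.nodup_append'] at hcs
    obtain ⟨lv, h0, h1, h2, h3, h4⟩ := ih hcs.2.1
    have hfirst : ∀ ε i, p = ⟨.cross ε, i⟩ → colorPair l i ∈ c := by
      intro ε i hpi
      cases hp with
      | cross u w x y hxy =>
        simp only [Piece.mk.injEq] at hpi
        rw [← hpi.2]
        simp [colorPair]
      | cup => simp at hpi
      | cap => simp at hpi
    refine ⟨fun k => k.casesOn l lv, rfl, h1, ?_, ?_, ?_⟩
    · rintro (_ | k) q hq
      · rw [List.getElem?_cons_zero, Option.some.injEq] at hq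
        subst hq
        exact ⟨c, by simpa [h0] using hp⟩
      · exact h2 k q (by simpa using hq)
    · rintro (_ | k) ε i hq
      · exact List.mem_append_left _ (hfirst ε i (by simpa using hq))
      · exact List.mem_append_right _ (h3 k ε i (by simpa using hq))
    · rintro (_ | k) ε i (_ | k') ε' i' hq hq' he
      · rfl
      · exact (hcs.2.2 (hfirst ε i (by simpa using hq))
          (he ▸ h3 k' ε' i' (by simpa using hq'))).elim
      · exact (hcs.2.2 (hfirst ε' i' (by simpa using hq'))
          (he ▸ h3 k ε i (by simpa using hq))).elim
      · rw [h4 k ε i k' ε' i' (by simpa using hq) (by simpa using hq') he]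

namespace Diagram

theorem exists_coloring {m n : ℕ} (D : Diagram m n) {l l' : List ℕ} {cs : List (Sym2 ℕ)}
    (h : Colored l D.word l' cs) (hcs : cs.Nodup) :
    ∃ L, D.Coloring L ∧ (∀ i : Fin m, L (D.endPt (.inl i)) = l.getD i 0) ∧
      ∀ j : Fin n, L (D.endPt (.inr j)) = l'.getD j 0 := by
  obtain ⟨lv, h0, h1, h2, -, h4⟩ := h.exists_levels hcs
  refine ⟨fun r => (lv r.1).getD r.2 0, ⟨?_, ?_, ?_⟩, ?_, ?_⟩
  · have key : ∀ r r', D.Strand r r' → (lv r.1).getD r.2 0 = (lv r'.1).getD r'.2 0 := by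
      intro r r' h
      cases h with
      | left k p j hp hj =>
        obtain ⟨c, hc⟩ := h2 k p hp
        simp only
        generalize lv k = a at hc ⊢
        generalize lv (k + 1) = b at hc ⊢
        cases hc <;> simp only at hj <;> simp [List.getElem?_append_left, hj]
      | right k p j hp hj =>
        obtain ⟨c, hc⟩ := h2 k p hp
        simp only
        generalize lv k = a at hc ⊢
        generalize lv (k + 1) = b at hc ⊢
        cases hc <;> simp [Shape.ins, Shape.outs, List.getElem?_append_right, add_assoc, add_comm 2 j]
      | crossRight k ε i hp =>
        obtain ⟨c, hc⟩ := h2 k _ hp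
        simp only
        generalize lv k = a at hc ⊢
        generalize lv (k + 1) = b at hc ⊢
        cases hc; simp
      | crossLeft k ε i hp =>
        obtain ⟨c, hc⟩ := h2 k _ hp
        simp only
        generalize lv k = a at hc ⊢
        generalize lv (k + 1) = b at hc ⊢
        cases hc; simp
      | cup k i hp =>
        obtain ⟨c, hc⟩ := h2 k _ hp
        simp only
        generalize lv k = a at hc ⊢
        generalize lv (k + 1) = b at hc ⊢
        cases hc; simp
      | cap k i hp =>
        obtain ⟨c, hc⟩ := h2 k _ hp
        simp only
        generalize lv k = a at hc ⊢
        generalize lv (k + 1) = b at hc ⊢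
        cases hc; simp
    rintro r r' (h | h)
    exacts [key _ _ h, (key _ _ h).symm]
  · intro k ε i hp
    obtain ⟨c, hc⟩ := h2 k _ hp
    simp only [overPt, underPt]
    generalize lv (k + 1) = b at hc
    generalize ha : lv k = a at hc
    cases hc with
    | cross u w x y hxy => by_cases h : x < y <;> simp [h, ha]; omega
  · exact h4
  · intro i; simp only [endPt, h0]
  · intro j; simp only [endPt, h1]

end Diagram

/-! ### Existence of totally descending diagrams -/

theorem getElem?_cups {n i : ℕ} (h : i < n) : (cups n)[i]? = some ⟨.cup, n - 1 - i⟩ := by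
  induction n generalizing i with
  | zero => omega
  | succ n ih =>
    rw [cups]
    rcases i with _ | i
    · simp
    · rw [List.getElem?_cons_succ, ih (by omega)]
      congr 2
      omega

theorem length_cups (n : ℕ) : (cups n).length = n := by
  induction n with
  | zero => rfl
  | succ n ih => simp [cups, ih]

namespace Diagram

variable {m n : ℕ} {D : Diagram m n}

theorem adj_left {k j : ℕ} {p : Piece} (hp : D.word[k]? = some p) (hj : j < p.left) :
    D.Adj (k, j) (k + 1, j) := .inl (.left k p j hp hj)

theorem joined_top {j k : ℕ} (hk : k ≤ D.word.length)
    (h : ∀ i p, i < k → D.word[i]? = some p → j < p.left) : D.Joined (0, j) (k, j) := by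
  induction k with
  | zero => exact .refl
  | succ k ih =>
    have hp := List.getElem?_eq_getElem (l := D.word) (i := k) (by omega)
    exact .tail (ih (by omega) fun i p hi => h i p (by omega)) (adj_left hp (h k _ (by omega) hp))

/-- Diagrams that consist of strings going down from maxima, followed by nested minima joining them
to the strings from the top, have no closed components. -/
theorem noClosed_of_word_eq {D : Diagram n n} {s : List Piece} (hs : ∀ q ∈ s, q.shape ≠ .cup)
    (hw : D.word = unfoldWord n s) : D.NoClosed := by
  have hlen : D.word.length = s.length + n := by
    rw [hw, unfoldWord, List.length_append, length_cups, sh, List.length_map]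
  have hfirst : ∀ k p, k < s.length → D.word[k]? = some p → p.shape ≠ .cup ∧ n ≤ p.left := by
    intro k p hk hp
    rw [hw, unfoldWord, List.getElem?_append_left (by simpa [sh] using hk), sh,
      List.getElem?_map, List.getElem?_eq_getElem hk] at hp
    simp only [Option.map_some, Option.some.injEq] at hp
    rw [← hp]
    exact ⟨hs s[k] (List.getElem_mem hk), by simp⟩
  have hlast : ∀ i, i < n → D.word[s.length + i]? = some ⟨.cup, n - 1 - i⟩ := by
    intro i hi
    rw [hw, unfoldWord, List.getElem?_append_right (by simp [sh])]
    simpa [sh] using getElem?_cups hi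
  -- There are no minima in this part, so every point can be followed downwards to level `s.length`.
  have hdown : ∀ d r, D.IsPoint r → r.1 + d = s.length → ∃ j, D.Joined (s.length, j) r := by
    intro d
    induction d with
    | zero =>
      rintro ⟨r1, r2⟩ - h
      simp only [add_zero] at h
      exact ⟨r2, h ▸ .refl⟩
    | succ d ih =>
      intro r hr h
      obtain ⟨r', hr'⟩ := exists_nbrAt_below hr (by omega)
      obtain ⟨p, hp, ⟨-, h1, h2⟩ | ⟨h1, -⟩⟩ := id hr'
      · have h3 : r'.1 = r.1 + 1 := by
          rw [h2, Piece.down]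
          split_ifs with c1 c2 c3
          · rfl
          · rfl
          · exact absurd c3 (hfirst _ p (by omega) hp).1
          · rfl
        obtain ⟨j, hj⟩ := ih r' hr'.symm.isPoint (by omega)
        exact ⟨j, hj.tail (adj_iff.2 ⟨_, hr'.symm⟩)⟩
      · omega
  -- There are no maxima in this part, so every point can be followed upwards to level `s.length`.
  have hup : ∀ d r, D.IsPoint r → r.1 = s.length + d → ∃ j, D.Joined (s.length, j) r := by
    intro d
    induction d with
    | zero =>
      rintro ⟨r1, r2⟩ - h
      simp only [add_zero] at h
      exact ⟨r2, h ▸ .refl⟩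
    | succ d ih =>
      intro r hr h
      have hrl := hr.1
      obtain ⟨r', hr'⟩ := exists_nbrAt_above (k := s.length + d) hr h
      obtain ⟨p, hp, ⟨h1, -⟩ | ⟨-, h1, h2⟩⟩ := id hr'
      · omega
      · have h3 : r'.1 = s.length + d := by
          rw [hlast d (by omega), Option.some.injEq] at hp
          rw [h2, Piece.up, ← hp]
          split_ifs with c1 c2 c3
          · simp only; omega
          · simp only; omega
          · exact absurd c3 (by simp)
          · simp only; omega
        obtain ⟨j, hj⟩ := ih r' hr'.symm.isPoint h3
        exact ⟨j, hj.tail (adj_iff.2 ⟨_, hr'.symm⟩)⟩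
  have htop : ∀ i j, i ≤ n → j + i < n → D.Joined (0, j) (s.length + i, j) := by
    intro i j hi hj
    refine joined_top (by omega) fun k p hk hp => ?_
    by_cases hks : k < s.length
    · have := (hfirst k p hks hp).2
      omega
    · obtain ⟨d, rfl⟩ := Nat.exists_eq_add_of_le (not_lt.1 hks)
      rw [hlast d (by omega), Option.some.injEq] at hp
      rw [← hp]
      simp only
      omega
  -- Each of the minima passed on the left removes two strings.
  have hright : ∀ i j, i ≤ n → n + i ≤ j → D.IsPoint (s.length, j) →
      D.Joined (s.length, j) (s.length + i, j - 2 * i) := by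
    intro i j hi hj hp
    induction i with
    | zero => exact .refl
    | succ i ih =>
      have h1 := ih (by omega) (by omega)
      have h2 := h1.isPoint hp
      refine h1.tail (adj_iff.2 ⟨s.length + i, _, hlast i (by omega), .inl ⟨rfl, h2.2, ?_⟩⟩)
      have c1 : ¬ j - 2 * i < n - 1 - i := by omega
      have c2 : n - 1 - i + 2 ≤ j - 2 * i := by omega
      simp only [Piece.down, Shape.ins, Shape.outs, c1, c2, if_true, if_false, Prod.mk.injEq]
      omega
  -- The strings at this level come from the top, or are joined to such strings by a minimum, or go
  -- on to the bottom.
  have hmid : ∀ j, D.IsPoint (s.length, j) → ∃ x, D.Joined (D.endPt x) (s.length, j) := by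
    intro j hj
    rcases lt_or_ge j n with h1 | h1
    · exact ⟨.inl ⟨j, h1⟩, htop 0 j (by omega) (by omega)⟩
    rcases lt_or_ge j (2 * n) with h2 | h2
    · refine ⟨.inl ⟨2 * n - 1 - j, by omega⟩, ?_⟩
      have h3 := htop (j - n) (2 * n - 1 - j) (by omega) (by omega)
      have h4 := hright (j - n) j (by omega) (by omega) hj
      refine Relation.ReflTransGen.trans (Relation.ReflTransGen.tail h3 (.inl ?_)) h4.symm
      have := Strand.cup (D := D) _ _ (hlast (j - n) (by omega))
      convert this using 2 <;> omega
    · have h4 := hright n j le_rfl (by omega) hj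
      have h5 := (h4.isPoint hj).2
      simp only at h5
      rw [← hlen, width_length] at h5
      refine ⟨.inr ⟨j - 2 * n, h5⟩, ?_⟩
      rw [← hlen] at h4
      exact h4.symm
  intro r hr
  have hj : ∃ j, D.Joined (s.length, j) r := by
    rcases le_total r.1 s.length with h | h
    · exact hdown (s.length - r.1) r hr (by omega)
    · exact hup (r.1 - s.length) r hr (by omega)
  obtain ⟨j, hj⟩ := hj
  obtain ⟨x, hx⟩ := hmid j (hj.symm.isPoint hr)
  exact ⟨x, Relation.ReflTransGen.trans hx hj⟩

end Diagram

theorem exists_rank {α : Type*} {b : List α} (hb : b.Nodup) :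
    ∃ f : α → ℕ, (b.Pairwise fun x y => f x < f y) ∧ ∀ x ∈ b, ∀ y ∈ b, f x = f y → x = y := by
  classical
  refine ⟨fun x => b.idxOf x, ?_, fun x hx y _ h => (List.idxOf_inj hx).1 h⟩
  rw [List.pairwise_iff_getElem]
  intro i j hi hj hij
  simp only [hb.idxOf_getElem]
  exact hij

open Classical in
/-- A numbering of the pairs of a connector in the order given by the base points. -/
theorem Connector.exists_rank {n : ℕ} {c : Connector n} {b : List (Fin n ⊕ Fin n)}
    (hb : c.IsBase b) : ∃ f : Fin n ⊕ Fin n → ℕ, (b.Pairwise fun x y => f x < f y) ∧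
      ∀ x y, f x = f y ↔ y = x ∨ y = c.partner x := by
  obtain ⟨f, h1, h2⟩ := Kauffman.exists_rank hb.1
  have hr : ∀ x, (if x ∈ b then x else c.partner x) ∈ b := fun x => by
    split_ifs with h
    exacts [h, (hb.2 x).2 h]
  refine ⟨fun x => f (if x ∈ b then x else c.partner x), ?_, fun x y => ⟨fun h => ?_, ?_⟩⟩
  · refine (List.Pairwise.and_mem.1 h1).imp ?_
    rintro x y ⟨hx, hy, h⟩
    simpa only [if_pos hx, if_pos hy] using h
  · have := h2 _ (hr x) _ (hr y) h
    split_ifs at this with hx hy hy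
    · exact .inl this.symm
    · exact .inr (by rw [this, c.partner_partner])
    · exact .inr this.symm
    · exact .inl (by rw [← c.partner_partner y, ← this, c.partner_partner])
  · rintro (rfl | rfl)
    · rfl
    · have := hb.2 x
      beta_reduce
      by_cases hx : x ∈ b
      · rw [if_pos hx, if_neg (fun h => this.1 h hx), c.partner_partner]
      · rw [if_neg hx, if_pos (this.2 hx)]

/-- Each pair is coloured by the rank of its base point. The folded end points are joined by arcs
crossing at most once, with smaller colours over, and the result is unfolded. -/
theorem exists_totallyDescending {n : ℕ} {c : Connector n} {b : List (Fin n ⊕ Fin n)}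
    (hb : c.IsBase b) :
    ∃ D : Diagram n n, D.NoClosed ∧ D.HasConn c ∧ D.CrossOnce ∧ D.TotallyDescending b := by
  obtain ⟨f, h1, h2⟩ := c.exists_rank hb
  obtain ⟨t, ht⟩ : ∃ t, t = List.ofFn fun i => f (.inl i) := ⟨_, rfl⟩
  obtain ⟨r, hr⟩ : ∃ r, r = List.ofFn fun j => f (.inr j) := ⟨_, rfl⟩
  have htl : t.length = n := by rw [ht, List.length_ofFn]
  have hrl : r.length = n := by rw [hr, List.length_ofFn]
  have hget : ∀ x, (t.reverse ++ r)[pos x]? = some (f x) := by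
    rintro (i | j)
    · simp only [pos]
      rw [List.getElem?_append_left (by simp; omega), List.getElem?_reverse (by omega), htl,
        show n - 1 - (n - 1 - (i : ℕ)) = i by omega, ht]
      simp
    · simp only [pos]
      rw [List.getElem?_append_right (by simp; omega), List.length_reverse, htl,
        Nat.add_sub_cancel_left, hr]
      simp
  have hp : Pattern c (t.reverse ++ r) :=
    ⟨by simp [htl, hrl], fun x y => by rw [hget, hget, Option.some.injEq, h2]⟩
  obtain ⟨s, cs, h3, h4, h5, -⟩ := exists_colored hp.double
  have h6 : Colored t (unfoldWord n s) r cs := by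
    have := (h3.append_left t).append (colored_cups t r)
    rw [List.append_nil, List.append_nil, htl] at this
    exact this
  have hruns := h6.runs
  rw [htl, hrl] at hruns
  obtain ⟨D, hD⟩ : ∃ D : Diagram n n, D.word = unfoldWord n s := ⟨⟨_, hruns⟩, rfl⟩
  obtain ⟨L, hL, hL1, hL2⟩ := D.exists_coloring (hD ▸ h6) h5
  have hLf : ∀ x, L (D.endPt x) = f x := by
    rintro (i | j)
    · rw [hL1, ht]; simp
    · rw [hL2, hr]; simp
  have hN := Diagram.noClosed_of_word_eq h4 hD
  have hC : D.HasConn c := by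
    -- For `n = 0` the word may be empty, but there are no end points to be joined.
    rcases Nat.eq_zero_or_pos n with rfl | hn
    · rintro (i | i) <;> exact i.elim0
    · refine hL.hasConn (fun x y h => ?_) fun h => ?_
      · rw [hLf, hLf] at h
        exact (h2 x y).1 h
      · rw [hD, unfoldWord, List.append_eq_nil_iff] at h
        have := length_cups n
        rw [h.2] at this
        simp at this
        omega
  exact ⟨D, hN, hC, hL.crossOnce, hL.totallyDescending hb hN hC (by simpa only [hLf] using h1)⟩

end Kauffman
end

open Kauffman in
theorem theorem4p2 (n : ℕ) :
    -- any spanning family of tangles without closed components, one for each connector, is a basis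
    (∀ T : Connector n → Diagram n n,
      (∀ c, (T c).NoClosed) → (∀ c, (T c).HasConn c) →
      Submodule.span Coeff (Set.range fun c => (T c).toMT) = (⊤ : Submodule Coeff (MT n)) →
      ∃ B : Module.Basis (Connector n) Coeff (MT n), ∀ c, B c = (T c).toMT) ∧
    -- there are totally descending tangles for all connectors and all choices of base points
    (∀ (c : Connector n) (b : List (Fin n ⊕ Fin n)), c.IsBase b →
      ∃ D : Diagram n n, D.NoClosed ∧ D.HasConn c ∧ D.CrossOnce ∧ D.TotallyDescending b) ∧
    -- they form a basis
    (∀ (b : Connector n → List (Fin n ⊕ Fin n)) (T : Connector n → Diagram n n),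
      (∀ c, (T c).NoClosed) → (∀ c, (T c).HasConn c) → (∀ c, (T c).TotallyDescending (b c)) →
      ∃ B : Module.Basis (Connector n) Coeff (MT n), ∀ c, B c = (T c).toMT) ∧
    -- the rank
    Module.Free Coeff (MT n) ∧
    Module.rank Coeff (MT n) = (Nat.doubleFactorial (2 * n - 1) : Cardinal) := by
  obtain ⟨B⟩ := exists_basis n
  -- `Scal` and `TMod n n` are `Coeff` and `MT n` by definition, so bases carry over directly.
  refine ⟨fun T _ _ hT => exists_basis_of_span (R := Scal) (M := TMod n n) B hT, ?_, ?_,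
    Module.Free.of_basis (R := Scal) (M := TMod n n) B, ?_⟩
  · exact fun c b hb => exists_totallyDescending hb
  · intro b T hT hc hd
    choose l s hs hp he using fun c => (T c).exists_std_of_totallyDescending (hT c) (hc c) (hd c)
    exact exists_basis_of_std T l s hs hp he
  · exact rank_tMod n
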